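/- **Conventions.** A hypergraph is a pair $H=(V,E)$ with $V$ finite and $E$ a set of non-empty subsets of $V$. A trimmed homomorphism from $H$ to $G$ is a map $\varphi\colon V(H)\to V(G)$ such that for every $e\in E(H)$ there is $e'\in E(G)$ with $\varphi(e)=e'\cap\mathrm{img}(\varphi)$; $\#\mathrm{TrimHom}(H,G)$ is their number. For $X\subseteq V(G)$ the induced trimmed sub-hypergraph is $G\langle X\rangle=(X,\{e\cap X: e\in E(G),\ e\cap X\neq\varnothing\})$; $\#\mathrm{IndTrimSub}(H,G)$ is the number of induced trimmed sub-hypergraphs of $G$ that are isomorphic to $H$. For a family $\mathcal H$ of hypergraphs, $\#\mathrm{TrimHom}(\mathcal H)$ and $\#\mathrm{IndTrimSub}(\mathcal H)$ are the problems of computing these numbers on input $(H,G)$ with $H\in\mathcal H$, parametrised by $|V(H)|$. Write $P\le^{\mathrm{FPT}}Q$ if there is a parametrised Turing reduction from $P$ to $Q$ (a deterministic oracle algorithm that runs in time $f(\kappa(x))\cdot|x|^{O(1)}$ and only queries instances of parameter at most $g(\kappa(x))$, with $f,g$ computable). $\#\mathrm{DomSet}$ is the problem of counting the dominating sets of size $k\ge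 1$ of a graph, with parameter $k$; a problem $P$ is $\#\mathrm W[2]$-hard if $\#\mathrm{DomSet}\le^{\mathrm{FPT}}P$. SETH is the hypothesis that for every $\delta>0$ there is $q\geq 1$ such that $q$-SAT on $n$ variables cannot be solved in time $O(2^{(1-\delta)n})$. Running times refer to random access machines with logarithmic cost. **Theorem.** For $k\ge 1$ let $B_k$ be the hypergraph with vertex set $\{1,\dots,k\}$ and the single edge $\{1,\dots,k\}$, and let $\mathcal B=\{B_k: k\ge 1\}$. 1. $\#\mathrm{TrimHom}(\mathcal B)$ is $\#\mathrm W[2]$-hard. Assuming SETH, it cannot be computed in time $f(k)\cdot O(|V(G)|^{k-\varepsilon})$ for any computable function $f$ and any $\varepsilon>0$; more precisely, assuming SETH, for every fixed $k\ge 3$ and every $\varepsilon>0$, the function $G\mapsto\#\mathrm{TrimHom}(B_k,G)$ cannot be computed in time $O(|V(G)|^{k-\varepsilon})$, not even on the non-empty hypergraphs $G$ with $|E(G)|\le|V(G)|$. 2. $\#\mathrm{IndTrimSub}(\mathcal B)$ can be computed in polynomial time. 3. For every $k\ge 1$ there is exactly one finitely supported function $\gamma$ from isomorphism classes of hypergraphs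 to $\mathbb Q$ such that $\#\mathrm{IndTrimSub}(B_k,G)=\sum_F\gamma(F)\cdot\#\mathrm{TrimHom}(F,G)$ for all hypergraphs $G$ (the trimmed-homomorphism expansion), and $\gamma(B_k)\neq 0$. Consequently complexity monotonicity fails: unless $\#\mathrm{DomSet}$ is fixed-parameter tractable, $\#\mathrm{TrimHom}(\mathcal B)\not\le^{\mathrm{FPT}}\#\mathrm{IndTrimSub}(\mathcal B)$. -/

import Mathlib

noncomputable section

/-! ## Hypergraphs, trimmed homomorphisms, induced trimmed sub-hypergraphs -/

/-- Finite hypergraphs with non-empty edges. The vertices are natural numbers, which loses nothing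
since every finite hypergraph is isomorphic to one of this kind. -/
@[ext]
structure FinHypergraph extends Hypergraph ℕ where
  finite : vertexSet.Finite
  empty_notMem : ∅ ∉ edgeSet

namespace FinHypergraph

/-- The vertex set, as a type. -/
abbrev V (H : FinHypergraph) : Type := {v : ℕ // v ∈ H.vertexSet}

/-- A set of vertices of `H` is an edge of `H`. -/
def IsEdge (H : FinHypergraph) (S : Set H.V) : Prop := Subtype.val '' S ∈ H.edgeSet

/-- `φ : V(H) → V(G)` is a trimmed homomorphism: the image of every edge of `H` has the form
`e' ∩ img φ` with `e'` an edge of `G`. -/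
def IsTrimHom (H G : FinHypergraph) (φ : H.V → G.V) : Prop :=
  ∀ e, H.IsEdge e → ∃ e', G.IsEdge e' ∧ φ '' e = e' ∩ Set.range φ

/-- The number of trimmed homomorphisms from `H` to `G`. -/
def numTrimHom (H G : FinHypergraph) : ℕ := Nat.card {φ : H.V → G.V // IsTrimHom H G φ}

/-- Isomorphism of hypergraphs: a bijection that preserves edges in both directions. -/
def Iso (H G : FinHypergraph) : Prop :=
  ∃ σ : H.V ≃ G.V, ∀ S : Set H.V, H.IsEdge S ↔ G.IsEdge (σ '' S)

/-- The trimmed sub-hypergraph of `G` induced by `X`: vertex set `X` (for `X ⊆ V(G)`), and edges the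
non-empty sets among the `e ∩ X`, `e ∈ E(G)`. -/
def trim (G : FinHypergraph) (X : Set ℕ) : FinHypergraph where
  vertexSet := G.vertexSet ∩ X
  edgeSet := {f | f.Nonempty ∧ ∃ e ∈ G.edgeSet, f = e ∩ X}
  subset_vertexSet_of_mem_edgeSet' := by
    rintro f ⟨-, e, he, rfl⟩
    exact Set.inter_subset_inter_left X (G.subset_vertexSet_of_mem_edgeSet' he)
  finite := G.finite.inter_of_left X
  empty_notMem := fun h => Set.not_nonempty_empty h.1

/-- The induced trimmed sub-hypergraphs of `G` that are isomorphic to `H`. -/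
def indTrimSub (H G : FinHypergraph) : Set FinHypergraph :=
  {G' | (∃ X ⊆ G.vertexSet, G' = G.trim X) ∧ G'.Iso H}

/-- The number of induced trimmed sub-hypergraphs of `G` that are isomorphic to `H`. -/
def numIndTrimSub (H G : FinHypergraph) : ℕ := (indTrimSub H G).ncard

/-- The hypergraph `B_k` on `k` vertices (here `0, …, k - 1`), whose only edge contains all of its
vertices. -/
def singleEdge (k : ℕ) (hk : 0 < k) : FinHypergraph where
  vertexSet := Set.Iio k
  edgeSet := {Set.Iio k}
  subset_vertexSet_of_mem_edgeSet' := by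
    rintro e rfl
    exact subset_rfl
  finite := Set.finite_Iio k
  empty_notMem := fun h => by
    have h0 : (0 : ℕ) ∈ (∅ : Set ℕ) := by
      rw [Set.mem_singleton_iff.mp h]; exact hk
    exact h0

/-- The family of all `B_k`, `k ≥ 1`. -/
def singleEdgeFamily : Set FinHypergraph := {H | ∃ k, ∃ hk : 0 < k, H = singleEdge k hk}

/-! ### Expansions over isomorphism classes -/

theorem Iso.refl (H : FinHypergraph) : H.Iso H := ⟨Equiv.refl _, fun S => by simp⟩

theorem Iso.symm {H G : FinHypergraph} : H.Iso G → G.Iso H := by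
  rintro ⟨σ, h⟩
  refine ⟨σ.symm, fun S => ?_⟩
  rw [h, ← Set.image_comp]
  simp

theorem Iso.trans {H G K : FinHypergraph} : H.Iso G → G.Iso K → H.Iso K := by
  rintro ⟨σ, h⟩ ⟨ρ, h'⟩
  refine ⟨σ.trans ρ, fun S => ?_⟩
  rw [h, h', ← Set.image_comp]
  rfl

instance isoSetoid : Setoid FinHypergraph := ⟨Iso, Iso.refl, Iso.symm, Iso.trans⟩

/-- Isomorphism classes of hypergraphs. -/
abbrev IsoClass : Type := Quotient isoSetoid

theorem numTrimHom_congr {H H' : FinHypergraph} (h : H.Iso H') (G : FinHypergraph) :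
    numTrimHom H G = numTrimHom H' G := by
  obtain ⟨σ, hσ⟩ := h
  refine Nat.card_congr (Equiv.subtypeEquiv (Equiv.arrowCongr σ (Equiv.refl _)) fun φ => ?_)
  have hr : Set.range (φ ∘ σ.symm) = Set.range φ := σ.symm.surjective.range_comp φ
  change IsTrimHom H G φ ↔ IsTrimHom H' G (φ ∘ σ.symm)
  unfold IsTrimHom
  rw [hr]
  constructor
  · intro hφ e he
    have h1 : H.IsEdge (σ.symm '' e) := by
      rw [hσ, ← Set.image_comp]; simpa using he
    obtain ⟨e', he', heq⟩ := hφ _ h1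
    exact ⟨e', he', by rw [Set.image_comp]; exact heq⟩
  · intro hφ e he
    obtain ⟨e', he', heq⟩ := hφ _ ((hσ e).1 he)
    refine ⟨e', he', ?_⟩
    rw [← heq, ← Set.image_comp]
    congr 1
    funext v
    simp

/-- The number of trimmed homomorphisms to `G` from a member of an isomorphism class. -/
def IsoClass.numTrimHom (F : IsoClass) (G : FinHypergraph) : ℕ :=
  Quotient.lift (fun H => FinHypergraph.numTrimHom H G) (fun _ _ h => numTrimHom_congr h G) F

/-- `g = ∑ F, γ F · #TrimHom(F, ·)`, a finite sum over isomorphism classes of hypergraphs. -/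
def IsTrimHomExpansion (g : FinHypergraph → ℕ) (γ : IsoClass →₀ ℚ) : Prop :=
  ∀ G : FinHypergraph, (g G : ℚ) = γ.sum fun F c => c * (F.numTrimHom G : ℚ)

end FinHypergraph

/-! ## The machine model

A random access machine with logarithmic cost, in structured form. A machine has finitely many
registers and finitely many infinite arrays, all of them holding natural numbers (a program mentions
only finitely many). The running time is the sum of the costs of the executed instructions; an
instruction costs one plus the bit lengths of the numbers and addresses that it works on. -/

inductive BinOp
  | add | sub | mul | div

def BinOp.eval : BinOp → ℕ → ℕ → ℕ
  | add, x, y => x + y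
  | sub, x, y => x - y
  | mul, x, y => x * y
  | div, x, y => x / y

/-- Programs. Registers and arrays are named by natural numbers.
* `const r c` sets register `r` to `c`;
* `op o r x y` sets register `r` to the result of the operation `o` on the registers `x`, `y`;
* `load r a i` sets register `r` to the entry of array `a` at the address in register `i`;
* `store a i x` writes register `x` into array `a` at the address in register `i`;
* `seq`, `ite`, `loop` are sequencing, the conditional on "register `r` is non-zero", and the loop
  that runs its body as long as register `r` is non-zero;
* `call p r a l` runs `p` as a procedure with its own, fresh memory on the word that consists of the
  first `l` entries of array `a` (`l` is a register) and writes its result to register `r`;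
* `query r a l` does the same with the oracle instead of a procedure. -/
inductive Prog
  | skip
  | const (r c : ℕ)
  | op (o : BinOp) (r x y : ℕ)
  | load (r a i : ℕ)
  | store (a i x : ℕ)
  | seq (p q : Prog)
  | ite (r : ℕ) (p q : Prog)
  | loop (r : ℕ) (p : Prog)
  | call (p : Prog) (r a l : ℕ)
  | query (r a l : ℕ)

/-- The memory of a machine: registers and arrays. -/
structure Memory where
  reg : ℕ → ℕ
  arr : ℕ → ℕ → ℕ

/-- Machines work on finite words of natural numbers; the size of a word is its total bit length,
plus one for each entry. -/
def wordSize (w : List ℕ) : ℕ := (w.map fun a => a.size + 1).sum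

namespace Memory

def setReg (σ : Memory) (r v : ℕ) : Memory := { σ with reg := Function.update σ.reg r v }

def setArr (σ : Memory) (a i v : ℕ) : Memory :=
  { σ with arr := Function.update σ.arr a (Function.update (σ.arr a) i v) }

/-- The word formed by the first `l` entries of array `a`. -/
def word (σ : Memory) (a l : ℕ) : List ℕ := (List.range l).map (σ.arr a)

/-- Initially, array `0` holds the input word, register `0` holds its length, and the rest is
zero. -/
def init (w : List ℕ) : Memory where
  reg r := if r = 0 then w.length else 0
  arr a i := if a = 0 then w.getD i 0 else 0

end Memory

/-- `Exec O p σ τ t`: started in the memory `σ`, with an oracle that answers `v` to the query `w`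
when `O w v` (other queries are not permitted), the program `p` halts in the memory `τ` after time
`t`. -/
inductive Exec (O : List ℕ → ℕ → Prop) : Prog → Memory → Memory → ℕ → Prop
  | skip (σ : Memory) : Exec O .skip σ σ 1
  | const (σ : Memory) (r c : ℕ) : Exec O (.const r c) σ (σ.setReg r c) (1 + c.size)
  | op (σ : Memory) (o : BinOp) (r x y : ℕ) :
      Exec O (.op o r x y) σ (σ.setReg r (o.eval (σ.reg x) (σ.reg y)))
        (1 + (σ.reg x).size + (σ.reg y).size)
  | load (σ : Memory) (r a i : ℕ) :
      Exec O (.load r a i) σ (σ.setReg r (σ.arr a (σ.reg i)))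
        (1 + (σ.reg i).size + (σ.arr a (σ.reg i)).size)
  | store (σ : Memory) (a i x : ℕ) :
      Exec O (.store a i x) σ (σ.setArr a (σ.reg i) (σ.reg x))
        (1 + (σ.reg i).size + (σ.reg x).size)
  | seq {p q : Prog} {σ τ υ : Memory} {t u : ℕ} :
      Exec O p σ τ t → Exec O q τ υ u → Exec O (.seq p q) σ υ (t + u)
  | ite_pos {r : ℕ} {p q : Prog} {σ τ : Memory} {t : ℕ} :
      σ.reg r ≠ 0 → Exec O p σ τ t → Exec O (.ite r p q) σ τ (1 + (σ.reg r).size + t)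
  | ite_neg {r : ℕ} {p q : Prog} {σ τ : Memory} {t : ℕ} :
      σ.reg r = 0 → Exec O q σ τ t → Exec O (.ite r p q) σ τ (1 + t)
  | loop_done {r : ℕ} {p : Prog} {σ : Memory} : σ.reg r = 0 → Exec O (.loop r p) σ σ 1
  | loop_step {r : ℕ} {p : Prog} {σ τ υ : Memory} {t u : ℕ} :
      σ.reg r ≠ 0 → Exec O p σ τ t → Exec O (.loop r p) τ υ u →
        Exec O (.loop r p) σ υ (1 + (σ.reg r).size + t + u)
  | call {p : Prog} {r a l : ℕ} {σ τ : Memory} {t : ℕ} :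
      Exec O p (Memory.init (σ.word a (σ.reg l))) τ t →
        Exec O (.call p r a l) σ (σ.setReg r (τ.reg 0))
          (1 + (σ.reg l).size + wordSize (σ.word a (σ.reg l)) + t + (τ.reg 0).size)
  | query {r a l v : ℕ} {σ : Memory} :
      O (σ.word a (σ.reg l)) v →
        Exec O (.query r a l) σ (σ.setReg r v)
          (1 + (σ.reg l).size + wordSize (σ.word a (σ.reg l)) + v.size)

/-- With oracle `O` and on input `w`, the program `p` halts within time `T` and outputs `v` (in
register `0`). -/
def Prog.Computes (p : Prog) (O : List ℕ → ℕ → Prop) (w : List ℕ) (v : ℕ) (T : ℝ) : Prop :=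
  ∃ (τ : Memory) (t : ℕ), Exec O p (Memory.init w) τ t ∧ τ.reg 0 = v ∧ (t : ℝ) ≤ T

/-- No oracle: no query is permitted. -/
def noOracle : List ℕ → ℕ → Prop := fun _ _ => False

/-! ## Parametrised counting problems -/

/-- A parametrised counting problem: its instances, their (unambiguous) encodings by words, the
number that is to be computed, and the parameter. -/
structure ParamCountingProblem where
  Inst : Type
  word : Inst → List ℕ
  word_injective : Function.Injective word
  value : Inst → ℕ
  param : Inst → ℕ

namespace ParamCountingProblem

/-- The oracle for `P`, restricted to queries with parameter at most `K`. -/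
def oracle (P : ParamCountingProblem) (K : ℕ) (w : List ℕ) (v : ℕ) : Prop :=
  ∃ y : P.Inst, P.word y = w ∧ P.param y ≤ K ∧ P.value y = v

/-- `P` is computable in time polynomial in the size of the input. -/
def PolyTime (P : ParamCountingProblem) : Prop :=
  ∃ (p : Prog) (c d : ℕ), ∀ x : P.Inst,
    p.Computes noOracle (P.word x) (P.value x) (c * (wordSize (P.word x) : ℝ) ^ d)

/-- `P` is fixed-parameter tractable. -/
def FPT (P : ParamCountingProblem) : Prop :=
  ∃ (p : Prog) (f : ℕ → ℕ) (d : ℕ), Computable f ∧ ∀ x : P.Inst,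
    p.Computes noOracle (P.word x) (P.value x)
      (f (P.param x) * (wordSize (P.word x) : ℝ) ^ d)

/-- There is a parametrised Turing reduction from `P` to `Q`. -/
def FPTReducible (P Q : ParamCountingProblem) : Prop :=
  ∃ (p : Prog) (f g : ℕ → ℕ) (d : ℕ), Computable f ∧ Computable g ∧ ∀ x : P.Inst,
    p.Computes (Q.oracle (g (P.param x))) (P.word x) (P.value x)
      (f (P.param x) * (wordSize (P.word x) : ℝ) ^ d)

end ParamCountingProblem

/-- The entries of an `m × n` matrix, row by row. -/
def matrixWord {m n : ℕ} (a : Fin m → Fin n → ℕ) : List ℕ :=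
  List.ofFn fun t : Fin (m * n) => a (finProdFinEquiv.symm t).1 (finProdFinEquiv.symm t).2

theorem matrixWord_length {m n : ℕ} (a : Fin m → Fin n → ℕ) : (matrixWord a).length = m * n := by
  simp [matrixWord]

theorem matrixWord_injective {m n : ℕ} :
    Function.Injective (matrixWord : (Fin m → Fin n → ℕ) → List ℕ) := by
  intro a b h
  have h' := List.ofFn_injective h
  funext i j
  simpa using congrFun h' (finProdFinEquiv (i, j))

/-! ### Dominating sets -/

/-- An instance of the problem of counting dominating sets: a graph and a positive integer `k`. -/
structure DomSetInst where
  k : ℕ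
  k_pos : 0 < k
  n : ℕ
  graph : SimpleGraph (Fin n)

open Classical in
/-- The encoding: `k`, the number of vertices, the adjacency matrix. -/
def DomSetInst.word (x : DomSetInst) : List ℕ :=
  x.k :: x.n :: matrixWord fun i j => if x.graph.Adj i j then 1 else 0

theorem DomSetInst.word_injective : Function.Injective DomSetInst.word := by
  rintro ⟨k, hk, n, G⟩ ⟨k', hk', n', G'⟩ h
  simp only [word, List.cons.injEq] at h
  obtain ⟨rfl, rfl, h⟩ := h
  have h' := matrixWord_injective h
  have : G = G' := by
    ext i j
    have := congrFun (congrFun h' i) j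
    by_cases h1 : G.Adj i j <;> by_cases h2 : G'.Adj i j <;> simp_all
  rw [this]

/-- `#DomSet`: count the dominating sets of size `k` of a graph; the parameter is `k`. -/
def domSetProblem : ParamCountingProblem where
  Inst := DomSetInst
  word := DomSetInst.word
  word_injective := DomSetInst.word_injective
  value x := Nat.card {S : Finset (Fin x.n) //
    S.card = x.k ∧ ∀ v, v ∈ S ∨ ∃ u ∈ S, x.graph.Adj u v}
  param x := x.k

/-- A parametrised counting problem is `#W[2]`-hard if `#DomSet` reduces to it. -/
def ParamCountingProblem.SharpW2Hard (P : ParamCountingProblem) : Prop :=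
  domSetProblem.FPTReducible P

/-! ### Trimmed homomorphisms and induced trimmed sub-hypergraphs -/

/-- A hypergraph as it is given to a machine: the vertices are `0, …, n - 1`, there are `m` edges,
listed in some order, and they are given by the incidence matrix. -/
structure HypergraphCode where
  n : ℕ
  m : ℕ
  inc : Fin m → Fin n → Bool
  inc_injective : Function.Injective inc
  edge_nonempty : ∀ i, ∃ v, inc i v = true

namespace HypergraphCode

/-- The hypergraph that is given by a code. -/
def toFinHypergraph (C : HypergraphCode) : FinHypergraph where
  vertexSet := Set.Iio C.n
  edgeSet := {e | ∃ i, e = {v | ∃ h : v < C.n, C.inc i ⟨v, h⟩ = true}}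
  subset_vertexSet_of_mem_edgeSet' := by
    rintro e ⟨i, rfl⟩ v ⟨h, -⟩
    exact h
  finite := Set.finite_Iio _
  empty_notMem := by
    rintro ⟨i, hi⟩
    obtain ⟨v, hv⟩ := C.edge_nonempty i
    have : (v : ℕ) ∈ (∅ : Set ℕ) := by rw [hi]; exact ⟨v.2, hv⟩
    exact this

/-- The encoding: the number of vertices, the number of edges, the incidence matrix. -/
def word (C : HypergraphCode) : List ℕ :=
  C.n :: C.m :: matrixWord fun i v => (C.inc i v).toNat

theorem word_append_injective {C C' D D' : HypergraphCode}
    (h : C.word ++ D.word = C'.word ++ D'.word) : C = C' ∧ D.word = D'.word := by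
  obtain ⟨n, m, a, ha, hb⟩ := C
  obtain ⟨n', m', a', ha', hb'⟩ := C'
  simp only [word, List.cons_append, List.cons.injEq] at h
  obtain ⟨rfl, rfl, h⟩ := h
  obtain ⟨h1, h2⟩ := List.append_inj h (by simp [matrixWord_length])
  refine ⟨?_, h2⟩
  have h3 := matrixWord_injective h1
  have : a = a' := by
    funext i v
    have := congrFun (congrFun h3 i) v
    cases h4 : a i v <;> cases h5 : a' i v <;> simp_all
  subst this
  rfl

theorem word_injective : Function.Injective word := fun C C' h =>
  (word_append_injective (C := C) (C' := C') (D := C) (D' := C) (by rw [h])).1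

end HypergraphCode

/-- An input to the pattern counting problems for the family `𝓗`: a pair of hypergraphs, the first
of which belongs to `𝓗`. -/
structure PatternInst (𝓗 : Set FinHypergraph) where
  H : HypergraphCode
  G : HypergraphCode
  mem : H.toFinHypergraph ∈ 𝓗

def PatternInst.word {𝓗 : Set FinHypergraph} (x : PatternInst 𝓗) : List ℕ :=
  x.H.word ++ x.G.word

theorem PatternInst.word_injective {𝓗 : Set FinHypergraph} :
    Function.Injective (PatternInst.word : PatternInst 𝓗 → List ℕ) := by
  rintro ⟨H, G, h⟩ ⟨H', G', h'⟩ e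
  obtain ⟨h1, h2⟩ := HypergraphCode.word_append_injective e
  have h3 := HypergraphCode.word_injective h2
  simp only at h1 h3
  subst h1 h3
  rfl

/-- `#TrimHom(𝓗)`: given `H ∈ 𝓗` and `G`, count the trimmed homomorphisms from `H` to `G`; the
parameter is the number of vertices of `H`. -/
def trimHomProblem (𝓗 : Set FinHypergraph) : ParamCountingProblem where
  Inst := PatternInst 𝓗
  word := PatternInst.word
  word_injective := PatternInst.word_injective
  value x := FinHypergraph.numTrimHom x.H.toFinHypergraph x.G.toFinHypergraph
  param x := x.H.n

/-- `#IndTrimSub(𝓗)`: given `H ∈ 𝓗` and `G`, count the induced trimmed sub-hypergraphs of `G` that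
are isomorphic to `H`; the parameter is the number of vertices of `H`. -/
def indTrimSubProblem (𝓗 : Set FinHypergraph) : ParamCountingProblem where
  Inst := PatternInst 𝓗
  word := PatternInst.word
  word_injective := PatternInst.word_injective
  value x := FinHypergraph.numIndTrimSub x.H.toFinHypergraph x.G.toFinHypergraph
  param x := x.H.n

/-! ## The Strong Exponential Time Hypothesis -/

/-- A formula in conjunctive normal form with `n` variables and `m` distinct clauses. In clause `i`,
the variable `v` occurs positively (`some true`), negatively (`some false`) or not at all. -/
structure CNF where
  n : ℕ
  m : ℕ
  clause : Fin m → Fin n → Option Bool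
  clause_injective : Function.Injective clause

namespace CNF

def Satisfiable (φ : CNF) : Prop := ∃ a : Fin φ.n → Bool, ∀ i, ∃ v, φ.clause i v = some (a v)

/-- Every clause has at most `q` literals. -/
def WidthAtMost (φ : CNF) (q : ℕ) : Prop :=
  ∀ i, (Finset.univ.filter fun v => φ.clause i v ≠ none).card ≤ q

def literalCode : Option Bool → ℕ
  | none => 0
  | some true => 1
  | some false => 2

def word (φ : CNF) : List ℕ := φ.n :: φ.m :: matrixWord fun i v => literalCode (φ.clause i v)

end CNF

open Classical in
/-- The Strong Exponential Time Hypothesis: for every `δ > 0` there is `q ≥ 1` such that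
satisfiability of formulas with clauses of at most `q` literals is not decidable in time
`O(2 ^ ((1 - δ) n))`, where `n` is the number of variables. -/
def SETH : Prop :=
  ∀ δ : ℝ, 0 < δ → ∃ q : ℕ, 1 ≤ q ∧ ¬ ∃ (p : Prog) (c : ℝ), ∀ φ : CNF, φ.WidthAtMost q →
    p.Computes noOracle φ.word (if φ.Satisfiable then 1 else 0) (c * 2 ^ ((1 - δ) * (φ.n : ℝ)))

end

/-! ## Arithmetic expressions and their compilation to programs -/

/-! Hardness. A map from `B_k` to `G` is a trimmed homomorphism exactly when its image lies inside
some edge of `G` (`numTrimHom_singleEdge`). The remaining maps are the `k`-tuples that meet the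
complement of every edge, so counting trimmed homomorphisms amounts to counting hitting tuples. In
`hittingCode` the complements of `k` of the edges are disjoint classes of `s` options. A hitting
tuple must then use each class exactly once, hence consists of a permutation and one option per
class, and the other edges impose arbitrary constraints of the form "some chosen option satisfies
`c`". With `N` vertices this gives homomorphisms + `k!` · (valid choices) = `N ^ k`
(`numTrimHom_hittingCode`).

Two families of constraints are used. For dominating sets, the options are the vertices of the graph
and the constraints say that the tuple is strictly increasing and dominating (`hitting_domHit_iff`).
For satisfiability, the variables are split into `k` blocks, the options are the about `2 ^ (n / k)`
assignments of a block, and the constraints are the clauses (`nonempty_hittingChoice_cnfHit`). A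
saving `N ^ (k - ε)` then becomes a saving `2 ^ (n - ε n / k)` up to a polynomial in `n`, which
contradicts SETH.

Easiness. `G⟨X⟩` is isomorphic to `B_k` iff `X` consists of `k` vertices that lie in the same edges,
and in at least one (`trim_iso_singleEdge_iff`). Such sets are counted by binomial coefficients,
sorted by least element (`card_isTwinSet`).

Expansion. Sorting trimmed homomorphisms by image gives `#TrimHom(F, G) = ∑ L, #Surj(F, L) ·
#IndTrimSub(L, G)` over isomorphism classes (`numTrimHom_eq_sum_isoClass`). The matrix `#Surj` is
triangular with non-zero diagonal for the order given by `rank`, and its rows are finite. Inverting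
it recursively gives existence and the non-zero coefficient (`exists_trimHom_expansion`);
triangularity also gives uniqueness (`eq_zero_of_trimHomSum_eq_zero`).

Failure of monotonicity follows by composing reductions (`FPTReducible.fpt`). To keep the machine
model manageable, every concrete program is compiled from an arithmetic expression with bounded sums
and products (`exec_compile`), with at most one oracle query or procedure call (`exec_callProg`). -/

@[simp] theorem Memory.setReg_reg (σ : Memory) (r v r' : ℕ) :
    (σ.setReg r v).reg r' = if r' = r then v else σ.reg r' := by
  simp [Memory.setReg, Function.update_apply]

@[simp] theorem Memory.setReg_arr (σ : Memory) (r v : ℕ) : (σ.setReg r v).arr = σ.arr := rfl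

@[simp] theorem Memory.setArr_reg (σ : Memory) (a i v : ℕ) : (σ.setArr a i v).reg = σ.reg := rfl

theorem Memory.setArr_arr (σ : Memory) (a i v a' i' : ℕ) :
    (σ.setArr a i v).arr a' i' = if a' = a ∧ i' = i then v else σ.arr a' i' := by
  by_cases h : a' = a
  · subst h; by_cases h : i' = i <;> simp [Memory.setArr, h]
  · simp [Memory.setArr, h]

/-! ### Bit lengths of the results of arithmetic operations. -/

theorem Nat.size_add_le (x y : ℕ) : (x + y).size ≤ x.size + y.size + 1 := by
  rw [Nat.size_le]
  have hx := Nat.lt_size_self x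
  have hy := Nat.lt_size_self y
  calc x + y < 2 ^ x.size + 2 ^ y.size := by omega
    _ ≤ 2 ^ (x.size + y.size) + 2 ^ (x.size + y.size) := by
        gcongr <;> norm_num
    _ = 2 ^ (x.size + y.size + 1) := by ring

theorem Nat.size_mul_le (x y : ℕ) : (x * y).size ≤ x.size + y.size := by
  rw [Nat.size_le, pow_add]
  exact Nat.mul_lt_mul'' (Nat.lt_size_self x) (Nat.lt_size_self y)

theorem Nat.size_le_self (n : ℕ) : n.size ≤ n := Nat.size_le.2 Nat.lt_two_pow_self

theorem BinOp.size_eval_le (o : BinOp) (x y : ℕ) : (o.eval x y).size ≤ x.size + y.size + 1 := by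
  cases o
  · exact Nat.size_add_le x y
  · exact (Nat.size_le_size (Nat.sub_le x y)).trans (by omega)
  · exact (Nat.size_mul_le x y).trans (by omega)
  · exact (Nat.size_le_size (Nat.div_le_self x y)).trans (by omega)

/-- Arithmetic expressions over an input word, with named variables and bounded iteration:
`fold o c x e f` starts with `c` and applies `o · f` for `x = 0, …, e - 1`. -/
inductive ArithExpr
  | var (x : ℕ)
  | const (c : ℕ)
  | inp (e : ArithExpr)
  | bin (o : BinOp) (e f : ArithExpr)
  | fold (o : BinOp) (c x : ℕ) (e f : ArithExpr)

/-- Left-nested iteration of a binary operation. -/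
def BinOp.iter (o : BinOp) (c : ℕ) (f : ℕ → ℕ) : ℕ → ℕ
  | 0 => c
  | n + 1 => o.eval (o.iter c f n) (f n)

theorem BinOp.iter_add (f : ℕ → ℕ) (n : ℕ) : BinOp.add.iter 0 f n = ∑ i ∈ Finset.range n, f i := by
  induction n with
  | zero => rfl
  | succ n ih => rw [Finset.sum_range_succ, ← ih]; rfl

theorem BinOp.iter_mul (f : ℕ → ℕ) (n : ℕ) : BinOp.mul.iter 1 f n = ∏ i ∈ Finset.range n, f i := by
  induction n with
  | zero => rfl
  | succ n ih => rw [Finset.prod_range_succ, ← ih]; rfl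

namespace ArithExpr

/-- The value of an expression for the input word `w` and the variable assignment `ρ`. -/
def eval (w : ℕ → ℕ) : (ℕ → ℕ) → ArithExpr → ℕ
  | ρ, var x => ρ x
  | _, const c => c
  | ρ, inp e => w (eval w ρ e)
  | ρ, bin o e f => o.eval (eval w ρ e) (eval w ρ f)
  | ρ, fold o c x e f => o.iter c (fun i => eval w (Function.update ρ x i) f) (eval w ρ e)

/-- All iterations in the evaluation of an expression have length at most `B`. -/
def LimitsLE (B : ℕ) (w : ℕ → ℕ) : (ℕ → ℕ) → ArithExpr → Prop
  | _, var _ => True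
  | _, const _ => True
  | ρ, inp e => LimitsLE B w ρ e
  | ρ, bin _ e f => LimitsLE B w ρ e ∧ LimitsLE B w ρ f
  | ρ, fold _ _ x e f => LimitsLE B w ρ e ∧ eval w ρ e ≤ B ∧
      ∀ i < eval w ρ e, LimitsLE B w (Function.update ρ x i) f

/-- A bound on the bit length of the value. -/
def bits (B : ℕ) : ArithExpr → ℕ
  | var _ => B
  | const c => c.size
  | inp _ => B
  | bin _ e f => bits B e + bits B f + 1
  | fold _ c _ _ f => c.size + B * (bits B f + 1)

/-- A bound on the running time of the compiled expression. -/
def time (B : ℕ) : ArithExpr → ℕ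
  | var _ => 2 + B
  | const c => 1 + c.size
  | inp e => time B e + 1 + bits B e + B
  | bin _ e f => time B e + time B f + 1 + bits B e + bits B f
  | fold _ c _ e f => time B e + (1 + c.size) + 4 +
      B * (time B f + (c.size + B * (bits B f + 1)) + bits B f + 3 * B + 6)

/-- The program that evaluates an expression to register `d`, using only registers from `d` on;
`Γ` says where the variables are. -/
def compile : (ℕ → ℕ) → ℕ → ArithExpr → Prog
  | Γ, d, var x => .seq (.const d 0) (.op .add d (Γ x) d)
  | _, d, const c => .const d c
  | Γ, d, inp e => .seq (compile Γ d e) (.load d 0 d)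
  | Γ, d, bin o e f => .seq (compile Γ d e) (.seq (compile Γ (d + 1) f) (.op o d d (d + 1)))
  -- Register `d` accumulates, `d + 1` counts the remaining rounds down, `d + 2` holds the iteration
  -- variable, `d + 3` the constant `1`, and the body is evaluated into `d + 4`.
  | Γ, d, fold o c x e f =>
      .seq (compile Γ (d + 1) e) <| .seq (.const d c) <| .seq (.const (d + 2) 0) <|
      .seq (.const (d + 3) 1) <| .loop (d + 1) <|
        .seq (compile (Function.update Γ x (d + 2)) (d + 4) f) <|
        .seq (.op o d d (d + 4)) <| .seq (.op .add (d + 2) (d + 2) (d + 3)) <|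
        .op .sub (d + 1) (d + 1) (d + 3)

end ArithExpr

/-- One round lengthens the accumulator by at most `b + 1` bits, even for multiplication, because
the second operand does not depend on the accumulator. The growth is therefore linear in the number
of rounds. -/
theorem BinOp.size_iter_le {o : BinOp} {c b N B : ℕ} {f : ℕ → ℕ} (hf : ∀ i < N, (f i).size ≤ b)
    (hN : N ≤ B) : (o.iter c f N).size ≤ c.size + B * (b + 1) := by
  have : (o.iter c f N).size ≤ c.size + N * (b + 1) := by
    clear hN
    induction N with
    | zero => simp [BinOp.iter]
    | succ N ih =>
      have h1 := ih fun i hi => hf i (by omega)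
      have h2 := hf N (by omega)
      have h3 := o.size_eval_le (o.iter c f N) (f N)
      rw [add_mul]
      change (o.eval _ _).size ≤ _
      omega
  have h2 : N * (b + 1) ≤ B * (b + 1) := Nat.mul_le_mul_right _ hN
  omega

namespace ArithExpr

theorem size_eval_le {B : ℕ} {w : ℕ → ℕ} (hw : ∀ i, (w i).size ≤ B) (e : ArithExpr) :
    ∀ ρ : ℕ → ℕ, (∀ x, (ρ x).size ≤ B) → e.LimitsLE B w ρ → (e.eval w ρ).size ≤ e.bits B := by
  induction e with
  | var x => intro ρ hρ _; exact hρ x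
  | const c => intro ρ hρ _; exact le_rfl
  | inp e _ => intro ρ hρ _; exact hw _
  | bin o e f he hf =>
    intro ρ hρ h
    have h1 := he ρ hρ h.1
    have h2 := hf ρ hρ h.2
    have h3 := o.size_eval_le (eval w ρ e) (eval w ρ f)
    simp only [eval, bits]
    omega
  | fold o c x e f he hf =>
    intro ρ hρ h
    refine BinOp.size_iter_le (fun i hi => hf _ (fun y => ?_) (h.2.2 i hi)) h.2.1
    rw [Function.update_apply]
    split_ifs
    · exact (Nat.size_le_self i).trans (hi.le.trans h.2.1)
    · exact hρ y

end ArithExpr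

/-- The rule for loops that count down a register. -/
theorem Exec.loop_count {O : List ℕ → ℕ → Prop} {r : ℕ} {p : Prog} {I : ℕ → Memory → Prop}
    {N C : ℕ} (hr : ∀ i σ, i ≤ N → I i σ → σ.reg r = N - i)
    (hp : ∀ i σ, i < N → I i σ → ∃ τ t, Exec O p σ τ t ∧ I (i + 1) τ ∧ t ≤ C)
    {σ : Memory} (h0 : I 0 σ) :
    ∃ τ t, Exec O (.loop r p) σ τ t ∧ I N τ ∧ t ≤ N * (1 + N.size + C) + 1 := by
  -- Induction on the number `m` of remaining rounds.
  suffices h : ∀ m i σ, i + m = N → I i σ →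
      ∃ τ t, Exec O (.loop r p) σ τ t ∧ I N τ ∧ t ≤ m * (1 + N.size + C) + 1 from
    h N 0 σ (by omega) h0
  intro m
  induction m with
  | zero =>
    intro i σ hi h
    obtain rfl : i = N := by omega
    exact ⟨σ, 1, .loop_done (by rw [hr i σ le_rfl h]; omega), h, by omega⟩
  | succ m ih =>
    intro i σ hi h
    have h1 := hr i σ (by omega) h
    obtain ⟨τ, t, e1, hI, ht⟩ := hp i σ (by omega) h
    obtain ⟨υ, u, e2, hI', hu⟩ := ih (i + 1) τ (by omega) hI
    refine ⟨υ, _, .loop_step (by omega) e1 e2, hI', ?_⟩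
    have : (σ.reg r).size ≤ N.size := Nat.size_le_size (by omega)
    rw [add_mul]
    omega

namespace ArithExpr

/-- The induction generalises over `Γ` and `d`: all variables live below `d` and the compiled code
writes only from `d` on, so evaluating one subexpression disturbs neither the variables nor the
intermediate results stored so far. Arrays are never written, so the input word stays available. -/
theorem exec_compile (O : List ℕ → ℕ → Prop) (B : ℕ) (e : ArithExpr) :
    ∀ (Γ : ℕ → ℕ) (d : ℕ) (σ : Memory), (∀ x, Γ x < d) → (∀ i, (σ.arr 0 i).size ≤ B) →
      (∀ x, (σ.reg (Γ x)).size ≤ B) → e.LimitsLE B (σ.arr 0) (fun x => σ.reg (Γ x)) →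
      ∃ τ t, Exec O (e.compile Γ d) σ τ t ∧ τ.arr = σ.arr ∧ (∀ r < d, τ.reg r = σ.reg r) ∧
        τ.reg d = e.eval (σ.arr 0) (fun x => σ.reg (Γ x)) ∧ t ≤ e.time B := by
  induction e with
  | var x =>
    intro Γ d σ hΓ hw hρ hl
    refine ⟨_, _, .seq (.const _ _ _) (.op _ _ _ _ _), rfl, ?_, ?_, ?_⟩
    · intro r hr
      simp [hr.ne]
    · simp [BinOp.eval, eval, (hΓ x).ne]
    · have := hρ x
      simp [(hΓ x).ne, time]
      omega
  | const c =>
    intro Γ d σ hΓ hw hρ hl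
    refine ⟨_, _, .const _ _ _, rfl, ?_, ?_, le_rfl⟩
    · intro r hr
      simp [hr.ne]
    · simp [eval]
  | inp e ih =>
    intro Γ d σ hΓ hw hρ hl
    obtain ⟨τ, t, h1, h2, h3, h4, h5⟩ := ih Γ d σ hΓ hw hρ hl
    have h6 := size_eval_le hw e _ hρ hl
    refine ⟨_, _, .seq h1 (.load _ _ _ _), h2, ?_, ?_, ?_⟩
    · intro r hr
      simp [hr.ne, h3 r hr]
    · simp [eval, h4, h2]
    · have := hw (eval (σ.arr 0) (fun x => σ.reg (Γ x)) e)
      simp only [time, h4, h2]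
      omega
  | bin o e f he hf =>
    intro Γ d σ hΓ hw hρ hl
    obtain ⟨τ, t, h1, h2, h3, h4, h5⟩ := he Γ d σ hΓ hw hρ hl.1
    have hρ' : (fun x => τ.reg (Γ x)) = fun x => σ.reg (Γ x) := funext fun x => h3 _ (hΓ x)
    have h6 := size_eval_le hw e _ hρ hl.1
    have h6' := size_eval_le hw f _ hρ hl.2
    obtain ⟨τ', t', h1', h2', h3', h4', h5'⟩ := hf Γ (d + 1) τ (fun x => (hΓ x).trans (by omega))
      (by rw [h2]; exact hw) (fun x => by rw [h3 _ (hΓ x)]; exact hρ x)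
      (by rw [hρ', h2]; exact hl.2)
    rw [hρ', h2] at h4'
    have h7 := h3' d (by omega)
    refine ⟨_, _, .seq h1 (.seq h1' (.op _ _ _ _ _)), ?_, ?_, ?_, ?_⟩
    · simp [h2', h2]
    · intro r hr
      simp [hr.ne, h3' r (by omega), h3 r hr]
    · simp [eval, h4', h7, h4]
    · simp only [time, h4', h7, h4]
      omega
  | fold o c x e f he hf =>
    intro Γ d σ hΓ hw hρ hl
    obtain ⟨hl1, hl2, hl3⟩ := hl
    obtain ⟨τ, t, h1, h2, h3, h4, h5⟩ := he Γ (d + 1) σ (fun x => (hΓ x).trans (by omega)) hw hρ hl1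
    set ρ : ℕ → ℕ := fun x => σ.reg (Γ x) with hρdef
    set N := eval (σ.arr 0) ρ e with hN
    set g : ℕ → ℕ := fun i => eval (σ.arr 0) (Function.update ρ x i) f with hg
    set b := bits B f
    have hupd : ∀ i, i < N → ∀ y, (Function.update ρ x i y).size ≤ B := by
      intro i hi y
      rw [Function.update_apply]
      split_ifs
      · exact (Nat.size_le_self i).trans (hi.le.trans hl2)
      · exact hρ y
    have hgb : ∀ i < N, (g i).size ≤ b := fun i hi =>
      size_eval_le hw f _ (hupd i hi) (hl3 i hi)
    have hNs : N.size ≤ B := (Nat.size_le_self N).trans hl2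
    let I : ℕ → Memory → Prop := fun i υ => υ.arr = σ.arr ∧ (∀ r < d, υ.reg r = σ.reg r) ∧
      υ.reg d = o.iter c g i ∧ υ.reg (d + 1) = N - i ∧ υ.reg (d + 2) = i ∧ υ.reg (d + 3) = 1
    have hloop := Exec.loop_count (O := O) (r := d + 1) (I := I) (N := N)
      (p := .seq (compile (Function.update Γ x (d + 2)) (d + 4) f) <|
        .seq (.op o d d (d + 4)) <| .seq (.op .add (d + 2) (d + 2) (d + 3)) <|
        .op .sub (d + 1) (d + 1) (d + 3))
      (C := time B f + (c.size + B * (b + 1)) + b + 2 * B + 5)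
      (fun i υ _ h => h.2.2.2.1) (by
        rintro i υ hi ⟨i1, i2, i3, i4, i5, i6⟩
        have hρ' : (fun y => υ.reg (Function.update Γ x (d + 2) y)) = Function.update ρ x i := by
          funext y
          by_cases hy : y = x
          · subst hy; simp [i5]
          · simp [hy, i2 _ (hΓ y), hρdef]
        obtain ⟨υ', t', j1, j2, j3, j4, j5⟩ := hf (Function.update Γ x (d + 2)) (d + 4) υ
          (fun y => by
            rw [Function.update_apply]
            split_ifs
            · omega
            · have := hΓ y; omega)
          (by rw [i1]; exact hw)
          (fun y => by rw [congrFun hρ' y]; exact hupd i hi y)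
          (by rw [hρ', i1]; exact hl3 i hi)
        rw [hρ', i1] at j4
        change _ = g i at j4
        refine ⟨_, _, .seq j1 (.seq (.op _ _ _ _ _) (.seq (.op _ _ _ _ _) (.op _ _ _ _ _))),
          ⟨?_, ?_, ?_, ?_, ?_, ?_⟩, ?_⟩
        · simp [j2, i1]
        · intro r hr
          have a1 : r ≠ d := by omega
          have a2 : r ≠ d + 1 := by omega
          have a3 : r ≠ d + 2 := by omega
          simp [a1, a2, a3, j3 r (by omega), i2 r hr]
        · simp [j4, j3 d (by omega), i3, BinOp.iter]
        · simp [j3 (d + 1) (by omega), j3 (d + 3) (by omega), i4, i6, BinOp.eval]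
          omega
        · simp [j3 (d + 2) (by omega), j3 (d + 3) (by omega), i5, i6, BinOp.eval]
        · simp [j3 (d + 3) (by omega), i6]
        · have k1 := hgb i hi
          have k2 : (o.iter c g i).size ≤ c.size + B * (b + 1) :=
            BinOp.size_iter_le (fun j hj => hgb j (by omega)) (by omega)
          have k3 : i.size ≤ N.size := Nat.size_le_size hi.le
          have k4 : (N - i).size ≤ N.size := Nat.size_le_size (Nat.sub_le _ _)
          have k5 : Nat.size 1 = 1 := by simp
          simp [j4, j3 d (by omega), j3 (d + 1) (by omega), j3 (d + 2) (by omega),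
            j3 (d + 3) (by omega), i3, i4, i5, i6, k5]
          omega)
      (σ := ((τ.setReg d c).setReg (d + 2) 0).setReg (d + 3) 1)
      ⟨by simp [h2], fun r hr => by
        have a1 : r ≠ d := by omega
        have a2 : r ≠ d + 3 := by omega
        have a3 : r ≠ d + 2 := by omega
        simp [a1, a2, a3, h3 r (by omega)], by simp [BinOp.iter], by simp [h4], by simp, by simp⟩
    obtain ⟨υ, u, l1, ⟨l2, l3, l4, -⟩, l5⟩ := hloop
    refine ⟨υ, _, .seq h1 (.seq (.const _ _ _) (.seq (.const _ _ _) (.seq (.const _ _ _) l1))),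
      l2, l3, l4, ?_⟩
    have k5 : Nat.size 1 = 1 := by simp
    have k6 : Nat.size 0 = 0 := by simp
    -- The loop test adds `1 + N.size ≤ 1 + B` per round, which turns `2 * B + 5` into the `3 * B +
    -- 6` of `time`.
    have k7 : N * (1 + N.size + (time B f + (c.size + B * (b + 1)) + b + 2 * B + 5)) ≤
        B * (time B f + (c.size + B * (b + 1)) + b + 3 * B + 6) :=
      Nat.mul_le_mul hl2 (by omega)
    have k8 : bits B f = b := rfl
    simp only [time, k5, k6, k8]
    omega

end ArithExpr

/-! ### Polynomial bounds -/

/-- Functions that are bounded by a polynomial. -/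
def PolyBounded (f : ℕ → ℕ) : Prop := ∃ C D : ℕ, ∀ B, f B ≤ C * (B + 1) ^ D

namespace PolyBounded

theorem const (c : ℕ) : PolyBounded fun _ => c := ⟨c, 0, by simp⟩

theorem id : PolyBounded fun B => B := ⟨1, 1, by simp⟩

theorem add {f g : ℕ → ℕ} (hf : PolyBounded f) (hg : PolyBounded g) :
    PolyBounded fun B => f B + g B := by
  obtain ⟨C, D, hf⟩ := hf
  obtain ⟨C', D', hg⟩ := hg
  refine ⟨C + C', D + D', fun B => ?_⟩
  rw [add_mul]
  refine add_le_add ((hf B).trans ?_) ((hg B).trans ?_) <;> gcongr <;> omega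

theorem mul {f g : ℕ → ℕ} (hf : PolyBounded f) (hg : PolyBounded g) :
    PolyBounded fun B => f B * g B := by
  obtain ⟨C, D, hf⟩ := hf
  obtain ⟨C', D', hg⟩ := hg
  refine ⟨C * C', D + D', fun B => ?_⟩
  calc f B * g B ≤ (C * (B + 1) ^ D) * (C' * (B + 1) ^ D') := Nat.mul_le_mul (hf B) (hg B)
    _ = _ := by ring

theorem pow {f : ℕ → ℕ} (hf : PolyBounded f) (n : ℕ) : PolyBounded fun B => f B ^ n := by
  induction n with
  | zero => simpa using const 1
  | succ n ih => simpa [pow_succ] using ih.mul hf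

end PolyBounded

namespace ArithExpr

/-- The expression is fixed while `B` varies, so the nesting depth of folds only affects the degree.
-/
theorem polyBounded_bits (e : ArithExpr) : PolyBounded fun B => e.bits B := by
  induction e with
  | var x => exact .id
  | const c => exact .const _
  | inp e _ => exact .id
  | bin o e f he hf => exact (he.add hf).add (.const 1)
  | fold o c x e f he hf => exact (PolyBounded.const _).add (PolyBounded.id.mul (hf.add (.const 1)))

theorem polyBounded_time (e : ArithExpr) : PolyBounded fun B => e.time B := by
  induction e with
  | var x => exact (PolyBounded.const 2).add .id
  | const c => exact .const _
  | inp e he => exact ((he.add (.const 1)).add e.polyBounded_bits).add .id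
  | bin o e f he hf =>
    exact (((he.add hf).add (.const 1)).add e.polyBounded_bits).add f.polyBounded_bits
  | fold o c x e f he hf =>
    have hb := f.polyBounded_bits
    exact ((he.add (.const _)).add (.const 4)).add (PolyBounded.id.mul
      ((((hf.add ((PolyBounded.const _).add (PolyBounded.id.mul (hb.add (.const 1))))).add hb).add
        ((PolyBounded.const 3).mul .id)).add (.const 6)))

end ArithExpr

/-! ### Programs that evaluate an expression, and programs that make one call -/

theorem List.size_getD_le {w : List ℕ} {B : ℕ} (hw : ∀ a ∈ w, a.size ≤ B) (i : ℕ) :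
    (w.getD i 0).size ≤ B := by
  by_cases h : i < w.length
  · rw [List.getD_eq_getElem _ _ h]; exact hw _ (List.getElem_mem h)
  · rw [List.getD_eq_default _ _ (by omega)]; simp

theorem Memory.init_arr_zero (w : List ℕ) : (Memory.init w).arr 0 = fun i => w.getD i 0 := by
  funext i; simp [Memory.init]

theorem size_le_wordSize {w : List ℕ} : ∀ a ∈ w, a.size ≤ wordSize w := by
  induction w with
  | nil => simp
  | cons b w ih =>
    intro a ha
    rw [wordSize, List.map_cons, List.sum_cons]
    change _ ≤ b.size + 1 + wordSize w
    rcases List.mem_cons.1 ha with rfl | ha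
    · omega
    · have := ih a ha; omega

theorem length_le_wordSize (w : List ℕ) : w.length ≤ wordSize w := by
  induction w with
  | nil => simp
  | cons b w ih =>
    rw [wordSize, List.map_cons, List.sum_cons]
    change _ ≤ b.size + 1 + wordSize w
    simp only [List.length_cons]
    omega

theorem wordSize_le {w : List ℕ} {B : ℕ} (hw : ∀ a ∈ w, a.size ≤ B) :
    wordSize w ≤ w.length * (B + 1) := by
  induction w with
  | nil => simp [wordSize]
  | cons b w ih =>
    have h1 := ih fun a ha => hw a (List.mem_cons_of_mem _ ha)
    have h2 := hw b List.mem_cons_self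
    rw [wordSize, List.map_cons, List.sum_cons]
    change b.size + 1 + wordSize w ≤ _
    rw [List.length_cons, add_mul]
    omega

namespace ArithExpr

/-- The program that outputs the value of an expression. -/
def outputProg (e : ArithExpr) : Prog :=
  .seq (e.compile (fun _ => 0) 1) (.seq (.const 0 0) (.op .add 0 1 0))

theorem exec_outputProg {O : List ℕ → ℕ → Prop} {e : ArithExpr} {w : List ℕ} {B : ℕ}
    (hw : ∀ a ∈ w, a.size ≤ B) (hlen : w.length.size ≤ B)
    (hl : e.LimitsLE B (fun i => w.getD i 0) fun _ => w.length) :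
    ∃ τ t, Exec O e.outputProg (Memory.init w) τ t ∧
      τ.reg 0 = e.eval (fun i => w.getD i 0) (fun _ => w.length) ∧
      t ≤ e.time B + e.bits B + 2 := by
  have h0 : (Memory.init w).arr 0 = fun i => w.getD i 0 := Memory.init_arr_zero w
  have hr : (Memory.init w).reg 0 = w.length := rfl
  obtain ⟨τ, t, h1, h2, h3, h4, h5⟩ := exec_compile O B e (fun _ => 0) 1 (Memory.init w)
    (fun _ => by simp) (fun i => by rw [h0]; exact List.size_getD_le hw i)
    (fun _ => by rw [hr]; exact hlen) (by rw [h0, hr]; exact hl)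
  rw [h0, hr] at h4
  refine ⟨_, _, .seq h1 (.seq (.const _ _ _) (.op _ _ _ _ _)), ?_, ?_⟩
  · simp [h4, BinOp.eval]
  · have := size_eval_le (List.size_getD_le hw) e (fun _ => w.length) (fun _ => hlen) hl
    simp [h4, -List.getD_eq_getElem?_getD]
    omega

/-- A problem whose values are given by an expression with polynomially bounded iterations is
computable in polynomial time. -/
theorem polyTime_of_eval {P : ParamCountingProblem} (e : ArithExpr)
    (hw : ∀ x, 1 ≤ wordSize (P.word x))
    (hv : ∀ x, e.eval (fun i => (P.word x).getD i 0) (fun _ => (P.word x).length) = P.value x)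
    (hl : ∀ x, e.LimitsLE (wordSize (P.word x)) (fun i => (P.word x).getD i 0)
      fun _ => (P.word x).length) : P.PolyTime := by
  obtain ⟨C, D, h⟩ := (e.polyBounded_time.add e.polyBounded_bits).add (.const 2)
  -- The factor `2 ^ D` absorbs the shift from `B` to `B + 1`, since `B + 1 ≤ 2 * B` for `B ≥ 1`.
  refine ⟨e.outputProg, C * 2 ^ D, D, fun x => ?_⟩
  obtain ⟨τ, t, h1, h2, h3⟩ := exec_outputProg (O := noOracle) (e := e) size_le_wordSize
    ((Nat.size_le_self _).trans (length_le_wordSize _)) (hl x)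
  refine ⟨τ, t, h1, h2.trans (hv x), ?_⟩
  have h4 : t ≤ C * 2 ^ D * wordSize (P.word x) ^ D := by
    refine (h3.trans (h _)).trans ?_
    rw [mul_assoc, ← mul_pow]
    have := hw x
    gcongr
    omega
  exact_mod_cast h4

/-- The program that writes the word with length `lenE` and entries `entE` to array `1`, performs
`q`, and evaluates `finE` on the contents of register `2`. -/
def callProg (lenE entE finE : ArithExpr) (q : Prog) : Prog :=
  .seq (lenE.compile (fun _ => 0) 1) <| .seq (.const 4 0) <| .seq (.const 3 1) <|
  .seq (.op .add 2 1 4) <|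
  .seq (.loop 2 <| .seq (entE.compile (fun _ => 4) 5) <| .seq (.store 1 4 5) <|
    .seq (.op .add 4 4 3) (.op .sub 2 2 3)) <|
  .seq q <| .seq (finE.compile (fun _ => 2) 3) <| .seq (.const 0 0) (.op .add 0 3 0)

/-- The instruction `q` enters only through its effect of putting `r` into register `2`, so that the
same result covers oracle queries and procedure calls. The position is visible to `entE`, and the
answer to `finE`, as the value of every free variable. -/
theorem exec_callProg {O : List ℕ → ℕ → Prop} {lenE entE finE : ArithExpr} {q : Prog}
    {w : List ℕ} {L r tq B B' : ℕ} {E : ℕ → ℕ}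
    (hw : ∀ a ∈ w, a.size ≤ B) (hlen : w.length.size ≤ B)
    (hL : lenE.eval (fun i => w.getD i 0) (fun _ => w.length) = L)
    (hLl : lenE.LimitsLE B (fun i => w.getD i 0) fun _ => w.length) (hLs : L.size ≤ B)
    (hE : ∀ t < L, entE.eval (fun i => w.getD i 0) (fun _ => t) = E t)
    (hEl : ∀ t < L, entE.LimitsLE B (fun i => w.getD i 0) fun _ => t)
    (hB : B ≤ B') (hr : r.size ≤ B')
    (hFl : finE.LimitsLE B' (fun i => w.getD i 0) fun _ => r)
    (hq : ∀ σ : Memory, σ.reg 1 = L → σ.word 1 (σ.reg 1) = (List.range L).map E →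
      Exec O q σ (σ.setReg 2 r) tq) :
    ∃ τ t, Exec O (callProg lenE entE finE q) (Memory.init w) τ t ∧
      τ.reg 0 = finE.eval (fun i => w.getD i 0) (fun _ => r) ∧
      t ≤ lenE.time B + B + 10 + L * (entE.time B + entE.bits B + 4 * B + 8) + tq +
        finE.time B' + finE.bits B' := by
  have h0 : (Memory.init w).arr 0 = fun i => w.getD i 0 := Memory.init_arr_zero w
  have hr0 : (Memory.init w).reg 0 = w.length := rfl
  obtain ⟨τ, t, h1, h2, h3, h4, h5⟩ := exec_compile O B lenE (fun _ => 0) 1 (Memory.init w)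
    (fun _ => by simp) (fun i => by rw [h0]; exact List.size_getD_le hw i)
    (fun _ => by rw [hr0]; exact hlen) (by rw [h0, hr0]; exact hLl)
  rw [h0, hr0, hL] at h4
  have hs1 : Nat.size 1 = 1 := by simp
  have hs0 : Nat.size 0 = 0 := by simp
  -- Loop invariant after `i` rounds: register `1` keeps the length, `2` counts down, `3` is the
  -- constant `1`, `4` is the next position, and the first `i` cells of array `1` are written.
  let I : ℕ → Memory → Prop := fun i υ => (υ.arr 0 = fun i => w.getD i 0) ∧ υ.reg 1 = L ∧
    υ.reg 2 = L - i ∧ υ.reg 3 = 1 ∧ υ.reg 4 = i ∧ ∀ j < i, υ.arr 1 j = E j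
  have hloop := Exec.loop_count (O := O) (r := 2) (I := I) (N := L)
    (p := .seq (entE.compile (fun _ => 4) 5) <| .seq (.store 1 4 5) <|
      .seq (.op .add 4 4 3) (.op .sub 2 2 3))
    (C := entE.time B + entE.bits B + 3 * B + 6)
    (fun i υ _ h => h.2.2.1) (by
      rintro i υ hi ⟨i1, i2, i3, i4, i5, i6⟩
      have k1 : i.size ≤ B := (Nat.size_le_size hi.le).trans hLs
      have k2 : (L - i).size ≤ B := (Nat.size_le_size (Nat.sub_le _ _)).trans hLs
      obtain ⟨υ', t', j1, j2, j3, j4, j5⟩ := exec_compile O B entE (fun _ => 4) 5 υ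
        (fun _ => by simp) (fun i => by rw [i1]; exact List.size_getD_le hw i)
        (fun _ => by rw [i5]; exact k1) (by rw [i1, i5]; exact hEl i hi)
      have k3 := size_eval_le (List.size_getD_le hw) entE (fun _ => i) (fun _ => k1) (hEl i hi)
      rw [i1, i5, hE i hi] at j4
      rw [hE i hi] at k3
      refine ⟨_, _, .seq j1 (.seq (.store _ _ _ _) (.seq (.op _ _ _ _ _) (.op _ _ _ _ _))),
        ⟨?_, ?_, ?_, ?_, ?_, ?_⟩, ?_⟩
      · funext j
        simp [Memory.setArr_arr, j2, i1]
      · simp [j3 1 (by omega), i2]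
      · simp [j3 2 (by omega), j3 3 (by omega), i3, i4, BinOp.eval]; omega
      · simp [j3 3 (by omega), i4]
      · simp [j3 3 (by omega), j3 4 (by omega), i4, i5, BinOp.eval]
      · intro j hj
        simp only [Memory.setReg_arr, Memory.setArr_arr, j3 4 (by omega : 4 < 5), i5, j4, j2,
          true_and]
        split_ifs with h
        · rw [h]
        · exact i6 j (by omega)
      · simp [j3 2 (by omega), j3 3 (by omega), j3 4 (by omega), i3, i4, i5, j4, hs1]
        omega)
    (σ := ((τ.setReg 4 0).setReg 3 1).setReg 2 L)
    ⟨by simp [h2, h0], by simp [h4], by simp, by simp, by simp, by simp⟩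
  obtain ⟨υ, u, l1, ⟨l2, l3, l4, l5, l6, l7⟩, l8⟩ := hloop
  have hadd : Exec O (.op .add 2 1 4) ((τ.setReg 4 0).setReg 3 1)
      (((τ.setReg 4 0).setReg 3 1).setReg 2 L) (1 + L.size) := by
    have := Exec.op (O := O) ((τ.setReg 4 0).setReg 3 1) .add 2 1 4
    simpa [h4, BinOp.eval] using this
  have hword : υ.word 1 (υ.reg 1) = (List.range L).map E := by
    rw [l3, Memory.word]
    exact List.map_congr_left fun j hj => l7 j (List.mem_range.1 hj)
  obtain ⟨ζ, z, m1, m2, m3, m4, m5⟩ := exec_compile O B' finE (fun _ => 2) 3 (υ.setReg 2 r)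
    (fun _ => by simp) (fun i => by simpa [l2] using (List.size_getD_le hw i).trans hB)
    (fun _ => by simpa using hr) (by simpa [l2] using hFl)
  have k3 := size_eval_le (fun i => (List.size_getD_le hw i).trans hB) finE (fun _ => r)
    (fun _ => hr) hFl
  have hm : (υ.setReg 2 r).arr 0 = fun i => w.getD i 0 := by simp [l2]
  rw [hm] at m4
  simp only [Memory.setReg_reg, if_true] at m4
  refine ⟨_, _, .seq h1 (.seq (.const _ _ _) (.seq (.const _ _ _) (.seq hadd (.seq l1
    (.seq (hq υ l3 hword) (.seq m1 (.seq (.const _ _ _) (.op _ _ _ _ _)))))))), ?_, ?_⟩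
  · simp [m4, BinOp.eval]
  · have : L * (1 + L.size + (entE.time B + entE.bits B + 3 * B + 6)) ≤
        L * (entE.time B + entE.bits B + 4 * B + 8) := Nat.mul_le_mul_left _ (by omega)
    simp [m4, hs0, hs1, -List.getD_eq_getElem?_getD]
    omega

end ArithExpr

/-! ## Trimmed homomorphisms from single-edge hypergraphs -/

open Classical in
-- The only edge of `B_k` is its whole vertex set, whose image is the range of `φ`; and `range φ =
-- e' ∩ range φ` just says `range φ ⊆ e'`.
theorem FinHypergraph.numTrimHom_singleEdge {k : ℕ} (hk : 0 < k) (C : HypergraphCode) :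
    FinHypergraph.numTrimHom (.singleEdge k hk) C.toFinHypergraph =
      Nat.card {φ : Fin k → Fin C.n // ∃ e, ∀ j, C.inc e (φ j) = true} := by
  let α : Fin k ≃ (FinHypergraph.singleEdge k hk).V := Fin.equivSubtype
  let β : Fin C.n ≃ C.toFinHypergraph.V := Fin.equivSubtype
  refine (Nat.card_congr (Equiv.subtypeEquiv (Equiv.arrowCongr α β) fun φ => ?_)).symm
  have hrange : Set.range (Equiv.arrowCongr α β φ) = Set.range fun j => β (φ j) := by
    ext v
    constructor
    · rintro ⟨x, rfl⟩
      exact ⟨α.symm x, rfl⟩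
    · rintro ⟨x, rfl⟩
      exact ⟨α x, by simp⟩
  have huniv : ∀ S, (FinHypergraph.singleEdge k hk).IsEdge S ↔ S = Set.univ := by
    intro S
    change Subtype.val '' S = Set.Iio k ↔ _
    constructor
    · intro h
      ext x
      have h2 : x.1 ∈ Subtype.val '' S := by rw [h]; exact x.2
      obtain ⟨y, hy, hxy⟩ := h2
      simpa [← Subtype.ext hxy] using hy
    · rintro rfl
      rw [Set.image_univ, Subtype.range_coe]
      rfl
  constructor
  · rintro ⟨e, he⟩ S hS
    rw [(huniv S).1 hS]
    refine ⟨{v | C.inc e (β.symm v) = true}, ⟨e, ?_⟩, ?_⟩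
    · ext v
      constructor
      · rintro ⟨x, hx, rfl⟩
        exact ⟨x.2, hx⟩
      · rintro ⟨h, hv⟩
        exact ⟨⟨v, h⟩, hv, rfl⟩
    · rw [Set.image_univ, hrange, eq_comm, Set.inter_eq_right]
      rintro _ ⟨j, rfl⟩
      simpa using he j
  · intro h
    obtain ⟨e', ⟨e, he⟩, h2⟩ := h Set.univ ((huniv _).2 rfl)
    refine ⟨e, fun j => ?_⟩
    rw [Set.image_univ, eq_comm, Set.inter_eq_right, hrange] at h2
    have h3 : (β (φ j)).1 ∈ Subtype.val '' e' := ⟨_, h2 ⟨j, rfl⟩, rfl⟩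
    rw [he] at h3
    exact h3.2

/-- The code of the single-edge hypergraph on `k` vertices. -/
def singleEdgeCode (k : ℕ) (hk : 0 < k) : HypergraphCode where
  n := k
  m := 1
  inc _ _ := true
  inc_injective _ _ _ := Subsingleton.elim _ _
  edge_nonempty _ := ⟨⟨0, hk⟩, rfl⟩

theorem toFinHypergraph_singleEdgeCode (k : ℕ) (hk : 0 < k) :
    (singleEdgeCode k hk).toFinHypergraph = .singleEdge k hk := by
  ext v
  · rfl
  · change (∃ _ : Fin 1, _) ↔ v = Set.Iio k
    have : {v | ∃ h : v < k, (singleEdgeCode k hk).inc (0 : Fin 1) ⟨v, h⟩ = true} = Set.Iio k := by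
      ext v; simp [singleEdgeCode]
    rw [← this]
    exact ⟨fun ⟨i, hi⟩ => by rw [hi, Subsingleton.elim i 0]; rfl, fun h => ⟨0, h⟩⟩

/-! ### Hitting tuples

There are `k` classes with `s` options each, and `R` constraints; option `a` of class `i` satisfies
constraint `c` when `hit c i a`. -/

/-- The incidence relation of the hypergraph whose edges are the complements of the sets of options
that satisfy a constraint, and the complements of the classes. The options are the first `k * s`
vertices. The edge of constraint `c` also contains vertex `k * s + c`, which makes it unique. -/
def hittingInc (k s R : ℕ) (hit : ℕ → ℕ → ℕ → Prop) (e v : ℕ) : Prop :=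
  (e < R ∧ (v < k * s ∧ ¬ hit e (v / s) (v % s) ∨ k * s ≤ v ∧ v - k * s = e)) ∨
    (R ≤ e ∧ (v < k * s ∧ v / s ≠ e - R ∨ k * s ≤ v))

open Classical in
/-- The hypergraph with incidence relation `hittingInc`. -/
noncomputable def hittingCode (k s R : ℕ) (hit : ℕ → ℕ → ℕ → Prop) (hs : 0 < s) : HypergraphCode where
  n := k * s + R + 1
  m := R + k
  inc e v := decide (hittingInc k s R hit e v)
  inc_injective := by
    -- Two constraint edges are told apart by the private vertex `k * s + e`, and a constraint edge
    -- from a class edge by the vertex `k * s + R`, which lies in all class edges and in no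
    -- constraint edge.
    have key : ∀ e e' : Fin (R + k), (∀ v : Fin (k * s + R + 1),
        hittingInc k s R hit e v ↔ hittingInc k s R hit e' v) → (e : ℕ) < R → e = e' := by
      intro e e' h he
      rcases lt_or_ge (e' : ℕ) R with he' | he'
      · have := (h ⟨k * s + e, by omega⟩).1 (Or.inl ⟨he, Or.inr ⟨by simp, by simp⟩⟩)
        rcases this with ⟨_, ⟨h1, _⟩ | ⟨_, h1⟩⟩ | ⟨h1, _⟩
        · simp at h1
        · simp at h1; exact Fin.ext h1
        · omega
      · have := (h ⟨k * s + R, by omega⟩).2 (Or.inr ⟨he', Or.inr (by simp)⟩)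
        rcases this with ⟨_, ⟨h1, _⟩ | ⟨_, h1⟩⟩ | ⟨h1, _⟩
        · simp at h1
        · simp at h1; omega
        · omega
    intro e e' h
    have h' : ∀ v : Fin (k * s + R + 1),
        hittingInc k s R hit e v ↔ hittingInc k s R hit e' v := fun v => by
      simpa using congrFun h v
    rcases lt_or_ge (e : ℕ) R with he | he
    · exact key e e' h' he
    rcases lt_or_ge (e' : ℕ) R with he' | he'
    · exact (key e' e (fun v => (h' v).symm) he').symm
    by_contra hne
    -- The first option of a class is missing from the edge of that class and present in every other
    -- class edge; it exists because `s > 0`.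
    have hlt : ((e : ℕ) - R) * s < k * s := Nat.mul_lt_mul_of_pos_right (by omega) hs
    have := (h' ⟨((e : ℕ) - R) * s, by omega⟩).2 (Or.inr ⟨he', Or.inl ⟨hlt, by
      rw [Nat.mul_div_cancel _ hs]
      intro h; exact hne (Fin.ext (by omega))⟩⟩)
    rcases this with ⟨h1, _⟩ | ⟨_, ⟨_, h1⟩ | h1⟩
    · omega
    · simp [Nat.mul_div_cancel _ hs] at h1
    · simp at h1; omega
  edge_nonempty e := by
    rcases lt_or_ge (e : ℕ) R with he | he
    · exact ⟨⟨k * s + e, by omega⟩, by simp [hittingInc, he]⟩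
    · exact ⟨⟨k * s + R, by omega⟩, by simp [hittingInc, he]⟩

/-- Choices of one option from each class that satisfy all constraints. -/
abbrev HittingChoice (k s R : ℕ) (hit : ℕ → ℕ → ℕ → Prop) : Type :=
  {a : Fin k → Fin s // ∀ c < R, ∃ i : Fin k, hit c i (a i)}

/-- A tuple that is contained in no class edge meets all `k` classes, so its `k` entries lie in
different classes: it is a permutation of the classes together with one option from each. Not being
contained in a constraint edge then says that the constraint is satisfied, whatever the permutation.
-/
theorem card_nonHom_hittingCode (k s R : ℕ) (hit : ℕ → ℕ → ℕ → Prop) (hs : 0 < s) :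
    Nat.card {φ : Fin k → Fin (k * s + R + 1) //
      ¬ ∃ e, ∀ j, (hittingCode k s R hit hs).inc e (φ j) = true} =
      k.factorial * Nat.card (HittingChoice k s R hit) := by
  have hlt : ∀ (i : Fin k) (a : Fin s), (i : ℕ) * s + a < k * s := fun i a =>
    calc (i : ℕ) * s + a < i * s + s := by omega
      _ = (i + 1) * s := by ring
      _ ≤ k * s := Nat.mul_le_mul_right _ i.2
  let vtx : Fin k → Fin s → Fin (k * s + R + 1) := fun i a =>
    ⟨(i : ℕ) * s + a, by have := hlt i a; omega⟩
  have hdiv : ∀ i a, (vtx i a : ℕ) / s = i := fun i a => by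
    change ((i : ℕ) * s + a) / s = i
    rw [mul_comm, Nat.mul_add_div hs, Nat.div_eq_of_lt a.2, add_zero]
  have hmod : ∀ i a, (vtx i a : ℕ) % s = a := fun i a => by
    change ((i : ℕ) * s + a) % s = a
    rw [mul_comm, Nat.mul_add_mod, Nat.mod_eq_of_lt a.2]
  have hiff : ∀ φ : Fin k → Fin (k * s + R + 1),
      (¬ ∃ e, ∀ j, (hittingCode k s R hit hs).inc e (φ j) = true) ↔
        ∀ e < R + k, ∃ j, ¬ hittingInc k s R hit e (φ j) := by
    intro φ
    simp only [hittingCode, decide_eq_true_eq, not_exists, not_forall]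
    exact ⟨fun h e he => h ⟨e, he⟩, fun h e => h e e.2⟩
  rw [Nat.card_congr (Equiv.subtypeEquivRight hiff)]
  have hinj : ∀ i a i' a', vtx i a = vtx i' a' → i = i' ∧ a = a' := by
    intro i a i' a' h
    exact ⟨Fin.ext (by rw [← hdiv i a, h, hdiv]), Fin.ext (by rw [← hmod i a, h, hmod])⟩
  have hinc1 : ∀ e < R, ∀ i a, hittingInc k s R hit e (vtx i a) ↔ ¬ hit e i a := by
    intro e he i a
    simp only [hittingInc, he, hdiv, hmod, true_and]
    have : (vtx i a : ℕ) < k * s := hlt i a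
    constructor
    · rintro ((⟨_, h⟩ | ⟨h, _⟩) | ⟨h, _⟩)
      · exact h
      · omega
      · omega
    · intro h; exact Or.inl (Or.inl ⟨this, h⟩)
  -- The complement of a class edge is exactly the class, because the extra vertices from `k * s` on
  -- lie in all class edges. This keeps them out of every counted tuple.
  have hcls : ∀ (i : Fin k) (v : Fin (k * s + R + 1)),
      ¬ hittingInc k s R hit (R + i) v ↔ ∃ a, v = vtx i a := by
    intro i v
    constructor
    · intro h
      simp only [hittingInc, not_or, not_and, not_le, ne_eq, not_not] at h
      have h1 := h.2 (by omega)
      have h2 : (v : ℕ) / s = i := by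
        rw [h1.1 h1.2]; omega
      refine ⟨⟨v % s, Nat.mod_lt _ hs⟩, Fin.ext ?_⟩
      change (v : ℕ) = i * s + v % s
      have := Nat.div_add_mod' (v : ℕ) s
      rw [h2] at this
      exact this.symm
    · rintro ⟨a, rfl⟩ h
      have : (vtx i a : ℕ) < k * s := hlt i a
      rcases h with ⟨h1, _⟩ | ⟨_, ⟨_, h1⟩ | h1⟩
      · omega
      · rw [hdiv] at h1; omega
      · omega
  have hcard : Nat.card (Equiv.Perm (Fin k) × HittingChoice k s R hit) =
      k.factorial * Nat.card (HittingChoice k s R hit) := by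
    rw [Nat.card_prod, Nat.card_perm, Nat.card_eq_fintype_card (α := Fin k), Fintype.card_fin]
  rw [← hcard]
  refine (Nat.card_congr (Equiv.ofBijective
    (fun x : Equiv.Perm (Fin k) × HittingChoice k s R hit =>
      (⟨fun j => vtx (x.1 j) (x.2.1 (x.1 j)), ?_⟩ : {φ : Fin k → Fin (k * s + R + 1) //
      ∀ e < R + k, ∃ j, ¬ hittingInc k s R hit e (φ j)})) ⟨?_, ?_⟩)).symm
  · intro e he
    rcases lt_or_ge e R with h | h
    · obtain ⟨i, hi⟩ := x.2.2 e h
      refine ⟨x.1.symm i, ?_⟩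
      simpa [hinc1 e h] using hi
    · obtain ⟨i, rfl⟩ := Nat.exists_eq_add_of_le h
      refine ⟨x.1.symm ⟨i, by omega⟩, (hcls ⟨i, by omega⟩ _).2 ⟨x.2.1 ⟨i, by omega⟩, ?_⟩⟩
      simp only [Equiv.apply_symm_apply]
  · rintro ⟨π, a⟩ ⟨π', a'⟩ h
    simp only [Subtype.mk.injEq] at h
    have h1 : π = π' := Equiv.ext fun j => (hinj _ _ _ _ (congrFun h j)).1
    subst h1
    have h2 : a = a' := Subtype.ext <| funext fun i => by
      have := (hinj _ _ _ _ (congrFun h (π.symm i))).2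
      simpa using this
    rw [h2]
  · rintro ⟨φ, hφ⟩
    have h1 : ∀ i : Fin k, ∃ j a, φ j = vtx i a := fun i => by
      obtain ⟨j, hj⟩ := hφ (R + i) (by omega)
      exact ⟨j, (hcls i _).1 hj⟩
    choose j a hja using h1
    -- `j i` is a position at which class `i` is met; distinct classes need distinct positions, so
    -- `j` is a permutation by finiteness.
    have hj : Function.Injective j := fun i i' h =>
      (hinj _ _ _ _ ((hja i).symm.trans ((congrArg φ h).trans (hja i')))).1
    let π := Equiv.ofBijective j (Finite.injective_iff_bijective.1 hj)
    have hπ : ∀ x, φ x = vtx (π.symm x) (a (π.symm x)) := fun x => by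
      rw [← hja]
      exact congrArg φ (π.apply_symm_apply x).symm
    refine ⟨⟨π.symm, a, fun c hc => ?_⟩, Subtype.ext <| funext fun x => (hπ x).symm⟩
    obtain ⟨x, hx⟩ := hφ c (by omega)
    rw [hπ x, hinc1 c hc, not_not] at hx
    exact ⟨_, hx⟩

/-- The additive form lets both reductions recover what they need from the answer `r`: the exact
count as `(N ^ k - r) / k!`, and mere existence as `N ^ k - r ≠ 0`. -/
theorem numTrimHom_hittingCode {k : ℕ} (hk : 0 < k) {s : ℕ} (hs : 0 < s) (R : ℕ)
    (hit : ℕ → ℕ → ℕ → Prop) :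
    FinHypergraph.numTrimHom (.singleEdge k hk) (hittingCode k s R hit hs).toFinHypergraph +
      k.factorial * Nat.card (HittingChoice k s R hit) = (k * s + R + 1) ^ k := by
  classical
  rw [FinHypergraph.numTrimHom_singleEdge, ← card_nonHom_hittingCode k s R hit hs]
  simp only [Nat.card_eq_fintype_card]
  have h := Fintype.card_subtype_compl fun φ : Fin k → Fin (k * s + R + 1) =>
    ∃ e, ∀ j, (hittingCode k s R hit hs).inc e (φ j) = true
  have h2 := Fintype.card_subtype_le fun φ : Fin k → Fin (k * s + R + 1) =>
    ∃ e, ∀ j, (hittingCode k s R hit hs).inc e (φ j) = true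
  have h3 : Fintype.card (Fin k → Fin (k * s + R + 1)) = (k * s + R + 1) ^ k := by simp
  rw [h3] at h h2
  rw [h]
  exact Nat.add_sub_of_le h2

/-! ### Derived expressions -/

namespace ArithExpr

instance : Add ArithExpr := ⟨bin .add⟩
instance : Sub ArithExpr := ⟨bin .sub⟩
instance : Mul ArithExpr := ⟨bin .mul⟩
instance : Div ArithExpr := ⟨bin .div⟩
instance (n : ℕ) : OfNat ArithExpr n := ⟨const n⟩

/-- `1` if `e ≠ 0`, and `0` otherwise. -/
def pos (e : ArithExpr) : ArithExpr := 1 - (1 - e)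
/-- `1` if `e < f`, and `0` otherwise. -/
def lt (e f : ArithExpr) : ArithExpr := pos (f - e)
/-- `1` if `e = f`, and `0` otherwise. -/
def eq (e f : ArithExpr) : ArithExpr := 1 - ((e - f) + (f - e))
/-- `e` if `c ≠ 0`, and `f` otherwise. -/
def ite (c e f : ArithExpr) : ArithExpr := pos c * e + (1 - c) * f
def mod (e f : ArithExpr) : ArithExpr := e - (e / f) * f
def sum (x : ℕ) (e f : ArithExpr) : ArithExpr := fold .add 0 x e f
def prod (x : ℕ) (e f : ArithExpr) : ArithExpr := fold .mul 1 x e f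

section eval
variable (w ρ : ℕ → ℕ) (c e f : ArithExpr) (B x n : ℕ)

@[simp] theorem eval_var : (var x).eval w ρ = ρ x := rfl
@[simp] theorem eval_const : (const n).eval w ρ = n := rfl
@[simp] theorem eval_ofNat : ArithExpr.eval w ρ (no_index (OfNat.ofNat n)) = n := rfl
@[simp] theorem eval_inp : (inp e).eval w ρ = w (e.eval w ρ) := rfl
@[simp] theorem eval_add : (e + f).eval w ρ = e.eval w ρ + f.eval w ρ := rfl
@[simp] theorem eval_sub : (e - f).eval w ρ = e.eval w ρ - f.eval w ρ := rfl
@[simp] theorem eval_mul : (e * f).eval w ρ = e.eval w ρ * f.eval w ρ := rfl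
@[simp] theorem eval_div : (e / f).eval w ρ = e.eval w ρ / f.eval w ρ := rfl

@[simp] theorem eval_pos : (pos e).eval w ρ = if e.eval w ρ = 0 then 0 else 1 := by
  simp only [pos, eval_sub, eval_ofNat]; split_ifs <;> omega

@[simp] theorem eval_lt : (lt e f).eval w ρ = if e.eval w ρ < f.eval w ρ then 1 else 0 := by
  simp only [lt, eval_sub, eval_pos, Nat.sub_eq_zero_iff_le]
  by_cases h : e.eval w ρ < f.eval w ρ
  · rw [if_pos h, if_neg (by omega)]
  · rw [if_neg h, if_pos (by omega)]

@[simp] theorem eval_eq : (eq e f).eval w ρ = if e.eval w ρ = f.eval w ρ then 1 else 0 := by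
  simp only [eq, eval_sub, eval_add, eval_ofNat]; split_ifs <;> omega

@[simp] theorem eval_ite :
    (ite c e f).eval w ρ = if c.eval w ρ = 0 then f.eval w ρ else e.eval w ρ := by
  simp only [ite, eval_sub, eval_add, eval_mul, eval_pos, eval_ofNat]
  split_ifs with h
  · simp [h]
  · rw [Nat.sub_eq_zero_of_le (by omega)]; simp

@[simp] theorem eval_mod : (mod e f).eval w ρ = e.eval w ρ % f.eval w ρ := by
  simp only [mod, eval_sub, eval_div, eval_mul]
  rw [Nat.mod_eq_sub_div_mul]

@[simp] theorem eval_sum : (sum x e f).eval w ρ =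
    ∑ i ∈ Finset.range (e.eval w ρ), f.eval w (Function.update ρ x i) := BinOp.iter_add _ _

@[simp] theorem eval_prod : (prod x e f).eval w ρ =
    ∏ i ∈ Finset.range (e.eval w ρ), f.eval w (Function.update ρ x i) := BinOp.iter_mul _ _

@[simp] theorem limitsLE_var : (var x).LimitsLE B w ρ := trivial
@[simp] theorem limitsLE_const : (const n).LimitsLE B w ρ := trivial
@[simp] theorem limitsLE_ofNat : ArithExpr.LimitsLE B w ρ (no_index (OfNat.ofNat n)) := trivial
@[simp] theorem limitsLE_inp : (inp e).LimitsLE B w ρ ↔ e.LimitsLE B w ρ := Iff.rfl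
@[simp] theorem limitsLE_add :
    (e + f).LimitsLE B w ρ ↔ e.LimitsLE B w ρ ∧ f.LimitsLE B w ρ := Iff.rfl
@[simp] theorem limitsLE_sub :
    (e - f).LimitsLE B w ρ ↔ e.LimitsLE B w ρ ∧ f.LimitsLE B w ρ := Iff.rfl
@[simp] theorem limitsLE_mul :
    (e * f).LimitsLE B w ρ ↔ e.LimitsLE B w ρ ∧ f.LimitsLE B w ρ := Iff.rfl
@[simp] theorem limitsLE_div :
    (e / f).LimitsLE B w ρ ↔ e.LimitsLE B w ρ ∧ f.LimitsLE B w ρ := Iff.rfl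

@[simp] theorem limitsLE_pos : (pos e).LimitsLE B w ρ ↔ e.LimitsLE B w ρ := by simp [pos]

@[simp] theorem limitsLE_lt :
    (lt e f).LimitsLE B w ρ ↔ e.LimitsLE B w ρ ∧ f.LimitsLE B w ρ := by simp [lt, and_comm]

@[simp] theorem limitsLE_eq :
    (eq e f).LimitsLE B w ρ ↔ e.LimitsLE B w ρ ∧ f.LimitsLE B w ρ := by
  simp only [eq, limitsLE_sub, limitsLE_add, limitsLE_ofNat]; tauto

@[simp] theorem limitsLE_ite : (ite c e f).LimitsLE B w ρ ↔
    c.LimitsLE B w ρ ∧ e.LimitsLE B w ρ ∧ f.LimitsLE B w ρ := by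
  simp only [ite, limitsLE_sub, limitsLE_add, limitsLE_mul, limitsLE_pos, limitsLE_ofNat]; tauto

@[simp] theorem limitsLE_mod :
    (mod e f).LimitsLE B w ρ ↔ e.LimitsLE B w ρ ∧ f.LimitsLE B w ρ := by
  simp only [mod, limitsLE_sub, limitsLE_mul, limitsLE_div]; tauto

@[simp] theorem limitsLE_sum : (sum x e f).LimitsLE B w ρ ↔ e.LimitsLE B w ρ ∧
    e.eval w ρ ≤ B ∧ ∀ i < e.eval w ρ, f.LimitsLE B w (Function.update ρ x i) := Iff.rfl

@[simp] theorem limitsLE_prod : (prod x e f).LimitsLE B w ρ ↔ e.LimitsLE B w ρ ∧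
    e.eval w ρ ≤ B ∧ ∀ i < e.eval w ρ, f.LimitsLE B w (Function.update ρ x i) := Iff.rfl

end eval

end ArithExpr

/-! ### The encoding of the hitting hypergraph -/

theorem matrixWord_eq_map {m n : ℕ} {a : Fin m → Fin n → ℕ} {g : ℕ → ℕ}
    (h : ∀ i j, a i j = g (i * n + j)) : matrixWord a = (List.range (m * n)).map g := by
  refine List.ext_getElem (by simp [matrixWord]) fun t h1 h2 => ?_
  simp only [matrixWord, List.getElem_ofFn, List.getElem_map, List.getElem_range, h]
  congr 1
  simp only [finProdFinEquiv, Equiv.coe_fn_symm_mk, Fin.divNat, Fin.modNat]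
  exact Nat.div_add_mod' t n

theorem matrixWord_getD {m n : ℕ} (a : Fin m → Fin n → ℕ) (i : Fin m) (j : Fin n) :
    (matrixWord a).getD (i * n + j) 0 = a i j := by
  have hlt : (i : ℕ) * n + j < m * n := by
    calc (i : ℕ) * n + j < i * n + n := by omega
      _ = (i + 1) * n := by ring
      _ ≤ m * n := Nat.mul_le_mul_right _ i.2
  have hn : 0 < n := j.pos
  rw [List.getD_eq_getElem _ _ (by rw [matrixWord_length]; exact hlt)]
  simp only [matrixWord, List.getElem_ofFn, finProdFinEquiv, Equiv.coe_fn_symm_mk, Fin.divNat,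
    Fin.modNat]
  congr 1
  · refine Fin.ext ?_
    change ((i : ℕ) * n + j) / n = i
    rw [mul_comm, Nat.mul_add_div hn, Nat.div_eq_of_lt j.2, add_zero]
  · refine Fin.ext ?_
    change ((i : ℕ) * n + j) % n = j
    rw [mul_comm, Nat.mul_add_mod, Nat.mod_eq_of_lt j.2]

/-- The instance that consists of the single-edge hypergraph and the hitting hypergraph. -/
noncomputable def hittingInst (k s R : ℕ) (hit : ℕ → ℕ → ℕ → Prop) (hk : 0 < k) (hs : 0 < s) :
    PatternInst FinHypergraph.singleEdgeFamily where
  H := singleEdgeCode k hk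
  G := hittingCode k s R hit hs
  mem := ⟨k, hk, toFinHypergraph_singleEdgeCode k hk⟩

/-- The length of the encoding of `hittingInst`. -/
def hittingLength (k s R : ℕ) : ℕ := k + 4 + (R + k) * (k * s + R + 1)

open Classical in
/-- The entries of the encoding of `hittingInst`. -/
noncomputable def hittingEntry (k s R : ℕ) (hit : ℕ → ℕ → ℕ → Prop) (t : ℕ) : ℕ :=
  if t < k + 4 then
    if t = 0 then k else if t < k + 2 then 1 else if t = k + 2 then k * s + R + 1 else R + k
  else if hittingInc k s R hit ((t - (k + 4)) / (k * s + R + 1)) ((t - (k + 4)) % (k * s + R + 1))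
    then 1 else 0

/-- The pattern contributes `k`, its edge number `1` and `k` matrix entries `1`, which explains the
uniform value on positions `1` to `k + 1`. The host contributes its two dimensions and then its
matrix from position `k + 4` on. -/
theorem word_hittingInst {k s R : ℕ} {hit : ℕ → ℕ → ℕ → Prop} (hk : 0 < k) (hs : 0 < s) :
    (hittingInst k s R hit hk hs).word =
      (List.range (hittingLength k s R)).map (hittingEntry k s R hit) := by
  classical
  have h1 : (singleEdgeCode k hk).word = (List.range (2 + k)).map (hittingEntry k s R hit) := by
    have : matrixWord (fun i v => ((singleEdgeCode k hk).inc i v).toNat) =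
        (List.range (1 * k)).map fun t => hittingEntry k s R hit (2 + t) := by
      refine matrixWord_eq_map fun i j => ?_
      have hj : (j : ℕ) < k := j.2
      have hi : (i : ℕ) = 0 := Nat.lt_one_iff.1 i.2
      have : 2 + ((i : ℕ) * (singleEdgeCode k hk).n + j) = 2 + j := by rw [hi]; simp
      rw [this]
      simp only [hittingEntry, singleEdgeCode, Bool.toNat_true]
      rw [if_pos (by omega), if_neg (by omega), if_pos (by omega)]
    rw [HypergraphCode.word]
    erw [this]
    rw [List.range_add, one_mul]
    simp [List.range_succ, hittingEntry, singleEdgeCode, hk, Function.comp_def]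
  have h2 : (hittingCode k s R hit hs).word = (List.range (2 + (R + k) * (k * s + R + 1))).map
      fun t => hittingEntry k s R hit (2 + k + t) := by
    have : matrixWord (fun i v => ((hittingCode k s R hit hs).inc i v).toNat) =
        (List.range ((R + k) * (k * s + R + 1))).map fun t =>
          hittingEntry k s R hit (2 + k + (2 + t)) := by
      refine matrixWord_eq_map (m := R + k) (n := k * s + R + 1) fun i j => ?_
      rw [hittingEntry, if_neg (by omega), show 2 + k + (2 + ((i : ℕ) * (k * s + R + 1) + j)) -
        (k + 4) = (k * s + R + 1) * i + j by rw [mul_comm]; omega, Nat.mul_add_div (by omega),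
        Nat.div_eq_of_lt j.2, Nat.mul_add_mod, Nat.mod_eq_of_lt j.2, add_zero]
      simp only [hittingCode]
      split_ifs with h <;> simp [h]
    rw [HypergraphCode.word]
    erw [this]
    rw [List.range_add]
    simp only [List.map_append, List.map_map, Function.comp_def]
    have e1 : hittingEntry k s R hit (2 + k + 0) = k * s + R + 1 := by
      rw [hittingEntry, if_pos (by omega), if_neg (by omega), if_neg (by omega),
        if_pos (by omega)]
    have e2 : hittingEntry k s R hit (2 + k + 1) = R + k := by
      rw [hittingEntry, if_pos (by omega), if_neg (by omega), if_neg (by omega),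
        if_neg (by omega)]
    simp only [List.range_succ, List.range_zero, List.map_nil, List.map_cons,
      e1, e2, List.nil_append, List.cons_append]
    rfl
  rw [PatternInst.word]
  change (singleEdgeCode k hk).word ++ (hittingCode k s R hit hs).word = _
  rw [h1, h2, hittingLength, show k + 4 + (R + k) * (k * s + R + 1) =
    (2 + k) + (2 + (R + k) * (k * s + R + 1)) by omega, List.range_add (n := 2 + k)]
  simp [Function.comp_def]

theorem hittingEntry_le (k s R : ℕ) (hit : ℕ → ℕ → ℕ → Prop) (hk : 0 < k) (hs : 0 < s) (t : ℕ) :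
    hittingEntry k s R hit t ≤ k * s + R + 1 := by
  have : k ≤ k * s := Nat.le_mul_of_pos_right _ hs
  unfold hittingEntry
  split_ifs <;> omega

namespace ArithExpr

/-- The expression `E` depends only on the variable `0`, and has value `c` when that variable has
value `t`. -/
def EvalsTo (w : ℕ → ℕ) (t : ℕ) (E : ArithExpr) (c : ℕ) : Prop := ∀ ρ, ρ 0 = t → E.eval w ρ = c

/-- The bound on iterations is satisfied whenever the variable `0` has value `t`. -/
def Limited (B : ℕ) (w : ℕ → ℕ) (t : ℕ) (E : ArithExpr) : Prop := ∀ ρ, ρ 0 = t → E.LimitsLE B w ρ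

section hitting
variable (K S R : ArithExpr) (hit : ArithExpr → ArithExpr → ArithExpr → ArithExpr)

/-- The length of the encoding of a hitting hypergraph, as an expression. -/
def hittingLengthE : ArithExpr := K + 4 + (R + K) * (K * S + R + 1)

/-- The edge of an entry of the incidence matrix. -/
def hittingEdgeE : ArithExpr := (var 0 - (K + 4)) / (K * S + R + 1)

/-- The vertex of an entry of the incidence matrix. -/
def hittingVertexE : ArithExpr := mod (var 0 - (K + 4)) (K * S + R + 1)

/-- The entries of the encoding of a hitting hypergraph, as an expression; the position is the
variable `0`. -/
def hittingEntryE : ArithExpr :=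
  ite (lt (var 0) (K + 4))
    (ite (eq (var 0) 0) K (ite (lt (var 0) (K + 2)) 1 (ite (eq (var 0) (K + 2)) (K * S + R + 1)
      (R + K))))
    (ite (lt (hittingVertexE K S R) (K * S))
      (ite (lt (hittingEdgeE K S R) R)
        (1 - hit (hittingEdgeE K S R) (hittingVertexE K S R / S) (mod (hittingVertexE K S R) S))
        (1 - eq (hittingVertexE K S R / S) (hittingEdgeE K S R - R)))
      (ite (lt (hittingEdgeE K S R) R) (eq (hittingVertexE K S R - K * S) (hittingEdgeE K S R)) 1))

end hitting

open Classical in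
-- The expression for a constraint has to be correct only for genuine constraints, classes and
-- options. Elsewhere the case distinctions multiply its value by zero, so it may read irrelevant
-- parts of the input there.
theorem eval_hittingEntryE {K S R : ArithExpr} {hit : ArithExpr → ArithExpr → ArithExpr → ArithExpr}
    {w : ℕ → ℕ} {k s r : ℕ} {h : ℕ → ℕ → ℕ → Prop} (t : ℕ) (hs : 0 < s)
    (hK : EvalsTo w t K k) (hS : EvalsTo w t S s) (hR : EvalsTo w t R r)
    (hh : ∀ C I A c i a, EvalsTo w t C c → EvalsTo w t I i → EvalsTo w t A a →
      c < r → i < k → a < s → EvalsTo w t (hit C I A) (if h c i a then 1 else 0)) :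
    EvalsTo w t (hittingEntryE K S R hit) (hittingEntry k s r h t) := by
  have hE : EvalsTo w t (hittingEdgeE K S R) ((t - (k + 4)) / (k * s + r + 1)) := fun ρ hρ => by
    simp [hittingEdgeE, hρ, hK ρ hρ, hS ρ hρ, hR ρ hρ]
  have hV : EvalsTo w t (hittingVertexE K S R) ((t - (k + 4)) % (k * s + r + 1)) := fun ρ hρ => by
    simp [hittingVertexE, hρ, hK ρ hρ, hS ρ hρ, hR ρ hρ]
  set e := (t - (k + 4)) / (k * s + r + 1)
  set v := (t - (k + 4)) % (k * s + r + 1)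
  intro ρ hρ
  simp only [hittingEntryE, eval_ite, eval_lt, eval_eq, eval_var, eval_ofNat, eval_add, eval_mul,
    eval_sub, eval_div, hρ, hK ρ hρ, hS ρ hρ, hR ρ hρ, hE ρ hρ, hV ρ hρ]
  unfold hittingEntry
  by_cases h1 : t < k + 4
  · simp only [h1, if_true, one_ne_zero, if_false]
    by_cases h2 : t = 0
    · simp [h2]
    · by_cases h3 : t < k + 2
      · simp [h2, h3]
      · by_cases h4 : t = k + 2 <;> simp [h2, h3, h4]
  · simp only [h1, if_false, if_true]
    change _ = if hittingInc k s r h e v then 1 else 0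
    unfold hittingInc
    by_cases h2 : v < k * s
    · by_cases h3 : e < r
      · have h4 := hh (hittingEdgeE K S R) (hittingVertexE K S R / S) (mod (hittingVertexE K S R) S)
          e (v / s) (v % s) hE (fun ρ hρ => by simp [hV ρ hρ, hS ρ hρ])
          (fun ρ hρ => by simp [hV ρ hρ, hS ρ hρ]) h3
          ((Nat.div_lt_iff_lt_mul hs).2 h2) (Nat.mod_lt _ hs)
        have h5 : ¬ k * s ≤ v := by omega
        have h6 : ¬ r ≤ e := by omega
        rw [h4 ρ hρ]
        by_cases h7 : h e (v / s) (v % s) <;> simp [h2, h3, h5, h6, h7]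
      · have h5 : ¬ k * s ≤ v := by omega
        have h6 : r ≤ e := by omega
        by_cases h7 : v / s = e - r <;> simp [h2, h3, h5, h6, h7]
    · have h5 : k * s ≤ v := by omega
      by_cases h3 : e < r
      · have h6 : ¬ r ≤ e := by omega
        by_cases h7 : v - k * s = e <;> simp [h2, h3, h5, h6, h7]
      · have h6 : r ≤ e := by omega
        simp [h2, h3, h5, h6]

/-- In contrast to correctness, no range conditions are available here: the arithmetic conditional
evaluates both branches, so iterations must be short even in the branch that is discarded. -/
theorem limited_hittingEntryE {K S R : ArithExpr}
    {hit : ArithExpr → ArithExpr → ArithExpr → ArithExpr} {w : ℕ → ℕ} {B t : ℕ}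
    (hK : Limited B w t K) (hS : Limited B w t S) (hR : Limited B w t R)
    (hh : ∀ C I A, Limited B w t C → Limited B w t I → Limited B w t A →
      Limited B w t (hit C I A)) :
    Limited B w t (hittingEntryE K S R hit) := by
  have hE : Limited B w t (hittingEdgeE K S R) := fun ρ hρ => by
    simp [hittingEdgeE, hK ρ hρ, hS ρ hρ, hR ρ hρ]
  have hV : Limited B w t (hittingVertexE K S R) := fun ρ hρ => by
    simp [hittingVertexE, hK ρ hρ, hS ρ hρ, hR ρ hρ]
  have h4 := hh (hittingEdgeE K S R) (hittingVertexE K S R / S) (mod (hittingVertexE K S R) S)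
    hE (fun ρ hρ => by simp [hV ρ hρ, hS ρ hρ]) (fun ρ hρ => by simp [hV ρ hρ, hS ρ hρ])
  intro ρ hρ
  simp [hittingEntryE, hK ρ hρ, hS ρ hρ, hR ρ hρ, hE ρ hρ, hV ρ hρ, h4 ρ hρ]

end ArithExpr

namespace ArithExpr

open Classical in
/-- Correctness of the programs that perform one call on the encoding of a hitting hypergraph. -/
theorem exec_callProg_hitting {O : List ℕ → ℕ → Prop} {K S R finE : ArithExpr}
    {hit : ArithExpr → ArithExpr → ArithExpr → ArithExpr} {q : Prog} {w : List ℕ}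
    {k s m r tq B B' : ℕ} {h : ℕ → ℕ → ℕ → Prop} (hk : 0 < k) (hs : 0 < s)
    (hw : ∀ a ∈ w, a.size ≤ B) (hlen : w.length.size ≤ B)
    (hLs : (hittingLength k s m).size ≤ B)
    (hK : ∀ t, EvalsTo (fun i => w.getD i 0) t K k) (hS : ∀ t, EvalsTo (fun i => w.getD i 0) t S s)
    (hR : ∀ t, EvalsTo (fun i => w.getD i 0) t R m)
    (hh : ∀ t C I A c i a, EvalsTo (fun i => w.getD i 0) t C c →
      EvalsTo (fun i => w.getD i 0) t I i → EvalsTo (fun i => w.getD i 0) t A a →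
      c < m → i < k → a < s →
      EvalsTo (fun i => w.getD i 0) t (hit C I A) (if h c i a then 1 else 0))
    (lK : ∀ t, Limited B (fun i => w.getD i 0) t K) (lS : ∀ t, Limited B (fun i => w.getD i 0) t S)
    (lR : ∀ t, Limited B (fun i => w.getD i 0) t R)
    (lh : ∀ t C I A, Limited B (fun i => w.getD i 0) t C → Limited B (fun i => w.getD i 0) t I →
      Limited B (fun i => w.getD i 0) t A → Limited B (fun i => w.getD i 0) t (hit C I A))
    (hB : B ≤ B') (hr : r.size ≤ B') (hFl : finE.LimitsLE B' (fun i => w.getD i 0) fun _ => r)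
    (hq : ∀ σ : Memory, σ.reg 1 = hittingLength k s m →
      σ.word 1 (σ.reg 1) = (hittingInst k s m h hk hs).word → Exec O q σ (σ.setReg 2 r) tq) :
    ∃ τ t, Exec O (callProg (hittingLengthE K S R) (hittingEntryE K S R hit) finE q)
        (Memory.init w) τ t ∧
      τ.reg 0 = finE.eval (fun i => w.getD i 0) (fun _ => r) ∧
      t ≤ (hittingLengthE K S R).time B + B + 10 + hittingLength k s m *
        ((hittingEntryE K S R hit).time B + (hittingEntryE K S R hit).bits B + 4 * B + 8) + tq +
        finE.time B' + finE.bits B' := by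
  refine exec_callProg (E := hittingEntry k s m h) hw hlen ?_ ?_ hLs ?_ ?_ hB hr hFl ?_
  · simp only [hittingLengthE, eval_add, eval_mul, eval_ofNat, hK _ _ rfl, hS _ _ rfl, hR _ _ rfl,
      hittingLength]
  · simp only [hittingLengthE, limitsLE_add, limitsLE_mul, limitsLE_ofNat, lK _ _ rfl, lS _ _ rfl,
      lR _ _ rfl, and_self]
  · exact fun t _ => eval_hittingEntryE t hs (hK t) (hS t) (hR t) (hh t) _ rfl
  · exact fun t _ => limited_hittingEntryE (lK t) (lS t) (lR t) (lh t) _ rfl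
  · exact fun σ h1 h2 => hq σ h1 (h2.trans (word_hittingInst hk hs).symm)

end ArithExpr

/-! ## Dominating sets reduce to trimmed homomorphisms -/

/-- The constraints on increasing enumerations of dominating sets with `k` elements: constraint
`u < n` says that `u` is dominated, constraint `j * n + u`, `0 < j < k`, that it is not the case that
`a j ≤ u ≤ a (j - 1)`. -/
def domHit {n : ℕ} (G : SimpleGraph (Fin n)) (c i a : ℕ) : Prop :=
  (c / n = 0 ∧ (a = c % n ∨ ∃ (ha : a < n) (hu : c % n < n), G.Adj ⟨a, ha⟩ ⟨c % n, hu⟩)) ∨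
    (c / n ≠ 0 ∧ ((i + 1 = c / n ∧ a < c % n) ∨ (i = c / n ∧ c % n < a)))

/-- Monotonicity is not a condition on single entries, but `a (j - 1) < a j` holds iff for every `u`
either `a (j - 1) < u` or `u < a j`, and each of these alternatives concerns a single entry. -/
theorem hitting_domHit_iff {n k : ℕ} (hk : 0 < k) (G : SimpleGraph (Fin n)) (a : Fin k → Fin n) :
    (∀ c < k * n, ∃ i : Fin k, domHit G c i (a i)) ↔
      StrictMono a ∧ ∀ v, ∃ i, a i = v ∨ G.Adj (a i) v := by
  obtain ⟨k, rfl⟩ := Nat.exists_eq_succ_of_ne_zero hk.ne'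
  have hlt : ∀ j ≤ k, ∀ u < n, j * n + u < (k + 1) * n := fun j hj u hu => by
    calc j * n + u < j * n + n := by omega
      _ = (j + 1) * n := by ring
      _ ≤ _ := Nat.mul_le_mul_right _ (by omega)
  have hdm : ∀ j, ∀ u < n, (j * n + u) / n = j ∧ (j * n + u) % n = u := fun j u hu => by
    have hn : 0 < n := by omega
    rw [mul_comm, Nat.mul_add_div hn, Nat.div_eq_of_lt hu, Nat.mul_add_mod, Nat.mod_eq_of_lt hu]
    simp
  constructor
  · intro h
    refine ⟨Fin.strictMono_iff_lt_succ.2 fun i => ?_, fun v => ?_⟩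
    · obtain ⟨x, hx⟩ := h _ (hlt (i + 1) i.2 (a i.castSucc) (a i.castSucc).2)
      obtain ⟨h1, h2⟩ := hdm (i + 1) (a i.castSucc) (a i.castSucc).2
      simp only [domHit, h1, h2] at hx
      rcases hx with ⟨h3, _⟩ | ⟨_, ⟨h3, h4⟩ | ⟨h3, h4⟩⟩
      · omega
      · have : x = i.castSucc := Fin.ext (by simpa using h3)
        subst this
        omega
      · have : x = i.succ := Fin.ext (by simpa using h3)
        subst this
        exact h4
    · obtain ⟨x, hx⟩ := h _ (hlt 0 (Nat.zero_le k) v v.2)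
      obtain ⟨h1, h2⟩ := hdm 0 v v.2
      simp only [domHit, h1, h2] at hx
      rcases hx with ⟨_, h3 | ⟨_, _, h3⟩⟩ | ⟨h3, _⟩
      · exact ⟨x, Or.inl (Fin.ext h3)⟩
      · exact ⟨x, Or.inr h3⟩
      · exact absurd rfl h3
  · rintro ⟨hm, hd⟩ c hc
    have hn : 0 < n := by
      rcases Nat.eq_zero_or_pos n with h | h
      · subst h; simp at hc
      · exact h
    have hu : c % n < n := Nat.mod_lt _ hn
    rcases hj : c / n with _ | j
    · obtain ⟨i, hi⟩ := hd ⟨c % n, hu⟩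
      refine ⟨i, Or.inl ⟨hj, ?_⟩⟩
      rcases hi with hi | hi
      · exact Or.inl (by rw [hi])
      · exact Or.inr ⟨(a i).2, hu, hi⟩
    · have hjk : j + 1 < k + 1 := by rw [← hj]; exact (Nat.div_lt_iff_lt_mul hn).2 hc
      have h1 : a ⟨j, by omega⟩ < a ⟨j + 1, hjk⟩ := hm (by simp)
      by_cases h2 : (a ⟨j, by omega⟩ : ℕ) < c % n
      · exact ⟨⟨j, by omega⟩, Or.inr ⟨by omega, Or.inl ⟨by simp [hj], h2⟩⟩⟩
      · refine ⟨⟨j + 1, hjk⟩, Or.inr ⟨by omega, Or.inr ⟨by simp [hj], ?_⟩⟩⟩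
        have : (a ⟨j, by omega⟩ : ℕ) < a ⟨j + 1, hjk⟩ := h1
        omega

/-- Sets with `k` elements correspond to strictly increasing sequences of length `k`. -/
theorem card_finset_eq_card_strictMono {n k : ℕ} (P : Set (Fin n) → Prop) :
    Nat.card {S : Finset (Fin n) // S.card = k ∧ P S} =
      Nat.card {a : Fin k → Fin n // StrictMono a ∧ P (Set.range a)} := by
  classical
  refine Nat.card_congr (Equiv.ofBijective
    (fun S => ⟨S.1.orderEmbOfFin S.2.1, (S.1.orderEmbOfFin S.2.1).strictMono, by
      rw [Finset.range_orderEmbOfFin]; exact S.2.2⟩) ⟨?_, ?_⟩)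
  · rintro ⟨S, hS⟩ ⟨T, hT⟩ h
    simp only [Subtype.mk.injEq] at h
    have h2 := congrArg Set.range h
    rw [Finset.range_orderEmbOfFin, Finset.range_orderEmbOfFin] at h2
    exact Subtype.ext (Finset.coe_injective h2)
  · rintro ⟨a, ha, hP⟩
    have hc : (Finset.univ.map ⟨a, ha.injective⟩).card = k := by simp
    refine ⟨⟨Finset.univ.map ⟨a, ha.injective⟩, hc, by simpa using hP⟩, Subtype.ext ?_⟩
    exact (Finset.orderEmbOfFin_unique hc (fun x => by simp) ha).symm

/-- Since each set has exactly one increasing enumeration, the ordering constraints make tuples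
count sets without repetition. -/
theorem value_domSet_eq (x : DomSetInst) :
    domSetProblem.value x = Nat.card (HittingChoice x.k x.n (x.k * x.n) (domHit x.graph)) := by
  have h := card_finset_eq_card_strictMono (n := x.n) (k := x.k)
    fun S => ∀ v, v ∈ S ∨ ∃ u ∈ S, x.graph.Adj u v
  simp only [Finset.mem_coe] at h
  refine h.trans (Nat.card_congr (Equiv.subtypeEquivRight fun a => ?_))
  rw [hitting_domHit_iff x.k_pos]
  refine and_congr_right fun _ => forall_congr' fun v => ?_
  simp only [Set.mem_range, exists_exists_eq_and]
  exact exists_or.symm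

/-! ### The reduction from dominating sets as arithmetic expressions. -/

namespace ArithExpr

/-- The number of options, `max n 1`. -/
def domOptionsE : ArithExpr := inp 1 + (1 - inp 1)

/-- The constraint `domHit` as an expression. -/
def domHitE (C I A : ArithExpr) : ArithExpr :=
  ite (C / inp 1)
    (pos (eq (I + 1) (C / inp 1) * lt A (mod C (inp 1)) +
      eq I (C / inp 1) * lt (mod C (inp 1)) A))
    (pos (eq A (mod C (inp 1)) + inp (2 + (A * inp 1 + mod C (inp 1)))))

/-- The number of dominating sets, when the variable `0` is the answer of the oracle. -/
def domFinalE : ArithExpr :=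
  (prod 1 (inp 0) (inp 0 * domOptionsE + inp 0 * inp 1 + 1) - var 0) /
    prod 1 (inp 0) (var 1 + 1) * pos (inp 1)

/-- The length of the query, as an expression. -/
def domLengthE : ArithExpr := hittingLengthE (inp 0) domOptionsE (inp 0 * inp 1)
/-- The entries of the query, as an expression. -/
def domEntryE : ArithExpr := hittingEntryE (inp 0) domOptionsE (inp 0 * inp 1) domHitE

/-- The reduction from dominating sets to trimmed homomorphisms. -/
def domProg : Prog := callProg domLengthE domEntryE domFinalE (.query 2 1 1)

/-- A bound on the running time of `domProg`. -/
def domCost (B : ℕ) : ℕ :=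
  domLengthE.time B + B + 10 + B * (domEntryE.time B + domEntryE.bits B + 4 * B + 8) +
    (1 + B + B * (B + 1) + B) + domFinalE.time B + domFinalE.bits B

theorem polyBounded_domCost : PolyBounded domCost := by
  have h := PolyBounded.id
  exact (((((domLengthE.polyBounded_time.add h).add (.const 10)).add (h.mul
    (((domEntryE.polyBounded_time.add domEntryE.polyBounded_bits).add
      ((PolyBounded.const 4).mul h)).add (.const 8)))).add ((((PolyBounded.const 1).add h).add
      (h.mul (h.add (.const 1)))).add h)).add domFinalE.polyBounded_time).add
      domFinalE.polyBounded_bits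

/-- A bound on the numbers and loops in `domProg`, for `X` the parameter plus the input size. -/
def domBound (X : ℕ) : ℕ :=
  X + (X + 4 + (X * X + X) * (X * (X + 1) + X * X + 1)) + (X * (X * (X + 1) + X * X + 1) + 1)

theorem polyBounded_domBound : PolyBounded domBound := by
  have h := PolyBounded.id
  have hN := ((h.mul (h.add (.const 1))).add (h.mul h)).add (.const 1)
  exact (h.add ((h.add (.const 4)).add (((h.mul h).add h).mul hN))).add
    ((h.mul hN).add (.const 1))

end ArithExpr

theorem Nat.size_pow_le (N k : ℕ) : (N ^ k).size ≤ k * N.size + 1 := by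
  rw [Nat.size_le, pow_succ, mul_comm k, pow_mul]
  have h := Nat.pow_le_pow_left (Nat.lt_size_self N).le k
  have : 0 < (2 ^ N.size) ^ k := by positivity
  omega

theorem Computable.nat_pow_const {f : ℕ → ℕ} (hf : Computable f) (d : ℕ) :
    Computable fun n => f n ^ d := by
  induction d with
  | zero => simpa using Computable.const 1
  | succ d ih => simpa only [pow_succ] using Primrec.nat_mul.to_comp.comp ih hf

open ArithExpr in
-- The single query has the same parameter `k` as the input. Because `k` is written in binary, it is
-- not polynomially bounded by the input size, hence the bound in terms of their sum.
theorem exec_domProg (x : DomSetInst) : ∃ τ t B,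
    Exec ((trimHomProblem FinHypergraph.singleEdgeFamily).oracle x.k) domProg (.init x.word) τ t ∧
      τ.reg 0 = domSetProblem.value x ∧ B ≤ domBound (x.k + wordSize x.word) ∧ t ≤ domCost B := by
  classical
  obtain ⟨k, hk, n, G⟩ := x
  set x : DomSetInst := ⟨k, hk, n, G⟩ with hx
  set w := x.word with hw
  set W := wordSize w
  have hw0 : w.getD 0 0 = k := rfl
  have hw1 : w.getD 1 0 = n := rfl
  have hadj : ∀ a u (ha : a < n) (hu : u < n),
      w.getD (2 + (a * n + u)) 0 = if G.Adj ⟨a, ha⟩ ⟨u, hu⟩ then 1 else 0 := by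
    intro a u ha hu
    rw [add_comm]
    exact matrixWord_getD (fun i j => if G.Adj i j then 1 else 0) ⟨a, ha⟩ ⟨u, hu⟩
  have hlen : w.length = n * n + 2 := by
    change (matrixWord _).length + 1 + 1 = _
    rw [matrixWord_length]
  have hlW := length_le_wordSize w
  have hnW : n ≤ W := by nlinarith
  have hW1 : 1 ≤ W := by omega
  set s := n + (1 - n) with hs'
  have hs : 0 < s := by omega
  set N := k * s + k * n + 1 with hN
  set L := hittingLength k s (k * n) with hL
  set r := FinHypergraph.numTrimHom (.singleEdge k hk)
    (hittingCode k s (k * n) (domHit G) hs).toFinHypergraph with hr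
  have hcount := numTrimHom_hittingCode hk hs (k * n) (domHit G)
  rw [← hr, ← hN] at hcount
  -- `W` covers the input, `L` the length of the query, and `k * N + 1` the bit length of the answer
  -- `r ≤ N ^ k`.
  set B := W + L + (k * N + 1) with hB
  have hfact : ∏ i ∈ Finset.range k, (i + 1) = k.factorial := Finset.prod_range_add_one_eq_factorial k
  have hfin : domFinalE.eval (fun i => w.getD i 0) (fun _ => r) = domSetProblem.value x := by
    simp only [domFinalE, domOptionsE, eval_mul, eval_div, eval_sub, eval_prod, eval_inp, eval_ofNat,
      eval_add, eval_var, eval_pos, hw0, hw1, Finset.prod_const, Finset.card_range,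
      Function.update_self, hfact]
    rw [value_domSet_eq]
    -- For the empty graph the query was made with `s = 1`, so its answer says nothing about the
    -- graph; the factor `pos (inp 1)` supplies the correct value `0`.
    rcases Nat.eq_zero_or_pos n with h0 | h0
    · subst h0
      have : IsEmpty (HittingChoice k 0 (k * 0) (domHit G)) := ⟨fun a => (a.1 ⟨0, hk⟩).elim0⟩
      simp [hx]
    · have hsn : s = n := by omega
      have h1 : ∀ s (_ : s = n), Nat.card (HittingChoice k s (k * n) (domHit G)) =
        Nat.card (HittingChoice k n (k * n) (domHit G)) := by rintro s rfl; rfl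
      rw [if_neg h0.ne', mul_one]
      change (N ^ k - r) / _ = Nat.card (HittingChoice k n (k * n) (domHit G))
      rw [← h1 s hsn, ← hcount, Nat.add_sub_cancel_left,
        Nat.mul_div_cancel_left _ (Nat.factorial_pos k)]
  have hrB : r.size ≤ k * N + 1 :=
    (Nat.size_le_size (show r ≤ N ^ k by omega)).trans
      ((Nat.size_pow_le N k).trans (by gcongr; exact Nat.size_le_self N))
  have hkN : k ≤ k * N := Nat.le_mul_of_pos_right _ (by omega)
  have hLNk : L = k + 4 + (k * n + k) * N := rfl
  have hNL : N ≤ L := by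
    have : N ≤ (k * n + k) * N := Nat.le_mul_of_pos_left _ (by omega)
    omega
  obtain ⟨τ, t, e1, e2, e3⟩ := exec_callProg_hitting (w := w) (k := k) (s := s) (m := k * n)
    (O := (trimHomProblem FinHypergraph.singleEdgeFamily).oracle k)
    (r := r) (B := B) (B' := B) (h := domHit G) (finE := domFinalE) (K := inp 0)
    (S := domOptionsE) (R := inp 0 * inp 1) (hit := domHitE) (q := .query 2 1 1)
    (tq := 1 + L.size + wordSize (hittingInst k s (k * n) (domHit G) hk hs).word + r.size)
    hk hs (fun a ha => (size_le_wordSize a ha).trans (by omega))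
    ((Nat.size_le_self _).trans (by omega)) ((Nat.size_le_self _).trans (by omega))
    (fun t ρ _ => hw0) (fun t ρ _ => by simp only [domOptionsE, eval_add, eval_sub, eval_inp,
      eval_ofNat, hw1, hs']) (fun t ρ _ => by simp only [eval_mul, eval_inp, eval_ofNat, hw0, hw1])
    (by
      intro t C I A c i a hC hI hA hc hi ha ρ hρ
      have hn : 0 < n := by
        rcases Nat.eq_zero_or_pos n with h | h
        · rw [h] at hc; simp at hc
        · exact h
      have han : a < n := by omega
      simp only [domHitE, eval_ite, eval_pos, eval_eq, eval_lt, eval_add, eval_mul, eval_div,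
        eval_mod, eval_inp, eval_ofNat, hC ρ hρ, hI ρ hρ, hA ρ hρ, hw1, domHit,
        hadj a (c % n) han (Nat.mod_lt _ hn)]
      have hu : c % n < n := Nat.mod_lt _ hn
      by_cases h0 : c / n = 0
      · by_cases h1 : a = c % n <;> by_cases h2 : G.Adj ⟨a, han⟩ ⟨c % n, hu⟩ <;>
          simp [h0, h1, h2, han, hu]
      · by_cases h1 : i + 1 = c / n <;> by_cases h2 : a < c % n <;> by_cases h3 : i = c / n <;>
          by_cases h4 : c % n < a <;> simp [h0, h1, h2, h3, h4])
    (fun t ρ _ => by simp) (fun t ρ _ => by simp [domOptionsE]) (fun t ρ _ => by simp)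
    (fun t C I A hC hI hA ρ hρ => by
      simp [domHitE, hC ρ hρ, hI ρ hρ, hA ρ hρ, -List.getD_eq_getElem?_getD])
    le_rfl (by omega)
    (by simp only [domFinalE, domOptionsE, limitsLE_mul, limitsLE_div, limitsLE_sub, limitsLE_prod,
          limitsLE_inp, limitsLE_ofNat, limitsLE_add, limitsLE_var, limitsLE_pos, eval_inp,
          eval_ofNat, hw0]
        simp only [implies_true, and_true, true_and]
        omega)
    (fun σ h1 h2 => by
      have h3 := Exec.query (O := (trimHomProblem FinHypergraph.singleEdgeFamily).oracle k)
        (r := 2) (a := 1) (l := 1) (v := r) (σ := σ)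
        ⟨hittingInst k s (k * n) (domHit G) hk hs, h2.symm, le_rfl, by
          change FinHypergraph.numTrimHom (singleEdgeCode k hk).toFinHypergraph _ = r
          rw [toFinHypergraph_singleEdgeCode]
          rfl⟩
      rw [h2, h1] at h3
      exact h3)
  have hqw : wordSize (hittingInst k s (k * n) (domHit G) hk hs).word ≤ B * (B + 1) := by
    refine (wordSize_le (B := N) fun a ha => ?_).trans ?_
    · rw [word_hittingInst] at ha
      obtain ⟨t, -, rfl⟩ := List.mem_map.1 ha
      exact (Nat.size_le_self _).trans (hittingEntry_le k s (k * n) (domHit G) hk hs t)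
    · rw [word_hittingInst, List.length_map, List.length_range]
      exact Nat.mul_le_mul (by omega) (by omega)
  have hLs : L.size ≤ B := (Nat.size_le_self _).trans (by omega)
  refine ⟨τ, t, B, e1, e2.trans hfin, ?_, ?_⟩
  · change B ≤ domBound (k + W)
    unfold domBound
    have h1 : k * n ≤ (k + W) * (k + W) := Nat.mul_le_mul (by omega) (by omega)
    have h2 : N ≤ (k + W) * (k + W + 1) + (k + W) * (k + W) + 1 := by
      have : k * s ≤ (k + W) * (k + W + 1) := Nat.mul_le_mul (by omega) (by omega)
      omega
    have h3 : k * N ≤ (k + W) * ((k + W) * (k + W + 1) + (k + W) * (k + W) + 1) :=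
      Nat.mul_le_mul (by omega) h2
    have h4 : (k * n + k) * N ≤ ((k + W) * (k + W) + (k + W)) *
        ((k + W) * (k + W + 1) + (k + W) * (k + W) + 1) := Nat.mul_le_mul (by omega) h2
    omega
  · have hLB : L * (domEntryE.time B + domEntryE.bits B + 4 * B + 8) ≤
        B * (domEntryE.time B + domEntryE.bits B + 4 * B + 8) :=
      Nat.mul_le_mul_right _ (by omega)
    have e3' : t ≤ domLengthE.time B + B + 10 +
        L * (domEntryE.time B + domEntryE.bits B + 4 * B + 8) +
        (1 + L.size + wordSize (hittingInst k s (k * n) (domHit G) hk hs).word + r.size) +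
        domFinalE.time B + domFinalE.bits B := e3
    unfold domCost
    omega

theorem wordSize_domSetInst_pos (x : DomSetInst) : 1 ≤ wordSize x.word :=
  le_trans (by simp [DomSetInst.word]) (length_le_wordSize x.word)

open ArithExpr in
theorem sharpW2Hard_trimHomProblem :
    (trimHomProblem FinHypergraph.singleEdgeFamily).SharpW2Hard := by
  obtain ⟨C', D', hF⟩ := polyBounded_domCost
  obtain ⟨C, D, hCD⟩ : PolyBounded fun X => C' * (domBound X + 1) ^ D' :=
    (PolyBounded.const C').mul ((polyBounded_domBound.add (.const 1)).pow D')
  -- The dependence on parameter and size separates because `k + W + 1 ≤ (k + 2) * W` for `W ≥ 1`.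
  refine ⟨domProg, fun k => C * (k + 2) ^ D, fun k => k, D,
    Primrec.nat_mul.to_comp.comp (Computable.const C) (Computable.nat_pow_const
      (Primrec.nat_add.to_comp.comp Computable.id (Computable.const 2)) D), Computable.id,
    fun x => ?_⟩
  obtain ⟨τ, t, B, h1, h2, h3, h4⟩ := exec_domProg x
  refine ⟨τ, t, h1, h2, ?_⟩
  have hW := wordSize_domSetInst_pos x
  set W := wordSize x.word with hWdef
  have hfinal : t ≤ C * (x.k + 2) ^ D * W ^ D := by
    calc t ≤ C' * (B + 1) ^ D' := h4.trans (hF B)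
      _ ≤ C' * (domBound (x.k + W) + 1) ^ D' := by gcongr
      _ ≤ C * (x.k + W + 1) ^ D := hCD (x.k + W)
      _ ≤ C * ((x.k + 2) * W) ^ D := by
          gcongr
          nlinarith
      _ = C * (x.k + 2) ^ D * W ^ D := by rw [mul_pow, mul_assoc]
  exact_mod_cast hfinal

/-! ## Composition of reductions with algorithms -/

/-- Replace oracle queries by calls of a program. -/
def Prog.answerBy (q : Prog) : Prog → Prog
  | .seq p p' => .seq (answerBy q p) (answerBy q p')
  | .ite r p p' => .ite r (answerBy q p) (answerBy q p')
  | .loop r p => .loop r (answerBy q p)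
  | .call p r a l => .call (answerBy q p) r a l
  | .query r a l => .call q r a l
  | .skip => .skip
  | .const r c => .const r c
  | .op o r x y => .op o r x y
  | .load r a i => .load r a i
  | .store a i x => .store a i x

/-- A query is charged for the size of its word, so every queried word has size at most `T` and its
answer takes time at most `c * T ^ d`. Each query also costs at least one unit, so the overhead is
at most this amount per unit of the original time. Procedures run in fresh memory and cannot disturb
the caller. -/
theorem Exec.answerBy {O O' : List ℕ → ℕ → Prop} {q : Prog} {c d : ℕ}
    (hq : ∀ w v, O w v → ∃ τ t, Exec O' q (.init w) τ t ∧ τ.reg 0 = v ∧ t ≤ c * wordSize w ^ d)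
    {p : Prog} {σ τ : Memory} {t T : ℕ} (h : Exec O p σ τ t) (hT : t ≤ T) :
    ∃ t', Exec O' (q.answerBy p) σ τ t' ∧ t' ≤ t * (1 + c * T ^ d) := by
  have hM : ∀ x, x ≤ x * (1 + c * T ^ d) := fun x => Nat.le_mul_of_pos_right _ (by omega)
  induction h with
  | skip σ => exact ⟨_, .skip σ, hM _⟩
  | const σ r c => exact ⟨_, .const σ r c, hM _⟩
  | op σ o r x y => exact ⟨_, .op σ o r x y, hM _⟩
  | load σ r a i => exact ⟨_, .load σ r a i, hM _⟩
  | store σ a i x => exact ⟨_, .store σ a i x, hM _⟩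
  | seq _ _ ih1 ih2 =>
    obtain ⟨t1, e1, h1⟩ := ih1 (by omega)
    obtain ⟨t2, e2, h2⟩ := ih2 (by omega)
    exact ⟨_, .seq e1 e2, by rw [add_mul]; omega⟩
  | @ite_pos r _ _ σ _ t hr _ ih =>
    obtain ⟨t1, e1, h1⟩ := ih (by omega)
    have := hM (1 + (σ.reg r).size)
    exact ⟨_, .ite_pos hr e1, by rw [add_mul]; omega⟩
  | ite_neg hr _ ih =>
    obtain ⟨t1, e1, h1⟩ := ih (by omega)
    exact ⟨_, .ite_neg hr e1, by rw [add_mul]; omega⟩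
  | loop_done hr => exact ⟨_, .loop_done hr, hM _⟩
  | @loop_step r _ σ _ _ t u hr _ _ ih1 ih2 =>
    obtain ⟨t1, e1, h1⟩ := ih1 (by omega)
    obtain ⟨t2, e2, h2⟩ := ih2 (by omega)
    have := hM (1 + (σ.reg r).size)
    exact ⟨_, .loop_step hr e1 e2, by rw [add_mul _ u, add_mul _ t]; omega⟩
  | @call p r a l σ τ t _ ih =>
    obtain ⟨t1, e1, h1⟩ := ih (by omega)
    have h2 := hM (1 + (σ.reg l).size + wordSize (σ.word a (σ.reg l)))
    have h3 := hM (τ.reg 0).size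
    exact ⟨_, .call e1, by rw [add_mul _ (τ.reg 0).size, add_mul _ t]; omega⟩
  | @query r a l v σ ho =>
    obtain ⟨τ, t, e, rfl, ht⟩ := hq _ _ ho
    refine ⟨_, .call e, ?_⟩
    have h1 : c * wordSize (σ.word a (σ.reg l)) ^ d ≤ c * T ^ d := by
      gcongr
      omega
    have h2 : c * T ^ d ≤
        (1 + (σ.reg l).size + wordSize (σ.word a (σ.reg l)) + (τ.reg 0).size) * (c * T ^ d) :=
      Nat.le_mul_of_pos_left _ (by omega)
    rw [mul_add, mul_one]
    omega

/-- Partial sums provide a computable monotone majorant of a computable function. -/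
theorem Computable.sum_range {f : ℕ → ℕ} (hf : Computable f) :
    Computable fun n => ∑ i ∈ Finset.range n, f i := by
  have h : Computable₂ fun (_ : ℕ) (p : ℕ × ℕ) => p.2 + f p.1 :=
    Primrec.nat_add.to_comp.comp (Computable.snd.comp Computable.snd)
      (hf.comp (Computable.fst.comp Computable.snd))
  refine (Computable.nat_rec Computable.id (Computable.const 0) h).of_eq fun n => ?_
  induction n with
  | zero => rfl
  | succ n ih => rw [Finset.sum_range_succ, ← ih]; rfl

namespace ParamCountingProblem

theorem PolyTime.fpt {P : ParamCountingProblem} : P.PolyTime → P.FPT := by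
  rintro ⟨p, c, d, h⟩
  exact ⟨p, fun _ => c, d, Computable.const c, h⟩

theorem FPTReducible.fpt {P Q : ParamCountingProblem} : P.FPTReducible Q → Q.FPT → P.FPT := by
  rintro ⟨p, f, g, d, hf, hg, hp⟩ ⟨q, f', d', hf', hq⟩
  -- `f'` need not be monotone, whereas queries may have any parameter up to `g k`; `F (g k)`
  -- dominates `f'` at all of them.
  let F : ℕ → ℕ := fun n => ∑ i ∈ Finset.range (n + 1), f' i
  have hF : Computable F := hf'.sum_range.comp Computable.succ
  refine ⟨q.answerBy p, fun k => f k ^ (d' + 1) * (1 + F (g k)), d * (d' + 1),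
    Primrec.nat_mul.to_comp.comp (hf.nat_pow_const _)
      (Primrec.nat_add.to_comp.comp (Computable.const 1) (hF.comp hg)), fun x => ?_⟩
  obtain ⟨τ, t, e, hv, ht⟩ := hp x
  set k := P.param x
  set w := wordSize (P.word x)
  have ht : t ≤ f k * w ^ d := by exact_mod_cast ht
  obtain ⟨t', e', ht'⟩ := e.answerBy (O' := noOracle) (q := q) (c := F (g k)) (d := d')
    (fun u v ⟨y, h1, h2, h3⟩ => by
      obtain ⟨τ, t, e, hv, ht⟩ := hq y
      rw [h1] at e ht
      refine ⟨τ, t, e, hv.trans h3, ?_⟩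
      have ht : t ≤ f' (Q.param y) * wordSize u ^ d' := by exact_mod_cast ht
      refine ht.trans (Nat.mul_le_mul_right _ ?_)
      exact Finset.single_le_sum (f := f') (fun _ _ => Nat.zero_le _)
        (Finset.mem_range.2 (by omega))) ht
  refine ⟨τ, t', e', hv, ?_⟩
  set T := f k * w ^ d
  have hfinal : t' ≤ f k ^ (d' + 1) * (1 + F (g k)) * w ^ (d * (d' + 1)) := by
    rcases Nat.eq_zero_or_pos T with h0 | h0
    · have : t = 0 := by omega
      simp [this] at ht'
      omega
    calc t' ≤ T * (1 + F (g k) * T ^ d') := ht'.trans (Nat.mul_le_mul_right _ ht)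
      _ ≤ T * ((1 + F (g k)) * T ^ d') := by
          gcongr
          rw [add_mul, one_mul]
          gcongr
          exact Nat.one_le_pow _ _ h0
      _ = T ^ (d' + 1) * (1 + F (g k)) := by ring
      _ = _ := by rw [mul_pow, ← pow_mul]; ring
  exact_mod_cast hfinal

end ParamCountingProblem

theorem not_fptReducible_of_not_fpt {Q : ParamCountingProblem} (hQ : Q.PolyTime)
    (h : ¬ domSetProblem.FPT) :
    ¬ (trimHomProblem FinHypergraph.singleEdgeFamily).FPTReducible Q := fun hr =>
  h (sharpW2Hard_trimHomProblem.fpt (hr.fpt hQ.fpt))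

/-! ## Counting induced trimmed sub-hypergraphs isomorphic to a single edge -/

theorem Set.image_equiv_eq_univ {α β : Type*} (σ : α ≃ β) {S : Set α} :
    σ '' S = Set.univ ↔ S = Set.univ := by
  rw [← Set.image_univ_of_surjective σ.surjective, σ.injective.image_injective.eq_iff]

namespace FinHypergraph

theorem trim_vertexSet {G : FinHypergraph} {X : Set ℕ} (hX : X ⊆ G.vertexSet) :
    (G.trim X).vertexSet = X := Set.inter_eq_right.2 hX

/-- Distinct vertex sets give distinct sub-hypergraphs, as `X` is recovered as the vertex set of
`G⟨X⟩`. -/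
theorem numIndTrimSub_eq (H G : FinHypergraph) :
    numIndTrimSub H G = {X | X ⊆ G.vertexSet ∧ (G.trim X).Iso H}.ncard := by
  have : indTrimSub H G = G.trim '' {X | X ⊆ G.vertexSet ∧ (G.trim X).Iso H} := by
    ext G'
    constructor
    · rintro ⟨⟨X, hX, rfl⟩, h⟩
      exact ⟨X, ⟨hX, h⟩, rfl⟩
    · rintro ⟨X, ⟨hX, h⟩, rfl⟩
      exact ⟨⟨X, hX, rfl⟩, h⟩
  rw [numIndTrimSub, this, Set.InjOn.ncard_image]
  intro X hX Y hY h
  rw [← trim_vertexSet hX.1, ← trim_vertexSet hY.1, h]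

theorem mem_edgeSet_iff {K : FinHypergraph} {e : Set ℕ} :
    e ∈ K.edgeSet ↔ ∃ S, K.IsEdge S ∧ e = Subtype.val '' S := by
  constructor
  · intro h
    have : e = Subtype.val '' (Subtype.val ⁻¹' e : Set K.V) := by
      rw [Subtype.image_preimage_coe]
      exact (Set.inter_eq_right.2 (K.subset_vertexSet_of_mem_edgeSet' h)).symm
    exact ⟨_, by rw [IsEdge, ← this]; exact h, this⟩
  · rintro ⟨S, h, rfl⟩
    exact h

theorem isEdge_iff_eq_univ {K : FinHypergraph} (h : K.edgeSet = {K.vertexSet}) (S : Set K.V) :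
    K.IsEdge S ↔ S = Set.univ := by
  rw [IsEdge, h, Set.mem_singleton_iff]
  constructor
  · intro h2
    have h3 : Subtype.val '' S = Subtype.val '' (Set.univ : Set K.V) := by
      rw [h2, Set.image_univ, Subtype.range_coe]
    exact Subtype.val_injective.image_injective h3
  · rintro rfl
    rw [Set.image_univ, Subtype.range_coe]

/-- When the full vertex set is the only edge, every bijection of the vertices is an isomorphism, so
only their number matters. -/
theorem iso_singleEdge_iff {K : FinHypergraph} {k : ℕ} (hk : 0 < k) :
    K.Iso (singleEdge k hk) ↔ K.vertexSet.ncard = k ∧ K.edgeSet = {K.vertexSet} := by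
  have hB := isEdge_iff_eq_univ (K := singleEdge k hk) rfl
  have hcard : Nat.card (singleEdge k hk).V = k :=
    (Nat.card_congr (Fin.equivSubtype (n := k))).symm.trans (by simp)
  constructor
  · rintro ⟨σ, h⟩
    refine ⟨(Nat.card_congr σ).trans hcard, Set.ext fun e => ?_⟩
    have hK : ∀ S, K.IsEdge S ↔ S = Set.univ := fun S => by
      rw [h, hB, Set.image_equiv_eq_univ]
    rw [mem_edgeSet_iff, Set.mem_singleton_iff]
    simp only [hK, exists_eq_left, Set.image_univ, Subtype.range_coe]
  · rintro ⟨h1, h2⟩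
    have : Finite K.V := K.finite
    have : Finite (singleEdge k hk).V := (singleEdge k hk).finite
    obtain ⟨σ⟩ : Nonempty (K.V ≃ (singleEdge k hk).V) := Finite.card_eq.1 (Eq.trans h1 hcard.symm)
    refine ⟨σ, fun S => ?_⟩
    rw [hB, isEdge_iff_eq_univ h2, Set.image_equiv_eq_univ]

end FinHypergraph

/-- The twin sets: sets of `k` vertices that lie in the same edges, and in at least one edge. -/
def IsTwinSet (C : HypergraphCode) (k : ℕ) (S : Finset (Fin C.n)) : Prop :=
  S.card = k ∧ (∀ u ∈ S, ∀ v ∈ S, ∀ e, C.inc e u = C.inc e v) ∧ ∀ v ∈ S, ∃ e, C.inc e v = true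

namespace FinHypergraph

/-- That all non-empty traces on `S` equal `S` means that an edge containing one element of `S`
contains all of them; that `S` itself is a trace means that some edge does. -/
theorem trim_iso_singleEdge_iff {k : ℕ} (hk : 0 < k) (C : HypergraphCode) (S : Finset (Fin C.n)) :
    (C.toFinHypergraph.trim (Fin.val '' (S : Set (Fin C.n)))).Iso (singleEdge k hk) ↔
      IsTwinSet C k S := by
  have hsub : Fin.val '' (S : Set (Fin C.n)) ⊆ C.toFinHypergraph.vertexSet := by
    rintro _ ⟨v, -, rfl⟩
    exact v.2
  set X : Set ℕ := Fin.val '' (S : Set (Fin C.n)) with hX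
  have hmem : ∀ v : Fin C.n, (v : ℕ) ∈ X ↔ v ∈ S := fun v => by
    simp [hX, Fin.val_inj]
  have hcard : X.ncard = S.card := by
    rw [hX, Set.ncard_image_of_injective _ Fin.val_injective, Set.ncard_coe_finset]
  let E : Fin C.m → Set ℕ := fun i => {v | ∃ h : v < C.n, C.inc i ⟨v, h⟩ = true}
  have hE : ∀ i (v : Fin C.n), (v : ℕ) ∈ E i ↔ C.inc i v = true := fun i v => by simp [E]
  have hedge : (C.toFinHypergraph.trim X).edgeSet = {f | f.Nonempty ∧ ∃ i, f = E i ∩ X} := by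
    ext f
    constructor
    · rintro ⟨h1, _, ⟨i, rfl⟩, h2⟩
      exact ⟨h1, i, h2⟩
    · rintro ⟨h1, i, h2⟩
      exact ⟨h1, _, ⟨i, rfl⟩, h2⟩
  rw [iso_singleEdge_iff, trim_vertexSet hsub, hcard, hedge, IsTwinSet]
  refine and_congr_right fun hS => ?_
  obtain ⟨v0, hv0⟩ : S.Nonempty := Finset.card_pos.1 (by omega)
  constructor
  · intro h
    have h1 : ∀ i, ∀ u ∈ S, C.inc i u = true → ∀ v ∈ S, C.inc i v = true := by
      intro i u hu hiu v hv
      have h2 : E i ∩ X ∈ ({X} : Set (Set ℕ)) := by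
        rw [← h]
        exact ⟨⟨u, (hE i u).2 hiu, (hmem u).2 hu⟩, i, rfl⟩
      have h3 : (v : ℕ) ∈ E i ∩ X := by
        rw [Set.mem_singleton_iff.1 h2]
        exact (hmem v).2 hv
      exact (hE i v).1 h3.1
    refine ⟨fun u hu v hv e => Bool.eq_iff_iff.2 ⟨fun h => h1 e u hu h v hv,
      fun h => h1 e v hv h u hu⟩, fun v hv => ?_⟩
    have h2 : X ∈ ({X} : Set (Set ℕ)) := rfl
    rw [← h] at h2
    obtain ⟨-, i, hi⟩ := h2
    have h3 := (hmem v).2 hv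
    rw [hi] at h3
    exact ⟨i, (hE i v).1 h3.1⟩
  · rintro ⟨h1, h2⟩
    obtain ⟨e0, he0⟩ := h2 v0 hv0
    have h3 : ∀ i, C.inc i v0 = true → E i ∩ X = X := fun i hi => by
      refine Set.inter_eq_right.2 ?_
      rintro _ ⟨v, hv, rfl⟩
      rw [hE, h1 v hv v0 hv0]
      exact hi
    ext f
    constructor
    · rintro ⟨⟨u, hu⟩, i, rfl⟩
      obtain ⟨v, hv, rfl⟩ := hu.2
      refine h3 i ?_
      rw [h1 v0 hv0 v hv]
      exact (hE i v).1 hu.1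
    · rintro rfl
      exact ⟨⟨v0, (hmem v0).2 hv0⟩, e0, (h3 e0 he0).symm⟩

theorem numIndTrimSub_singleEdge {k : ℕ} (hk : 0 < k) (C : HypergraphCode) :
    numIndTrimSub (singleEdge k hk) C.toFinHypergraph = Nat.card {S // IsTwinSet C k S} := by
  rw [numIndTrimSub_eq]
  refine (Nat.card_congr (Equiv.ofBijective (fun S : {S // IsTwinSet C k S} =>
    (⟨Fin.val '' (S.1 : Set (Fin C.n)), ?_, (trim_iso_singleEdge_iff hk C S.1).2 S.2⟩ :
      {X // X ∈ {X | X ⊆ C.toFinHypergraph.vertexSet ∧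
        (C.toFinHypergraph.trim X).Iso (singleEdge k hk)}})) ⟨?_, ?_⟩)).symm
  · rintro _ ⟨v, -, rfl⟩
    exact v.2
  · intro S T h
    simp only [Subtype.mk.injEq] at h
    exact Subtype.ext (Finset.coe_injective (Fin.val_injective.image_injective h))
  · rintro ⟨X, hX, h⟩
    classical
    have : Fin.val '' ((Finset.univ.filter fun v : Fin C.n => (v : ℕ) ∈ X : Finset (Fin C.n)) :
        Set (Fin C.n)) = X := by
      ext v
      simp only [Finset.coe_filter, Finset.mem_univ, true_and, Set.mem_image, Set.mem_ofPred_eq]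
      exact ⟨fun ⟨u, hu, e⟩ => e ▸ hu, fun hv => ⟨⟨v, hX hv⟩, hv, rfl⟩⟩
    refine ⟨⟨Finset.univ.filter fun v : Fin C.n => (v : ℕ) ∈ X, ?_⟩, Subtype.ext this⟩
    rw [← trim_iso_singleEdge_iff hk, this]
    exact h

end FinHypergraph

open Classical in
/-- Twin sets are counted by their minimal element. -/
theorem card_isTwinSet {k : ℕ} (hk : 0 < k) (C : HypergraphCode) :
    Nat.card {S // IsTwinSet C k S} = ∑ v : Fin C.n, if ∃ e, C.inc e v = true then
      (Finset.univ.filter fun u => v < u ∧ ∀ e, C.inc e u = C.inc e v).card.choose (k - 1)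
      else 0 := by
  let U : Fin C.n → Finset (Fin C.n) := fun v =>
    Finset.univ.filter fun u => v < u ∧ ∀ e, C.inc e u = C.inc e v
  have hU : ∀ v T, T ⊆ U v → v ∉ T := fun v T hT hv => by
    have := hT hv
    simp [U] at this
  -- A twin set is its least element `v` together with `k - 1` of the later twins of `v`.
  have hset : Finset.univ.filter (IsTwinSet C k) =
      (Finset.univ.filter fun v => ∃ e, C.inc e v = true).biUnion fun v =>
        ((U v).powersetCard (k - 1)).image (insert v) := by
    ext S
    simp only [Finset.mem_filter, Finset.mem_univ, true_and, Finset.mem_biUnion, Finset.mem_image,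
      Finset.mem_powersetCard]
    constructor
    · rintro ⟨h1, h2, h3⟩
      have hne : S.Nonempty := Finset.card_pos.1 (by omega)
      have hm := S.min'_mem hne
      refine ⟨S.min' hne, h3 _ hm, S.erase (S.min' hne), ⟨fun u hu => ?_, ?_⟩,
        Finset.insert_erase hm⟩
      · rw [Finset.mem_erase] at hu
        simp only [U, Finset.mem_filter, Finset.mem_univ, true_and]
        exact ⟨lt_of_le_of_ne (S.min'_le _ hu.2) (Ne.symm hu.1), h2 _ hu.2 _ hm⟩
      · rw [Finset.card_erase_of_mem hm, h1]
    · rintro ⟨v, hv, T, ⟨hT, hc⟩, rfl⟩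
      have htw : ∀ u ∈ insert v T, ∀ e, C.inc e u = C.inc e v := by
        intro u hu
        rcases Finset.mem_insert.1 hu with rfl | hu
        · exact fun _ => rfl
        · exact (Finset.mem_filter.1 (hT hu)).2.2
      refine ⟨?_, fun u hu u' hu' e => (htw u hu e).trans (htw u' hu' e).symm, fun u hu => ?_⟩
      · rw [Finset.card_insert_of_notMem (hU v T hT), hc]
        omega
      · obtain ⟨e, he⟩ := hv
        exact ⟨e, (htw u hu e).trans he⟩
  rw [Nat.card_eq_fintype_card, Fintype.card_subtype, hset, Finset.card_biUnion, Finset.sum_filter]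
  · refine Finset.sum_congr rfl fun v _ => ?_
    split_ifs
    · rw [Finset.card_image_of_injOn, Finset.card_powersetCard]
      intro T hT T' hT' h
      have h1 := hU v T (Finset.mem_powersetCard.1 hT).1
      have h2 := hU v T' (Finset.mem_powersetCard.1 hT').1
      rw [← Finset.erase_insert h1, ← Finset.erase_insert h2, h]
    · rfl
  -- If one set arose from `v ≠ v'`, each would be among the later twins of the other, giving both
  -- `v < v'` and `v' < v`.
  · intro v _ v' _ hne
    rw [Function.onFun, Finset.disjoint_left]
    intro S hS hS'
    obtain ⟨T, hT, rfl⟩ := Finset.mem_image.1 hS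
    obtain ⟨T', hT', h⟩ := Finset.mem_image.1 hS'
    have hTU := (Finset.mem_powersetCard.1 hT).1
    have hTU' := (Finset.mem_powersetCard.1 hT').1
    have h1 : v' ∈ T := (Finset.mem_insert.1 (h ▸ Finset.mem_insert_self v' T')).resolve_left hne.symm
    have h2 : v ∈ T' := (Finset.mem_insert.1 (h ▸ Finset.mem_insert_self v T)).resolve_left hne
    have h3 := (Finset.mem_filter.1 (hTU h1)).2.1
    have h4 := (Finset.mem_filter.1 (hTU' h2)).2.1
    exact lt_asymm h3 h4

/-- Every row of the incidence matrix is all ones and rows are distinct, so there is exactly one.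
This fixes where the encoding of the host starts in the input word. -/
theorem singleEdgeFamily_code {H : HypergraphCode}
    (h : H.toFinHypergraph ∈ FinHypergraph.singleEdgeFamily) :
    ∃ hk : 0 < H.n, H.toFinHypergraph = .singleEdge H.n hk ∧ H.m = 1 := by
  obtain ⟨k, hk, h⟩ := h
  have hn : H.n = k := by
    have h1 : Set.Iio H.n = Set.Iio k := congrArg (fun K => K.vertexSet) h
    exact Set.Iio_injective h1
  have hedge : {e | ∃ i, e = {v | ∃ h : v < H.n, H.inc i ⟨v, h⟩ = true}} = {Set.Iio k} :=
    congrArg (fun K => K.edgeSet) h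
  have hone : ∀ i v, H.inc i v = true := by
    intro i v
    have h1 : {v | ∃ h : v < H.n, H.inc i ⟨v, h⟩ = true} ∈ ({Set.Iio k} : Set (Set ℕ)) := by
      rw [← hedge]; exact ⟨i, rfl⟩
    have h2 : (v : ℕ) ∈ {v | ∃ h : v < H.n, H.inc i ⟨v, h⟩ = true} := by
      rw [Set.mem_singleton_iff.1 h1, ← hn]
      exact v.2
    exact h2.2
  have hm : H.m = 1 := by
    refine le_antisymm ?_ ?_
    · by_contra hlt
      have := H.inc_injective (a₁ := ⟨0, by omega⟩) (a₂ := ⟨1, by omega⟩)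
        (funext fun v => (hone _ v).trans (hone _ v).symm)
      simp at this
    · have h1 : Set.Iio k ∈ ({Set.Iio k} : Set (Set ℕ)) := rfl
      rw [← hedge] at h1
      obtain ⟨i, -⟩ := h1
      exact i.pos
  subst hn
  exact ⟨hk, h, hm⟩

/-! ### The number of twin sets as an arithmetic expression. -/

namespace ArithExpr

/-- The number of vertices of the host, or `0` if it has no edges. -/
def hostOrderE : ArithExpr := inp (inp 0 + 2) * pos (inp (inp 0 + 3))
/-- The incidence matrix of the host. -/
def hostIncE (e v : ArithExpr) : ArithExpr :=
  inp (inp 0 + 4 + (e * inp (inp 0 + 2) + v))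
/-- The number of twins of vertex `var 1` that come after it. -/
def twinCountE : ArithExpr :=
  sum 3 hostOrderE (lt (var 1) (var 3) * prod 4 (inp (inp 0 + 3))
    (eq (hostIncE (var 4) (var 3)) (hostIncE (var 4) (var 1))))
/-- The number of twin sets. -/
def twinSetsE : ArithExpr :=
  sum 1 hostOrderE (pos (sum 4 (inp (inp 0 + 3)) (hostIncE (var 4) (var 1))) *
    (prod 2 (inp 0 - 1) (twinCountE - var 2) / prod 2 (inp 0 - 1) (var 2 + 1)))

end ArithExpr

/-- For `k > n` the truncated subtraction produces a zero factor, as required. -/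
theorem Nat.choose_eq_prod_div_prod (n k : ℕ) :
    n.choose k = (∏ i ∈ Finset.range k, (n - i)) / ∏ i ∈ Finset.range k, (i + 1) := by
  rw [← Nat.descFactorial_eq_prod_range, Finset.prod_range_add_one_eq_factorial,
    Nat.choose_eq_descFactorial_div_factorial]

open ArithExpr in
-- The products with `k - 1` factors are affordable because the incidence matrix of the pattern
-- already has `k` entries, so `k` is below the input length.
theorem polyTime_indTrimSubProblem :
    (indTrimSubProblem FinHypergraph.singleEdgeFamily).PolyTime := by
  classical
  have hword : ∀ x : PatternInst FinHypergraph.singleEdgeFamily, ∃ k m n, 0 < k ∧ x.H.n = k ∧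
      x.G.n = n ∧ x.G.m = m ∧ x.word.getD 0 0 = k ∧ x.word.getD (k + 2) 0 = n ∧
      x.word.getD (k + 3) 0 = m ∧ (∀ (e : Fin x.G.m) (v : Fin x.G.n),
        x.word.getD (k + 4 + (e * n + v)) 0 = (x.G.inc e v).toNat) ∧
      x.word.length = k + 4 + m * n := by
    intro x
    obtain ⟨hk, -, hm⟩ := singleEdgeFamily_code x.mem
    have hlen : x.H.word.length = x.H.n + 2 := by
      simp [HypergraphCode.word, matrixWord_length, hm]
    have hget : ∀ i, x.word.getD (x.H.n + 2 + i) 0 = x.G.word.getD i 0 := fun i => by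
      rw [PatternInst.word, List.getD_append_right _ _ _ _ (by omega), hlen,
        Nat.add_sub_cancel_left]
    refine ⟨x.H.n, x.G.m, x.G.n, hk, rfl, rfl, rfl, rfl, hget 0, hget 1, fun e v => ?_, ?_⟩
    · rw [show x.H.n + 4 + ((e : ℕ) * x.G.n + v) = x.H.n + 2 + (((e : ℕ) * x.G.n + v) + 2) by
        omega, hget]
      exact matrixWord_getD (fun i v => (x.G.inc i v).toNat) e v
    · rw [PatternInst.word, List.length_append, hlen]
      simp [HypergraphCode.word, matrixWord_length]
      omega
  have hlen : ∀ x : PatternInst FinHypergraph.singleEdgeFamily, 1 ≤ wordSize x.word := fun x => by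
    obtain ⟨k, m, n, hk, -, -, -, -, -, -, -, h⟩ := hword x
    have := length_le_wordSize x.word
    omega
  refine polyTime_of_eval (P := indTrimSubProblem _) twinSetsE hlen
    (fun (x : PatternInst FinHypergraph.singleEdgeFamily) => ?_)
    (fun (x : PatternInst FinHypergraph.singleEdgeFamily) => ?_)
  · obtain ⟨k, m, n, hk, hHn, hGn, hGm, h0, h1, h2, h3, -⟩ := hword x
    obtain ⟨hk', hH, -⟩ := singleEdgeFamily_code x.mem
    change _ = FinHypergraph.numIndTrimSub x.H.toFinHypergraph x.G.toFinHypergraph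
    rw [hH, FinHypergraph.numIndTrimSub_singleEdge, card_isTwinSet hk']
    change twinSetsE.eval (fun i => x.word.getD i 0) (fun _ => x.word.length) = _
    rw [hHn]
    rcases Nat.eq_zero_or_pos m with hm | hm
    · have : IsEmpty (Fin x.G.m) := by rw [hGm, hm]; infer_instance
      simp [twinSetsE, hostOrderE, h0, h2, hm, -List.getD_eq_getElem?_getD]
    have hord : ∀ ρ, hostOrderE.eval (fun i => x.word.getD i 0) ρ = n := fun ρ => by
      simp [hostOrderE, h0, h1, h2, hm.ne', -List.getD_eq_getElem?_getD]
    have hinc : ∀ (E V : ArithExpr) ρ (e : Fin x.G.m) (v : Fin x.G.n),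
        E.eval (fun i => x.word.getD i 0) ρ = e → V.eval (fun i => x.word.getD i 0) ρ = v →
        (hostIncE E V).eval (fun i => x.word.getD i 0) ρ = (x.G.inc e v).toNat := by
      intro E V ρ e v hE hV
      simp only [hostIncE, eval_inp, eval_add, eval_mul, eval_ofNat, h0, h1, hE, hV, h3]
    have hcount : ∀ (v : Fin x.G.n) (ρ : ℕ → ℕ), ρ 1 = v →
        twinCountE.eval (fun i => x.word.getD i 0) ρ =
          (Finset.univ.filter fun u => v < u ∧ ∀ e, x.G.inc e u = x.G.inc e v).card := by
      intro v ρ hv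
      simp only [twinCountE, eval_sum, hord, eval_mul, eval_lt, eval_prod, eval_inp, eval_add,
        eval_ofNat, h0, h2, eval_var]
      rw [← hGn, Finset.sum_range, Finset.card_filter]
      refine Finset.sum_congr rfl fun u _ => ?_
      have hprod : (∏ i ∈ Finset.range m,
          eval (fun i => x.word.getD i 0) (Function.update (Function.update ρ 3 (u : ℕ)) 4 i)
            ((hostIncE (var 4) (var 3)).eq (hostIncE (var 4) (var 1)))) =
          if ∀ e, x.G.inc e u = x.G.inc e v then 1 else 0 := by
        rw [← hGm, Finset.prod_range]
        trans ∏ e, if x.G.inc e u = x.G.inc e v then 1 else 0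
        · refine Finset.prod_congr rfl fun e _ => ?_
          rw [eval_eq, hinc _ _ _ e u (by simp) (by simp), hinc _ _ _ e v (by simp) (by simp [hv])]
          cases x.G.inc e u <;> cases x.G.inc e v <;> rfl
        · rw [Finset.prod_boole]
          simp
      have h13 : Function.update ρ 3 (u : ℕ) 1 = v := by simp [hv]
      simp only [hprod, Function.update_self, h13]
      by_cases h5 : v < u <;> by_cases h6 : ∀ e, x.G.inc e u = x.G.inc e v <;> simp [h5, h6]
    simp only [twinSetsE, eval_sum, hord, eval_mul, eval_pos, eval_inp, eval_add, eval_ofNat, h0,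
      h2, eval_div, eval_prod, eval_sub, eval_var, Function.update_self]
    rw [← hGn, Finset.sum_range]
    refine Finset.sum_congr rfl fun v _ => ?_
    have hnz : (∑ i ∈ Finset.range m, eval (fun i => x.word.getD i 0)
        (Function.update (Function.update (fun _ => x.word.length) 1 (v : ℕ)) 4 i)
          (hostIncE (var 4) (var 1))) = 0 ↔ ¬ ∃ e, x.G.inc e v = true := by
      rw [← hGm, Finset.sum_range, Finset.sum_eq_zero_iff]
      simp only [Finset.mem_univ, true_imp_iff, not_exists, Bool.not_eq_true]
      refine forall_congr' fun e => ?_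
      rw [hinc _ _ _ e v (by simp) (by simp)]
      cases x.G.inc e v <;> simp
    have hc : ∀ i, eval (fun i => x.word.getD i 0)
        (Function.update (Function.update (fun _ => x.word.length) 1 (v : ℕ)) 2 i) twinCountE = _ :=
      fun i => hcount v _ (by simp)
    simp only [hnz, hc]
    rw [← Nat.choose_eq_prod_div_prod]
    split_ifs with h4 <;> simp
  · obtain ⟨k, m, n, hk, -, -, -, h0, h1, h2, -, h3⟩ := hword x
    change twinSetsE.LimitsLE (wordSize x.word) (fun i => x.word.getD i 0) fun _ => x.word.length
    have hW := length_le_wordSize x.word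
    have hord : ∀ ρ, hostOrderE.eval (fun i => x.word.getD i 0) ρ = if m = 0 then 0 else n :=
      fun ρ => by
        simp only [hostOrderE, eval_mul, eval_pos, eval_inp, eval_add, eval_ofNat, h0, h1, h2]
        split_ifs <;> simp
    have hordl : ∀ ρ, hostOrderE.LimitsLE (wordSize x.word) (fun i => x.word.getD i 0) ρ :=
      fun ρ => by simp [hostOrderE]
    -- The word length controls `n` and `m` only through `m * n`. Without edges, `n` may be
    -- exponential in the input size, but `hostOrderE` is then `0` and no loop over vertices is run.
    -- If `n = 0`, the loops over the `m` edges are never entered.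
    rcases Nat.eq_zero_or_pos m with hm | hm
    · simp [twinSetsE, hord, hordl, hm, -List.getD_eq_getElem?_getD]
    have hnB : n ≤ wordSize x.word := by nlinarith
    rcases Nat.eq_zero_or_pos n with hn | hn
    · simp [twinSetsE, hord, hordl, hn, -List.getD_eq_getElem?_getD]
    have hmB : m ≤ wordSize x.word := by nlinarith
    have hkB : k - 1 ≤ wordSize x.word := by omega
    simp [twinSetsE, twinCountE, hostIncE, hord, hordl, hm.ne', hnB, hmB, hkB, h0, h2,
      -List.getD_eq_getElem?_getD, -tsub_le_iff_right]

/-! ## The lower bounds under the Strong Exponential Time Hypothesis -/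

/-- A formula with bounded clause width has polynomially many clauses. -/
theorem CNF.WidthAtMost.m_le {φ : CNF} {q : ℕ} (h : φ.WidthAtMost q) :
    φ.m ≤ (3 * φ.n) ^ q + 1 := by
  classical
  rcases Nat.eq_zero_or_pos φ.n with hn | hn
  · have : IsEmpty (Fin φ.n) := by rw [hn]; infer_instance
    have h1 := Fintype.card_le_of_injective _ φ.clause_injective
    simp only [Fintype.card_fin, Fintype.card_unique] at h1
    omega
  -- The variables of a clause are listed in `q` slots, unused slots being filled with variable `0`.
  -- A clause is determined by the pairs of variable and literal value in its slots, with `3 * n`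
  -- possibilities each. The `+ 1` in the bound is for `n = 0`, where only the empty clause exists.
  have hex : ∀ i, ∃ e : Fin q → Fin φ.n, ∀ v, φ.clause i v ≠ none → v ∈ Set.range e := by
    intro i
    set S := Finset.univ.filter fun v => φ.clause i v ≠ none
    refine ⟨fun j => if hj : (j : ℕ) < S.card then S.orderEmbOfFin rfl ⟨j, hj⟩ else ⟨0, hn⟩,
      fun v hv => ?_⟩
    have hv' : v ∈ Set.range (S.orderEmbOfFin rfl) := by
      rw [Finset.range_orderEmbOfFin]
      simpa [S] using hv
    obtain ⟨j, rfl⟩ := hv'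
    exact ⟨⟨j, j.2.trans_le (h i)⟩, by simp⟩
  choose e he using hex
  have hinj : Function.Injective fun i j => (e i j, φ.clause i (e i j)) := by
    intro i i' hii
    have h1 : e i = e i' := funext fun j => congrArg Prod.fst (congrFun hii j)
    have h2 : ∀ j, φ.clause i (e i j) = φ.clause i' (e i j) := fun j => by
      have := congrArg Prod.snd (congrFun hii j)
      simpa [h1] using this
    refine φ.clause_injective (funext fun v => ?_)
    by_cases hv : v ∈ Set.range (e i)
    · obtain ⟨j, rfl⟩ := hv
      exact h2 j
    · rw [not_not.1 (mt (he i v) hv), not_not.1 (mt (he i' v) (h1 ▸ hv))]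
  have h1 := Fintype.card_le_of_injective _ hinj
  simp only [Fintype.card_fin, Fintype.card_fun, Fintype.card_prod, Fintype.card_option,
    Fintype.card_bool] at h1
  rw [mul_comm 3]
  exact h1.trans (Nat.le_succ _)

/-- With the variables in blocks of length `l`: the assignment to block `i` whose values are the
binary digits of `a` satisfies clause `c`. -/
def cnfHit (φ : CNF) (l c i a : ℕ) : Prop :=
  ∃ b < l, ∃ (hv : i * l + b < φ.n) (hc : c < φ.m),
    φ.clause ⟨c, hc⟩ ⟨i * l + b, hv⟩ = some (a.testBit b)

/-- Variable `v` is digit `v % l` of block `v / l`, and `n ≤ k * l` says that the blocks cover all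
variables. Satisfying a clause through one literal is a condition on a single block, hence on a
single option. -/
theorem nonempty_hittingChoice_cnfHit {φ : CNF} {k l : ℕ} (hl : φ.n ≤ k * l) :
    Nonempty (HittingChoice k (2 ^ l) φ.m (cnfHit φ l)) ↔ φ.Satisfiable := by
  constructor
  · rintro ⟨a, ha⟩
    have hlt : ∀ v : Fin φ.n, (v : ℕ) / l < k := fun v =>
      Nat.div_lt_of_lt_mul (by rw [mul_comm]; omega)
    refine ⟨fun v => (a ⟨v / l, hlt v⟩ : ℕ).testBit (v % l), fun c => ?_⟩
    obtain ⟨i, b, hb, hv, hc, h⟩ := ha c c.2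
    refine ⟨⟨i * l + b, hv⟩, h.trans ?_⟩
    have h1 : ((i : ℕ) * l + b) / l = i := by
      rw [mul_comm, Nat.mul_add_div (by omega), Nat.div_eq_of_lt hb, add_zero]
    have h2 : ((i : ℕ) * l + b) % l = b := by
      rw [mul_comm, Nat.mul_add_mod, Nat.mod_eq_of_lt hb]
    simp only [h1, h2]
  · rintro ⟨α, hα⟩
    -- Digits beyond the last variable are irrelevant and set to `false`.
    let bits : Fin k → Fin l → Bool := fun i b =>
      if h : (i : ℕ) * l + b < φ.n then α ⟨i * l + b, h⟩ else false
    refine ⟨fun i => ⟨Nat.ofBits (bits i), Nat.ofBits_lt_two_pow _⟩, fun c hc => ?_⟩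
    obtain ⟨v, hv⟩ := hα ⟨c, hc⟩
    have hl0 : 0 < l := by
      rcases Nat.eq_zero_or_pos l with h | h
      · subst h; have := v.2; omega
      · exact h
    have hk : (v : ℕ) / l < k := Nat.div_lt_of_lt_mul (by rw [mul_comm]; omega)
    have hdm : (v : ℕ) / l * l + v % l = v := Nat.div_add_mod' _ _
    refine ⟨⟨v / l, hk⟩, v % l, Nat.mod_lt _ hl0, by rw [hdm]; exact v.2, hc, ?_⟩
    have h1 : (⟨(v : ℕ) / l * l + v % l, by rw [hdm]; exact v.2⟩ : Fin φ.n) = v := Fin.ext hdm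
    simp only [h1, hv]
    rw [Nat.testBit_ofBits_lt _ _ (Nat.mod_lt _ hl0)]
    simp [bits, hdm]

/-! ### The reduction from satisfiability as arithmetic expressions. -/

namespace ArithExpr

variable (k : ℕ)

/-- The block length. -/
def cnfBlockE : ArithExpr := inp 0 / const k + 1
/-- The number of assignments to a block. -/
def cnfOptionsE : ArithExpr := prod 1 (cnfBlockE k) 2
/-- The literal of variable `var 1` of block `I` in clause `C`. -/
def cnfLiteralE (C I : ArithExpr) : ArithExpr :=
  inp (2 + (C * inp 0 + (I * cnfBlockE k + var 1)))
/-- The binary digit `var 1` of `A`. -/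
def cnfDigitE (A : ArithExpr) : ArithExpr := mod (A / prod 2 (var 1) 2) 2
/-- The constraint `cnfHit` as an expression. -/
def cnfHitE (C I A : ArithExpr) : ArithExpr :=
  pos (sum 1 (cnfBlockE k) (lt (I * cnfBlockE k + var 1) (inp 0) *
    (eq (cnfLiteralE k C I) 1 * eq (cnfDigitE A) 1 +
      eq (cnfLiteralE k C I) 2 * eq (cnfDigitE A) 0)))
/-- Whether there is a satisfying assignment, when the variable `0` is the number of
homomorphisms. -/
def cnfFinalE : ArithExpr :=
  pos (prod 1 (const k) (const k * cnfOptionsE k + inp 1 + 1) - var 0)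
/-- The length of the constructed word, as an expression. -/
def cnfLengthE : ArithExpr := hittingLengthE (const k) (cnfOptionsE k) (inp 1)
/-- The entries of the constructed word, as an expression. -/
def cnfEntryE : ArithExpr := hittingEntryE (const k) (cnfOptionsE k) (inp 1) (cnfHitE k)
/-- The program that decides satisfiability with the help of a program for trimmed
homomorphisms. -/
def cnfProg (p : Prog) : Prog :=
  callProg (cnfLengthE k) (cnfEntryE k) (cnfFinalE k) (.call p 2 1 1)

/-- A bound on the time of `cnfProg` per entry of the constructed word, without the call. -/
def cnfCost (B : ℕ) : ℕ :=
  (cnfLengthE k).time B + (cnfEntryE k).time B + (cnfEntryE k).bits B + (cnfFinalE k).time B +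
    (cnfFinalE k).bits B + 8 * B + 20

theorem polyBounded_cnfCost : PolyBounded (cnfCost k) := by
  have h := PolyBounded.id
  exact ((((((cnfLengthE k).polyBounded_time.add (cnfEntryE k).polyBounded_time).add
    (cnfEntryE k).polyBounded_bits).add (cnfFinalE k).polyBounded_time).add
    (cnfFinalE k).polyBounded_bits).add ((PolyBounded.const 8).mul h)).add (.const 20)

end ArithExpr

/-- A bound on the bit lengths and loops in `cnfProg`, for `n` variables and `m` clauses. -/
def cnfBound (k n m : ℕ) : ℕ := m * n + n + (k + m) + (k + 1) * (k + n + m + 6) + 10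

theorem CNF.literalCode_eq_one {o : Option Bool} : CNF.literalCode o = 1 ↔ o = some true := by
  rcases o with _ | _ | _ <;> simp [CNF.literalCode]

theorem CNF.literalCode_eq_two {o : Option Bool} : CNF.literalCode o = 2 ↔ o = some false := by
  rcases o with _ | _ | _ <;> simp [CNF.literalCode]

theorem CNF.literalCode_le_two {o : Option Bool} : CNF.literalCode o ≤ 2 := by
  rcases o with _ | _ | _ <;> simp [CNF.literalCode]

open ArithExpr Classical in
-- The constructed word has about `(m + k) * N` entries, each computed in time polynomial in `n` and
-- `m` for fixed `k`. Only the number of entries is exponential, and it is linear in `N`.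
theorem exec_cnfProg {k : ℕ} (hk : 0 < k) {p : Prog} (φ : CNF) {N T : ℕ}
    (hN : N = k * 2 ^ (φ.n / k + 1) + φ.m + 1)
    (hp : ∃ τ t, Exec noOracle p (.init (hittingInst k (2 ^ (φ.n / k + 1)) φ.m
      (cnfHit φ (φ.n / k + 1)) hk (by positivity)).word) τ t ∧
      τ.reg 0 = FinHypergraph.numTrimHom (.singleEdge k hk) (hittingCode k (2 ^ (φ.n / k + 1)) φ.m
        (cnfHit φ (φ.n / k + 1)) (by positivity)).toFinHypergraph ∧ t ≤ T) :
    ∃ τ t, Exec noOracle (cnfProg k p) (.init φ.word) τ t ∧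
      τ.reg 0 = (if φ.Satisfiable then 1 else 0) ∧
      t ≤ (φ.m + 2 * k + 4) * N * cnfCost k (cnfBound k φ.n φ.m) + T := by
  set n := φ.n with hn
  set m := φ.m with hm
  set l := n / k + 1 with hl
  have hs : 0 < 2 ^ l := by positivity
  obtain ⟨ζ, tp, hp1, hp2, hp3⟩ := hp
  set r := FinHypergraph.numTrimHom (.singleEdge k hk)
    (hittingCode k (2 ^ l) m (cnfHit φ l) hs).toFinHypergraph with hr
  set w := φ.word with hw
  have hw0 : w.getD 0 0 = n := rfl
  have hw1 : w.getD 1 0 = m := rfl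
  have hlit : ∀ c v (hc : c < m) (hv : v < n),
      w.getD (2 + (c * n + v)) 0 = CNF.literalCode (φ.clause ⟨c, hc⟩ ⟨v, hv⟩) := by
    intro c v hc hv
    rw [add_comm]
    exact matrixWord_getD (fun i v => CNF.literalCode (φ.clause i v)) ⟨c, hc⟩ ⟨v, hv⟩
  have hlen : w.length = m * n + 2 := by
    change (matrixWord _).length + 1 + 1 = _
    rw [matrixWord_length]
  have hln : l ≤ n + 1 := Nat.succ_le_succ (Nat.div_le_self n k)
  have hcount := numTrimHom_hittingCode hk hs m (cnfHit φ l)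
  rw [← hr, ← hN] at hcount
  set L := hittingLength k (2 ^ l) m with hL
  have hLN : L = k + 4 + (m + k) * N := by rw [hN]; rfl
  -- `N` is exponential in `n / k`, but its bit length is linear, which keeps the bound `B`
  -- polynomial.
  have hNs : N.size ≤ k + n + m + 6 := by
    have h1 := Nat.size_add_le (k * 2 ^ l + m) 1
    have h2 := Nat.size_add_le (k * 2 ^ l) m
    have h3 := Nat.size_mul_le k (2 ^ l)
    have h4 := Nat.size_le_self k
    have h5 := Nat.size_le_self m
    have h6 : (2 ^ l).size = l + 1 := Nat.size_pow
    have h7 : Nat.size 1 = 1 := by simp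
    rw [hN]
    omega
  have hkNs : k * N.size ≤ k * (k + n + m + 6) := Nat.mul_le_mul_left _ hNs
  set B := cnfBound k n m with hB
  have hB' : B = m * n + n + (k + m) + (k * (k + n + m + 6) + (k + n + m + 6)) + 10 := by
    rw [hB, cnfBound]; ring
  have hrs : r.size ≤ k * (k + n + m + 6) + 1 :=
    (Nat.size_le_size (show r ≤ N ^ k by omega)).trans ((Nat.size_pow_le N k).trans (by omega))
  have hLs : L.size ≤ B := by
    have h1 := Nat.size_add_le (k + 4) ((m + k) * N)
    have h2 := Nat.size_mul_le (m + k) N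
    have h3 := Nat.size_le_self (k + 4)
    have h4 := Nat.size_le_self (m + k)
    have h5 : k ≤ k * (k + n + m + 6) := Nat.le_mul_of_pos_right _ (by omega)
    rw [hLN]
    omega
  have hblock : ∀ ρ, (cnfBlockE k).eval (fun i => w.getD i 0) ρ = l := fun ρ => by
    simp only [cnfBlockE, eval_add, eval_div, eval_inp, eval_const, eval_ofNat, hw0, hl]
  have hopt : ∀ ρ, (cnfOptionsE k).eval (fun i => w.getD i 0) ρ = 2 ^ l := fun ρ => by
    simp only [cnfOptionsE, eval_prod, hblock, eval_ofNat, Finset.prod_const, Finset.card_range]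
  have hlB : l ≤ B := by omega
  have hblockl : ∀ ρ, (cnfBlockE k).LimitsLE B (fun i => w.getD i 0) ρ := fun ρ => by
    simp [cnfBlockE]
  have hoptl : ∀ ρ, (cnfOptionsE k).LimitsLE B (fun i => w.getD i 0) ρ := fun ρ => by
    simp only [cnfOptionsE, limitsLE_prod, hblock, hblockl, limitsLE_ofNat, hlB, implies_true,
      and_self]
  have hfin : (cnfFinalE k).eval (fun i => w.getD i 0) (fun _ => r) =
      if φ.Satisfiable then 1 else 0 := by
    simp only [cnfFinalE, eval_pos, eval_sub, eval_prod, eval_const, eval_add, eval_mul, hopt,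
      eval_inp, eval_ofNat, hw1, eval_var, Finset.prod_const, Finset.card_range]
    rw [← hN, ← hcount, Nat.add_sub_cancel_left]
    have hsat := nonempty_hittingChoice_cnfHit (φ := φ) (k := k) (l := l)
      (Nat.lt_mul_div_succ n hk).le
    by_cases h : φ.Satisfiable
    · have := hsat.2 h
      rw [if_pos h, if_neg (Nat.mul_pos (Nat.factorial_pos k) Nat.card_pos).ne']
    · have : IsEmpty (HittingChoice k (2 ^ l) m (cnfHit φ l)) :=
        not_nonempty_iff.1 (mt hsat.1 h)
      rw [if_neg h, Nat.card_of_isEmpty, mul_zero, if_pos rfl]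
  obtain ⟨τ, t, e1, e2, e3⟩ := exec_callProg_hitting (w := w) (k := k) (s := 2 ^ l) (m := m)
    (O := noOracle) (r := r) (B := B) (B' := B) (h := cnfHit φ l) (finE := cnfFinalE k)
    (K := const k) (S := cnfOptionsE k) (R := inp 1) (hit := cnfHitE k) (q := .call p 2 1 1)
    (tq := 1 + L.size + wordSize (hittingInst k (2 ^ l) m (cnfHit φ l) hk hs).word + tp + r.size)
    hk hs (fun a ha => by
      have hle : ∀ a ∈ w, a.size ≤ n + m + 2 := by
        intro a ha
        rcases List.mem_cons.1 ha with rfl | ha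
        · exact (Nat.size_le_self _).trans (by omega)
        rcases List.mem_cons.1 ha with rfl | ha
        · exact (Nat.size_le_self _).trans (by omega)
        obtain ⟨i, rfl⟩ := List.mem_ofFn' _ _ |>.1 ha
        exact (Nat.size_le_self _).trans (CNF.literalCode_le_two.trans (by omega))
      exact (hle a ha).trans (by omega))
    ((Nat.size_le_self _).trans (by omega)) hLs
    (fun t ρ _ => rfl) (fun t ρ _ => hopt ρ) (fun t ρ _ => hw1)
    (by
      intro t C I A c i a hC hI hA hc hi ha ρ hρ
      have hup : ∀ b, Function.update ρ 1 b 0 = t := fun b => by simp [hρ]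
      have hdig : ∀ b, (cnfDigitE A).eval (fun i => w.getD i 0) (Function.update ρ 1 b) =
          a / 2 ^ b % 2 := fun b => by
        simp only [cnfDigitE, eval_mod, eval_div, eval_prod, eval_var, eval_ofNat, hA _ (hup b),
          Function.update_self, Finset.prod_const, Finset.card_range]
      have hcl : ∀ b, (cnfLiteralE k C I).eval (fun i => w.getD i 0) (Function.update ρ 1 b) =
          w.getD (2 + (c * n + (i * l + b))) 0 := fun b => by
        simp only [cnfLiteralE, eval_inp, eval_add, eval_mul, eval_var, eval_ofNat, hC _ (hup b),
          hI _ (hup b), hblock, hw0, Function.update_self]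
      simp only [cnfHitE, eval_pos, eval_sum, hblock, eval_mul, eval_lt, eval_add, eval_eq, hdig,
        hcl, hI _ (hup _), eval_var, eval_inp, eval_ofNat, hw0, Function.update_self]
      rw [← ite_not]
      refine if_congr ?_ rfl rfl
      rw [Finset.sum_eq_zero_iff]
      push Not
      simp only [Finset.mem_range, cnfHit, mul_ne_zero_iff]
      refine exists_congr fun b => and_congr_right fun hb => ?_
      by_cases hv : i * l + b < n
      · simp only [hlit c _ hc hv, CNF.literalCode_eq_one, CNF.literalCode_eq_two]
        have hex : (∃ (hv : i * l + b < φ.n) (hc : c < φ.m),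
            φ.clause ⟨c, hc⟩ ⟨i * l + b, hv⟩ = some (a.testBit b)) ↔
            φ.clause ⟨c, hc⟩ ⟨i * l + b, hv⟩ = some (a.testBit b) :=
          ⟨fun ⟨_, _, h⟩ => h, fun h => ⟨hv, hc, h⟩⟩
        rw [hex, Nat.testBit_eq_decide_div_mod_eq]
        generalize φ.clause _ _ = o
        rcases Nat.mod_two_eq_zero_or_one (a / 2 ^ b) with h | h <;>
          rcases o with _ | _ | _ <;> simp [h, hv]
      · have hex : ¬ ∃ (hv : i * l + b < φ.n) (hc : c < φ.m),
            φ.clause ⟨c, hc⟩ ⟨i * l + b, hv⟩ = some (a.testBit b) := fun ⟨h, _⟩ => hv h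
        simp [hv, hex])
    (fun t ρ _ => trivial) (fun t ρ _ => hoptl ρ) (fun t ρ _ => by simp)
    (fun t C I A hC hI hA ρ hρ => by
      have hup : ∀ b, Function.update ρ 1 b 0 = t := fun b => by simp [hρ]
      simp only [cnfHitE, limitsLE_pos, limitsLE_sum, limitsLE_mul, limitsLE_lt, limitsLE_add,
        limitsLE_eq, cnfLiteralE, cnfDigitE, limitsLE_inp, limitsLE_mod, limitsLE_div,
        limitsLE_prod, hblock, hblockl, hC _ (hup _), hI _ (hup _), hA _ (hup _), limitsLE_var,
        limitsLE_ofNat, eval_var, Function.update_self, and_self, true_and, implies_true, and_true,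
        hlB]
      intro i hi
      omega)
    le_rfl (by omega)
    (by simp only [cnfFinalE, limitsLE_pos, limitsLE_sub, limitsLE_prod, limitsLE_add, limitsLE_mul,
          limitsLE_const, limitsLE_inp, limitsLE_ofNat, limitsLE_var, hoptl, eval_const]
        simp only [implies_true, and_true, true_and]
        omega)
    (fun σ h1 h2 => by
      have h3 := Exec.call (O := noOracle) (p := p) (r := 2) (a := 1) (l := 1) (σ := σ) (τ := ζ)
        (t := tp) (by rw [h2]; exact hp1)
      rw [h2, h1, hp2] at h3
      exact h3)
  refine ⟨τ, t, e1, e2.trans hfin, ?_⟩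
  have hqw : wordSize (hittingInst k (2 ^ l) m (cnfHit φ l) hk hs).word ≤ L * (B + 1) := by
    refine (wordSize_le (B := B) fun a ha => ?_).trans ?_
    · rw [word_hittingInst] at ha
      obtain ⟨t, -, rfl⟩ := List.mem_map.1 ha
      have := Nat.size_le_size (hittingEntry_le k (2 ^ l) m (cnfHit φ l) hk hs t)
      rw [← hN] at this
      omega
    · rw [word_hittingInst, List.length_map, List.length_range]
  have hL1 : 1 ≤ L := by omega
  have hLX : L ≤ (m + 2 * k + 4) * N := by
    have : k + 4 ≤ (k + 4) * N := Nat.le_mul_of_pos_right _ (by omega)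
    rw [hLN, show (m + 2 * k + 4) * N = (k + 4) * N + (m + k) * N by ring]
    omega
  have e3' : t ≤ (cnfLengthE k).time B + B + 10 +
      L * ((cnfEntryE k).time B + (cnfEntryE k).bits B + 4 * B + 8) +
      (1 + L.size + wordSize (hittingInst k (2 ^ l) m (cnfHit φ l) hk hs).word + tp + r.size) +
      (cnfFinalE k).time B + (cnfFinalE k).bits B := e3
  have h5 : t ≤ L * cnfCost k B + T := by
    have h6 : ∀ x, x ≤ L * x := fun x => Nat.le_mul_of_pos_left _ hL1
    have h7 := h6 ((cnfLengthE k).time B + (cnfFinalE k).time B + (cnfFinalE k).bits B +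
      3 * B + 11)
    have h8 : L * cnfCost k B = L * ((cnfLengthE k).time B + (cnfFinalE k).time B +
        (cnfFinalE k).bits B + 3 * B + 11) +
        L * ((cnfEntryE k).time B + (cnfEntryE k).bits B + 4 * B + 8) + L * (B + 1) := by
      unfold cnfCost; ring
    omega
  exact h5.trans (Nat.add_le_add_right (Nat.mul_le_mul_right _ hLX) _)

/-- This lets polynomial factors of the reduction be absorbed by an arbitrarily small part of the
exponential saving. -/
theorem exists_pow_le_two_rpow (D : ℕ) {δ : ℝ} (hδ : 0 < δ) :
    ∃ C : ℝ, 0 ≤ C ∧ ∀ n : ℕ, ((n : ℝ) + 1) ^ D ≤ C * 2 ^ (δ * (n : ℝ)) := by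
  have hr : 1 < (2 : ℝ) ^ δ := Real.one_lt_rpow (by norm_num) hδ
  have h := (isLittleO_pow_const_const_pow_of_one_lt (R := ℝ) D hr).isBigO
  rw [Asymptotics.isBigO_nat_atTop_iff fun n hn => absurd hn (by positivity)] at h
  obtain ⟨C, hC⟩ := h
  refine ⟨|C| * 2 ^ δ, by positivity, fun n => ?_⟩
  have h1 := hC (n + 1)
  rw [Real.norm_of_nonneg (by positivity), Real.norm_of_nonneg (by positivity)] at h1
  push_cast at h1
  calc ((n : ℝ) + 1) ^ D ≤ C * (2 ^ δ) ^ (n + 1) := h1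
    _ ≤ |C| * (2 ^ δ) ^ (n + 1) := by gcongr; exact le_abs_self C
    _ = |C| * 2 ^ δ * 2 ^ (δ * (n : ℝ)) := by
        rw [Real.rpow_mul (by norm_num), Real.rpow_natCast, pow_succ]; ring

/-- A program for trimmed homomorphisms gives a program for satisfiability. -/
theorem exists_cnfProg_time {k : ℕ} (hk : 0 < k) (q : ℕ) : ∃ C D : ℕ, 1 ≤ C ∧
    ∀ (p : Prog) (c ε : ℝ), 0 ≤ c → 0 < ε → ε ≤ 1 → 2 ≤ k →
      (∀ x : PatternInst FinHypergraph.singleEdgeFamily,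
        x.H.n = k → 1 ≤ x.G.n → x.G.m ≤ x.G.n → p.Computes noOracle x.word
          (FinHypergraph.numTrimHom x.H.toFinHypergraph x.G.toFinHypergraph)
          (c * (x.G.n : ℝ) ^ ((k : ℝ) - ε))) →
      ∀ φ : CNF, φ.WidthAtMost q → ∃ τ t, Exec noOracle (ArithExpr.cnfProg k p) (.init φ.word) τ t ∧
        (open Classical in τ.reg 0 = if φ.Satisfiable then 1 else 0) ∧
        (t : ℝ) ≤ ((2 : ℝ) ^ ((φ.n : ℝ) / k)) ^ ((k : ℝ) - ε) *
          ((1 + c) * ((C : ℝ) * ((φ.n : ℝ) + 1) ^ D) ^ k) := by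
  classical
  have h := PolyBounded.id
  have hm : PolyBounded fun n => (3 * n) ^ q + 1 :=
    (((PolyBounded.const 3).mul h).pow q).add (.const 1)
  have hP : PolyBounded fun n => 2 * k + ((3 * n) ^ q + 1) + 1 :=
    ((PolyBounded.const (2 * k)).add hm).add (.const 1)
  obtain ⟨Cc, Dc, hc⟩ := ArithExpr.polyBounded_cnfCost k
  have hB : PolyBounded fun n => cnfBound k n ((3 * n) ^ q + 1) :=
    ((((hm.mul h).add h).add ((PolyBounded.const k).add hm)).add
      ((PolyBounded.const (k + 1)).mul ((((PolyBounded.const k).add h).add hm).add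
        (.const 6)))).add (.const 10)
  -- One polynomial dominates both the cost of the construction relative to `2 ^ (n / k)` and the
  -- factor `P` in the order of the host; the summand `1` ensures `C ≥ 1`.
  obtain ⟨C, D, hCD⟩ := (((((hm.add (.const (2 * k))).add (.const 4)).mul hP).mul
    ((PolyBounded.const Cc).mul ((hB.add (.const 1)).pow Dc))).add hP).add (.const 1)
  simp only at hCD
  have hC1 : 1 ≤ C := by
    simpa using (Nat.le_add_left 1 _).trans (hCD 0)
  refine ⟨C, D, hC1, fun p c ε hc0 hε hε1 hk2 hp φ hφ => ?_⟩
  set n := φ.n with hn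
  have hmn : φ.m ≤ (3 * n) ^ q + 1 := hφ.m_le
  have hs : 0 < 2 ^ (n / k + 1) := by positivity
  set N := k * 2 ^ (n / k + 1) + φ.m + 1 with hN
  have hkN : k ≤ k * 2 ^ (n / k + 1) := Nat.le_mul_of_pos_right _ hs
  -- The host has `m + k` edges and at least `k + m + 1` vertices, so it belongs to the hosts with
  -- `|E| ≤ |V|`.
  obtain ⟨τ, t, e1, e2, e3⟩ := hp (hittingInst k (2 ^ (n / k + 1)) φ.m
    (cnfHit φ (n / k + 1)) hk hs) rfl (by change 1 ≤ k * 2 ^ (n / k + 1) + φ.m + 1; omega)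
    (by change φ.m + k ≤ k * 2 ^ (n / k + 1) + φ.m + 1; omega)
  change (t : ℝ) ≤ c * (N : ℝ) ^ ((k : ℝ) - ε) at e3
  change τ.reg 0 = FinHypergraph.numTrimHom (singleEdgeCode k hk).toFinHypergraph _ at e2
  rw [toFinHypergraph_singleEdgeCode] at e2
  obtain ⟨ζ, u, f1, f2, f3⟩ := exec_cnfProg hk φ (T := t) hN ⟨τ, t, e1, e2, le_rfl⟩
  refine ⟨ζ, u, f1, f2, ?_⟩
  set Q := C * (n + 1) ^ D with hQ
  have hQ1 : 1 ≤ Q := Nat.one_le_iff_ne_zero.2 (by positivity)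
  set X : ℝ := (2 : ℝ) ^ ((n : ℝ) / k) with hX
  have hX1 : 1 ≤ X := Real.one_le_rpow (by norm_num) (by positivity)
  have h2X : ((2 ^ (n / k) : ℕ) : ℝ) ≤ X := by
    rw [Nat.cast_pow, Nat.cast_ofNat, ← Real.rpow_natCast]
    exact Real.rpow_le_rpow_of_exponent_le (by norm_num) Nat.cast_div_le
  set P := 2 * k + ((3 * n) ^ q + 1) + 1 with hPdef
  -- The additional variable per block doubles the number of options, whence `2 * k` in `P`.
  have hNP : N ≤ 2 ^ (n / k) * P := by
    have h1 : φ.m + 1 ≤ 2 ^ (n / k) * (φ.m + 1) := Nat.le_mul_of_pos_left _ (by positivity)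
    calc N = 2 ^ (n / k) * (2 * k) + (φ.m + 1) := by rw [hN, pow_succ]; ring
      _ ≤ 2 ^ (n / k) * (2 * k) + 2 ^ (n / k) * (φ.m + 1) := by omega
      _ = 2 ^ (n / k) * (2 * k + φ.m + 1) := by ring
      _ ≤ 2 ^ (n / k) * P := Nat.mul_le_mul_left _ (by omega)
  have hCDn : ((3 * n) ^ q + 1 + 2 * k + 4) * P *
      (Cc * (cnfBound k n ((3 * n) ^ q + 1) + 1) ^ Dc) + P + 1 ≤ Q := hCD n
  have hPQ : P ≤ Q := by omega
  have hcost : (φ.m + 2 * k + 4) * N * ArithExpr.cnfCost k (cnfBound k n φ.m) ≤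
      2 ^ (n / k) * Q := by
    have h1 : cnfBound k n φ.m ≤ cnfBound k n ((3 * n) ^ q + 1) := by
      unfold cnfBound; gcongr
    have h2 : ArithExpr.cnfCost k (cnfBound k n φ.m) ≤
        Cc * (cnfBound k n ((3 * n) ^ q + 1) + 1) ^ Dc := (hc _).trans (by gcongr)
    calc _ ≤ ((3 * n) ^ q + 1 + 2 * k + 4) * (2 ^ (n / k) * P) *
          (Cc * (cnfBound k n ((3 * n) ^ q + 1) + 1) ^ Dc) := by gcongr
      _ = 2 ^ (n / k) * (((3 * n) ^ q + 1 + 2 * k + 4) * P *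
          (Cc * (cnfBound k n ((3 * n) ^ q + 1) + 1) ^ Dc)) := by ring
      _ ≤ 2 ^ (n / k) * Q := Nat.mul_le_mul_left _ (by omega)
  have hk2' : (2 : ℝ) ≤ k := by exact_mod_cast hk2
  have hQ1' : (1 : ℝ) ≤ Q := by exact_mod_cast hQ1
  -- Here `k ≥ 2` and `ε ≤ 1` are needed: with `k - ε ≥ 1`, writing down the host costs no more than
  -- the bound allowed for counting in it.
  have hXe : X ≤ X ^ ((k : ℝ) - ε) := by
    conv_lhs => rw [← Real.rpow_one X]
    exact Real.rpow_le_rpow_of_exponent_le hX1 (by linarith)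
  have hQk : (Q : ℝ) ≤ (Q : ℝ) ^ k := le_self_pow₀ hQ1' hk.ne'
  have hcost' : ((2 ^ (n / k) * Q : ℕ) : ℝ) ≤ X ^ ((k : ℝ) - ε) * (Q : ℝ) ^ k := by
    rw [Nat.cast_mul]
    exact mul_le_mul (h2X.trans hXe) hQk (by positivity) (by positivity)
  have hNe : (N : ℝ) ^ ((k : ℝ) - ε) ≤ X ^ ((k : ℝ) - ε) * (Q : ℝ) ^ k := by
    have h1 : (N : ℝ) ≤ X * Q := by
      calc (N : ℝ) ≤ ((2 ^ (n / k) * P : ℕ) : ℝ) := by exact_mod_cast hNP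
        _ = ((2 ^ (n / k) : ℕ) : ℝ) * (P : ℝ) := Nat.cast_mul _ _
        _ ≤ X * Q := mul_le_mul h2X (by exact_mod_cast hPQ) (by positivity) (by positivity)
    calc (N : ℝ) ^ ((k : ℝ) - ε) ≤ (X * Q) ^ ((k : ℝ) - ε) :=
          Real.rpow_le_rpow (by positivity) h1 (by linarith)
      _ = X ^ ((k : ℝ) - ε) * (Q : ℝ) ^ ((k : ℝ) - ε) :=
          Real.mul_rpow (by positivity) (by positivity)
      _ ≤ X ^ ((k : ℝ) - ε) * (Q : ℝ) ^ k := by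
          refine mul_le_mul_of_nonneg_left ?_ (by positivity)
          rw [← Real.rpow_natCast]
          exact Real.rpow_le_rpow_of_exponent_le hQ1' (by linarith)
  have hQcast : (C : ℝ) * ((n : ℝ) + 1) ^ D = Q := by rw [hQ]; push_cast; ring
  rw [hQcast]
  calc (u : ℝ) ≤ ((2 ^ (n / k) * Q + t : ℕ) : ℝ) := by
        exact_mod_cast f3.trans (Nat.add_le_add_right hcost _)
    _ = ((2 ^ (n / k) * Q : ℕ) : ℝ) + t := Nat.cast_add _ _
    _ ≤ X ^ ((k : ℝ) - ε) * (Q : ℝ) ^ k + c * (X ^ ((k : ℝ) - ε) * (Q : ℝ) ^ k) :=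
        add_le_add hcost' (e3.trans (mul_le_mul_of_nonneg_left hNe hc0))
    _ = X ^ ((k : ℝ) - ε) * ((1 + c) * (Q : ℝ) ^ k) := by ring

/-- The assumed algorithm yields time `2 ^ (n - ε n / k)` times a polynomial for satisfiability at
every clause width, so no width `q` can be as SETH demands. The argument already works for `k = 2`.
-/
theorem SETH.not_computes_fixed (hS : SETH) {k : ℕ} (hk : 2 ≤ k) :
    ¬ ∃ (p : Prog) (c ε : ℝ), 0 < ε ∧
      ∀ x : PatternInst FinHypergraph.singleEdgeFamily,
        x.H.n = k → 1 ≤ x.G.n → x.G.m ≤ x.G.n →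
        p.Computes noOracle x.word
          (FinHypergraph.numTrimHom x.H.toFinHypergraph x.G.toFinHypergraph)
          (c * (x.G.n : ℝ) ^ ((k : ℝ) - ε)) := by
  rintro ⟨p, c, ε, hε, hp⟩
  have hk0 : (0 : ℝ) < k := by positivity
  -- It is harmless to assume `c ≥ 0` and `ε ≤ 1`, since hosts have at least one vertex and the time
  -- bound only grows.
  set c' := max c 0
  set ε' := min ε 1
  have hε' : 0 < ε' := lt_min hε one_pos
  have hp' : ∀ x : PatternInst FinHypergraph.singleEdgeFamily,
      x.H.n = k → 1 ≤ x.G.n → x.G.m ≤ x.G.n → p.Computes noOracle x.word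
        (FinHypergraph.numTrimHom x.H.toFinHypergraph x.G.toFinHypergraph)
        (c' * (x.G.n : ℝ) ^ ((k : ℝ) - ε')) := by
    intro x h1 h2 h3
    obtain ⟨τ, t, e1, e2, e3⟩ := hp x h1 h2 h3
    refine ⟨τ, t, e1, e2, e3.trans ?_⟩
    have h4 : (1 : ℝ) ≤ x.G.n := by exact_mod_cast h2
    have h5 : (x.G.n : ℝ) ^ ((k : ℝ) - ε) ≤ (x.G.n : ℝ) ^ ((k : ℝ) - ε') :=
      Real.rpow_le_rpow_of_exponent_le h4 (by have := min_le_left ε 1; linarith)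
    exact mul_le_mul (le_max_left _ _) h5 (by positivity) (le_max_right _ _)
  -- Half of the saving `ε' / k` pays for the polynomial factor; the other half is the `δ` that
  -- contradicts SETH.
  set δ := ε' / (2 * k) with hδ
  have hδ0 : 0 < δ := by positivity
  obtain ⟨q, -, hno⟩ := hS δ hδ0
  obtain ⟨C, D, -, hCD⟩ := exists_cnfProg_time (by omega : 0 < k) q
  obtain ⟨E, hE0, hE⟩ := exists_pow_le_two_rpow (D * k) hδ0
  refine hno ⟨ArithExpr.cnfProg k p, (1 + c') * (C : ℝ) ^ k * E, fun φ hφ => ?_⟩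
  obtain ⟨τ, t, e1, e2, e3⟩ := hCD p c' ε' (le_max_right _ _) hε' (min_le_right _ _) hk hp' φ hφ
  refine ⟨τ, t, e1, by convert e2, e3.trans ?_⟩
  have hc' : 0 ≤ c' := le_max_right _ _
  calc ((2 : ℝ) ^ ((φ.n : ℝ) / k)) ^ ((k : ℝ) - ε') *
        ((1 + c') * ((C : ℝ) * ((φ.n : ℝ) + 1) ^ D) ^ k)
      = (1 + c') * (C : ℝ) ^ k * (2 ^ ((φ.n : ℝ) / k * ((k : ℝ) - ε')) *
          ((φ.n : ℝ) + 1) ^ (D * k)) := by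
        rw [← Real.rpow_mul (by norm_num), mul_pow, ← pow_mul]; ring
    _ ≤ (1 + c') * (C : ℝ) ^ k * (2 ^ ((φ.n : ℝ) / k * ((k : ℝ) - ε')) *
          (E * 2 ^ (δ * (φ.n : ℝ)))) := by
        gcongr
        exact hE φ.n
    _ = (1 + c') * (C : ℝ) ^ k * E * (2 ^ ((φ.n : ℝ) / k * ((k : ℝ) - ε')) *
          2 ^ (δ * (φ.n : ℝ))) := by ring
    _ = (1 + c') * (C : ℝ) ^ k * E * 2 ^ ((1 - δ) * (φ.n : ℝ)) := by
        rw [← Real.rpow_add (by norm_num)]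
        congr 2
        rw [hδ]
        field_simp
        ring

/-- A uniform algorithm restricts to `k = 3`, where `f 3` becomes part of the constant. -/
theorem SETH.not_computes (hS : SETH) : ¬ ∃ (p : Prog) (f : ℕ → ℕ) (c ε : ℝ), Computable f ∧ 0 < ε ∧
    ∀ x : PatternInst FinHypergraph.singleEdgeFamily, 1 ≤ x.G.n →
      p.Computes noOracle x.word
        (FinHypergraph.numTrimHom x.H.toFinHypergraph x.G.toFinHypergraph)
        (f x.H.n * (c * (x.G.n : ℝ) ^ ((x.H.n : ℝ) - ε))) := by
  rintro ⟨p, f, c, ε, -, hε, hp⟩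
  refine hS.not_computes_fixed (k := 3) (by norm_num) ⟨p, f 3 * c, ε, hε, fun x h1 h2 _ => ?_⟩
  have h := hp x h2
  rw [h1, ← mul_assoc] at h
  exact h

/-! ## The trimmed-homomorphism expansion -/

namespace FinHypergraph

instance (H : FinHypergraph) : Finite H.V := H.finite

/-- Maps that are surjective on vertices and send edges to edges. -/
def IsSurjHom (F K : FinHypergraph) (φ : F.V → K.V) : Prop :=
  Function.Surjective φ ∧ ∀ e, F.IsEdge e → K.IsEdge (φ '' e)

/-- The number of these maps. -/
noncomputable def numSurjHom (F K : FinHypergraph) : ℕ := Nat.card {φ : F.V → K.V // IsSurjHom F K φ}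

theorem numSurjHom_congr_right (F : FinHypergraph) {K K' : FinHypergraph} (h : K.Iso K') :
    numSurjHom F K = numSurjHom F K' := by
  obtain ⟨σ, hσ⟩ := h
  refine Nat.card_congr (Equiv.subtypeEquiv (Equiv.arrowCongr (Equiv.refl _) σ) fun φ => ?_)
  change IsSurjHom F K φ ↔ IsSurjHom F K' (σ ∘ φ)
  unfold IsSurjHom
  rw [σ.comp_surjective]
  simp only [Set.image_comp, ← hσ]

theorem numSurjHom_self_pos (K : FinHypergraph) : 0 < numSurjHom K K := by
  have : Nonempty {φ : K.V → K.V // IsSurjHom K K φ} :=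
    ⟨id, Function.surjective_id, fun e he => by rwa [Set.image_id]⟩
  exact Nat.card_pos

theorem not_isEdge_empty (H : FinHypergraph) : ¬ H.IsEdge ∅ := by
  rw [IsEdge, Set.image_empty]
  exact H.empty_notMem

/-- The empty set is not an edge. As a consequence, a hypergraph with `n` vertices has `rank`
strictly above `2 ^ n` and at most `2 ^ (n + 1)`, so the number of vertices takes precedence in the
order. -/
theorem ncard_isEdge_lt (H : FinHypergraph) : {S | H.IsEdge S}.ncard < 2 ^ Nat.card H.V := by
  have h1 : {S | H.IsEdge S} ⊂ Set.univ :=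
    Set.ssubset_univ_iff.2 fun h =>
      H.not_isEdge_empty (h.symm ▸ Set.mem_univ (∅ : Set H.V) : ∅ ∈ {S | H.IsEdge S})
  have h2 := Set.ncard_lt_ncard h1
  have := Fintype.ofFinite H.V
  rwa [Set.ncard_univ, Nat.card_eq_fintype_card, Fintype.card_set, ← Nat.card_eq_fintype_card] at h2

/-- A number that orders hypergraphs by their number of vertices, and those with the same number of
vertices by decreasing number of edges. -/
noncomputable def rank (H : FinHypergraph) : ℕ := 2 ^ (Nat.card H.V + 1) - {S | H.IsEdge S}.ncard

/-- Either the target has fewer vertices, or `φ` is a bijection and embeds the edges of `F` into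
those of `K`. In the second case, either all edges of `K` are images, so that `φ` is an isomorphism,
or `K` has more edges and therefore smaller rank. -/
theorem IsSurjHom.iso_or_rank_lt {F K : FinHypergraph} {φ : F.V → K.V} (h : IsSurjHom F K φ) :
    K.Iso F ∨ K.rank < F.rank := by
  have hF := F.ncard_isEdge_lt
  rcases (Nat.card_le_card_of_surjective φ h.1).lt_or_eq with hlt | heq
  · right
    have h1 : 2 ^ (Nat.card K.V + 1) ≤ 2 ^ Nat.card F.V := Nat.pow_le_pow_right two_pos hlt
    rw [rank, rank, pow_succ 2 (Nat.card F.V)]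
    omega
  · have hb : Function.Bijective φ := h.1.bijective_of_nat_card_le heq.ge
    have hsub : Set.image φ '' {S | F.IsEdge S} ⊆ {S | K.IsEdge S} := by
      rintro _ ⟨e, he, rfl⟩
      exact h.2 e he
    have hcard : (Set.image φ '' {S | F.IsEdge S}).ncard = {S | F.IsEdge S}.ncard :=
      Set.ncard_image_of_injective _ hb.1.image_injective
    rcases hsub.eq_or_ssubset with he | hss
    · refine Or.inl (Iso.symm ⟨Equiv.ofBijective φ hb, fun S => ⟨h.2 S, fun hS => ?_⟩⟩)
      change φ '' S ∈ {S | K.IsEdge S} at hS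
      rw [← he] at hS
      obtain ⟨T, hT, hTS⟩ := hS
      exact hb.1.image_injective hTS ▸ hT
    · right
      have h1 := Set.ncard_lt_ncard hss
      have hK := K.ncard_isEdge_lt
      rw [rank, rank, heq, pow_succ]
      rw [heq] at hK
      omega

theorem trim_self (G : FinHypergraph) : G.trim G.vertexSet = G := by
  apply FinHypergraph.ext
  · exact Set.inter_self _
  · ext e
    constructor
    · rintro ⟨-, e', he', rfl⟩
      rwa [Set.inter_eq_left.2 (G.subset_vertexSet_of_mem_edgeSet' he')]
    · intro he
      refine ⟨Set.nonempty_iff_ne_empty.2 fun h => G.empty_notMem (h ▸ he), e, he, ?_⟩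
      rw [Set.inter_eq_left.2 (G.subset_vertexSet_of_mem_edgeSet' he)]

/-- Trimmed homomorphisms with image `X` are the surjective homomorphisms to `G⟨X⟩`. -/
theorem card_isTrimHom_image_eq (F G : FinHypergraph) {X : Set ℕ} (hX : X ⊆ G.vertexSet) :
    Nat.card {φ : F.V → G.V // IsTrimHom F G φ ∧ Subtype.val '' Set.range φ = X} =
      numSurjHom F (G.trim X) := by
  let ι : (G.trim X).V → G.V := fun v => ⟨v, v.2.1⟩
  have hι : Function.Injective ι := fun u v h => Subtype.ext (congrArg (fun w : G.V => (w : ℕ)) h)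
  have hval : ∀ S : Set (G.trim X).V, Subtype.val '' (ι '' S) = Subtype.val '' S := fun S => by
    rw [← Set.image_comp]
    rfl
  have hrange : Subtype.val '' Set.range ι = X := by
    rw [← Set.image_univ, hval, Set.image_univ, Subtype.range_coe, trim_vertexSet hX]
  have key : ∀ ψ : F.V → (G.trim X).V, IsSurjHom F (G.trim X) ψ ↔
      IsTrimHom F G (ι ∘ ψ) ∧ Subtype.val '' Set.range (ι ∘ ψ) = X := by
    intro ψ
    have h1 : Function.Surjective ψ ↔ Subtype.val '' Set.range (ι ∘ ψ) = X := by
      rw [Set.range_comp, ← Set.range_eq_univ]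
      refine Iff.trans ?_ (Eq.congr_right hrange)
      rw [← Set.image_univ (f := ι), (Subtype.val_injective.image_injective).eq_iff,
        hι.image_injective.eq_iff]
    rw [IsSurjHom, h1, and_comm]
    refine and_congr_left fun hr => forall₂_congr fun e he => ?_
    -- Edges are non-empty, so the image of an edge meets the non-emptiness condition on the edges
    -- of `G⟨X⟩` automatically.
    have hne : (Subtype.val '' (ψ '' e) : Set ℕ).Nonempty := by
      rw [Set.image_nonempty, Set.image_nonempty, Set.nonempty_iff_ne_empty]
      rintro rfl
      exact F.not_isEdge_empty he
    have h2 : ∀ e' : Set G.V, (ι ∘ ψ) '' e = e' ∩ Set.range (ι ∘ ψ) ↔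
        Subtype.val '' (ψ '' e) = Subtype.val '' e' ∩ X := fun e' => by
      rw [← Subtype.val_injective.image_injective.eq_iff, Set.image_comp, hval,
        Set.image_inter Subtype.val_injective, hr]
    simp only [h2]
    constructor
    · rintro ⟨-, e', he', h⟩
      obtain ⟨S, hS, rfl⟩ := mem_edgeSet_iff.1 he'
      exact ⟨S, hS, h⟩
    · rintro ⟨S, hS, h⟩
      exact ⟨hne, _, hS, h⟩
  refine (Nat.card_congr (Equiv.ofBijective (fun ψ : {ψ // IsSurjHom F (G.trim X) ψ} =>
    (⟨ι ∘ ψ.1, (key ψ.1).1 ψ.2⟩ :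
      {φ : F.V → G.V // IsTrimHom F G φ ∧ Subtype.val '' Set.range φ = X})) ⟨?_, ?_⟩)).symm
  · intro ψ ψ' h
    exact Subtype.ext (hι.comp_left (congrArg Subtype.val h))
  · rintro ⟨φ, h, hr⟩
    have hmem : ∀ v, (φ v : ℕ) ∈ (G.trim X).vertexSet := fun v =>
      ⟨(φ v).2, hr ▸ Set.mem_image_of_mem _ (Set.mem_range_self v)⟩
    have hφ : ι ∘ (fun v => ⟨φ v, hmem v⟩) = φ := rfl
    exact ⟨⟨fun v => ⟨φ v, hmem v⟩, (key _).2 (hφ.symm ▸ ⟨h, hr⟩)⟩, rfl⟩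

/-- The trimmed homomorphisms are sorted by their image `X`. -/
theorem numTrimHom_eq_sum (F G : FinHypergraph) :
    numTrimHom F G = ∑ X ∈ G.finite.toFinset.powerset, numSurjHom F (G.trim X) := by
  classical
  have := Fintype.ofFinite F.V
  have := Fintype.ofFinite G.V
  have hmaps : ∀ φ ∈ Finset.univ.filter (IsTrimHom F G),
      (Set.toFinite (Subtype.val '' Set.range φ)).toFinset ∈ G.finite.toFinset.powerset := by
    intro φ _
    rw [Finset.mem_powerset, Set.Finite.toFinset_subset_toFinset]
    rintro _ ⟨v, -, rfl⟩
    exact v.2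
  rw [numTrimHom, Nat.card_eq_fintype_card, Fintype.card_subtype,
    Finset.card_eq_sum_card_fiberwise hmaps]
  refine Finset.sum_congr rfl fun X hX => ?_
  have hX' : (X : Set ℕ) ⊆ G.vertexSet := fun v hv =>
    G.finite.mem_toFinset.1 (Finset.mem_powerset.1 hX hv)
  rw [← card_isTrimHom_image_eq F G hX', Nat.card_eq_fintype_card, Fintype.card_subtype,
    Finset.filter_filter]
  congr 1
  ext φ
  simp only [Finset.mem_filter, Finset.mem_univ, true_and]
  rw [← Finset.coe_inj, Set.Finite.coe_toFinset]

theorem numIndTrimSub_eq_card (H G : FinHypergraph) [DecidablePred fun X : Finset ℕ =>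
    (Quotient.mk _ (G.trim X) : IsoClass) = Quotient.mk _ H] :
    numIndTrimSub H G = (G.finite.toFinset.powerset.filter fun X : Finset ℕ =>
      (Quotient.mk _ (G.trim X) : IsoClass) = Quotient.mk _ H).card := by
  rw [numIndTrimSub_eq, ← Set.ncard_coe_finset,
    ← Set.ncard_image_of_injective _ (Finset.coe_injective (α := ℕ))]
  congr 1
  ext X
  simp only [Finset.coe_filter, Finset.mem_powerset, Set.mem_image, Set.mem_ofPred_eq]
  constructor
  · rintro ⟨h1, h2⟩
    have hX := G.finite.subset h1
    refine ⟨hX.toFinset, ⟨fun v hv => ?_, ?_⟩, hX.coe_toFinset⟩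
    · exact G.finite.mem_toFinset.2 (h1 (hX.mem_toFinset.1 hv))
    · rw [hX.coe_toFinset]
      exact Quotient.sound h2
  · rintro ⟨X, ⟨h1, h2⟩, rfl⟩
    exact ⟨fun v hv => G.finite.mem_toFinset.1 (h1 hv), Quotient.exact h2⟩

/-- After numbering the vertices of a representative, the class is determined by a family of subsets
of `Fin n`, and there are finitely many such families. -/
theorem finite_isoClass_card_eq (n : ℕ) : {L : IsoClass | Nat.card L.out.V = n}.Finite := by
  have h : ∀ L : {L : IsoClass | Nat.card L.out.V = n}, Nonempty (L.1.out.V ≃ Fin n) := fun L =>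
    ⟨Finite.equivFinOfCardEq L.2⟩
  let σ := fun L => (h L).some
  refine Set.finite_coe_iff.1 (Finite.of_injective
    (fun L => {S : Set (Fin n) | L.1.out.IsEdge (σ L ⁻¹' S)}) ?_)
  rintro L L' hLL
  have hiso : L.1.out.Iso L'.1.out := by
    refine ⟨(σ L).trans (σ L').symm, fun S => ?_⟩
    have h1 := Set.ext_iff.1 hLL (σ L '' S)
    rw [Set.mem_ofPred_eq, Set.mem_ofPred_eq, Equiv.preimage_image] at h1
    rw [h1, ← Equiv.image_symm_eq_preimage, ← Set.image_comp]
    rfl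
  refine Subtype.ext ?_
  rw [← L.1.out_eq, ← L'.1.out_eq]
  exact Quotient.sound hiso

theorem finite_numSurjHom_ne_zero (F : FinHypergraph) :
    {L : IsoClass | numSurjHom F L.out ≠ 0}.Finite := by
  refine ((Set.finite_Iic (Nat.card F.V)).biUnion fun n _ => finite_isoClass_card_eq n).subset ?_
  intro L hL
  obtain ⟨φ, h⟩ := (Nat.card_ne_zero.1 hL).1
  exact Set.mem_biUnion (Set.mem_Iic.2 (Nat.card_le_card_of_surjective φ h.1)) rfl

/-- Grouping the images `X` by the isomorphism class of `G⟨X⟩` separates the dependence on `F` from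
that on `G`: the matrix of the system does not involve `G`. -/
theorem numTrimHom_eq_sum_isoClass (F G : FinHypergraph) :
    numTrimHom F G = ∑ L ∈ (finite_numSurjHom_ne_zero F).toFinset,
      numSurjHom F L.out * numIndTrimSub L.out G := by
  classical
  have h1 : ∀ X : Finset ℕ, numSurjHom F (G.trim X) =
      numSurjHom F (Quotient.mk _ (G.trim X) : IsoClass).out := fun X =>
    numSurjHom_congr_right F (Iso.symm (Quotient.mk_out (G.trim (X : Set ℕ))))
  have h2 : ∀ X : Finset ℕ, numSurjHom F (G.trim X) =
      ∑ L ∈ (finite_numSurjHom_ne_zero F).toFinset,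
        if (Quotient.mk _ (G.trim X) : IsoClass) = L then numSurjHom F L.out else 0 := by
    intro X
    rw [Finset.sum_ite_eq, h1]
    split_ifs with h
    · rfl
    · simpa using h
  rw [numTrimHom_eq_sum, Finset.sum_congr rfl fun X _ => h2 X, Finset.sum_comm]
  refine Finset.sum_congr rfl fun L _ => ?_
  rw [← Finset.sum_filter, Finset.sum_const, numIndTrimSub_eq_card, Quotient.out_eq, smul_eq_mul,
    mul_comm]

theorem IsoClass.numTrimHom_eq (F : IsoClass) (G : FinHypergraph) :
    F.numTrimHom G = FinHypergraph.numTrimHom F.out G := by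
  conv_lhs => rw [← F.out_eq]
  rfl

theorem eq_or_rank_lt {F K : IsoClass} (h : numSurjHom F.out K.out ≠ 0) :
    K = F ∨ K.out.rank < F.out.rank := by
  obtain ⟨φ, hφ⟩ := (Nat.card_ne_zero.1 h).1
  refine hφ.iso_or_rank_lt.imp_left fun h => ?_
  rw [← K.out_eq, ← F.out_eq]
  exact Quotient.sound h

/-- The right-hand side of an expansion, as a linear functional of the coefficients. -/
noncomputable def trimHomSum (G : FinHypergraph) : (IsoClass →₀ ℚ) →ₗ[ℚ] ℚ :=
  Finsupp.linearCombination ℚ fun F => (F.numTrimHom G : ℚ)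

theorem trimHomSum_apply (G : FinHypergraph) (γ : IsoClass →₀ ℚ) :
    trimHomSum G γ = γ.sum fun F c => c * (F.numTrimHom G : ℚ) := rfl

/-- Row `K` of the triangular system is solved for `#IndTrimSub(K, ·)`; the other terms have smaller
rank and are expanded by induction. The rank condition on the support shows that these expansions do
not involve `K`, so the coefficient of `K` is the inverse of the diagonal entry. -/
theorem exists_trimHom_expansion (K : IsoClass) : ∃ γ : IsoClass →₀ ℚ,
    IsTrimHomExpansion (numIndTrimSub K.out) γ ∧ γ K ≠ 0 ∧
      ∀ F, γ F ≠ 0 → F = K ∨ F.out.rank < K.out.rank := by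
  classical
  induction hN : K.out.rank using Nat.strong_induction_on generalizing K with
  | _ N ih =>
  subst hN
  -- The rank condition is placed inside the existential so that `choose` yields a total function;
  -- classes of larger or equal rank get the dummy value `0`.
  have hex : ∀ L : IsoClass, ∃ γ : IsoClass →₀ ℚ, L.out.rank < K.out.rank →
      IsTrimHomExpansion (numIndTrimSub L.out) γ ∧ ∀ F, γ F ≠ 0 → F.out.rank < K.out.rank := by
    intro L
    by_cases hL : L.out.rank < K.out.rank
    · obtain ⟨γ, h1, -, h3⟩ := ih _ hL L rfl
      refine ⟨γ, fun _ => ⟨h1, fun F hF => ?_⟩⟩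
      rcases h3 F hF with rfl | h
      exacts [hL, h.trans hL]
    · exact ⟨0, fun h => (hL h).elim⟩
  choose g hg using hex
  have hself := (numSurjHom_self_pos K.out).ne'
  let T := (finite_numSurjHom_ne_zero K.out).toFinset
  have hKT : K ∈ T := (Set.Finite.mem_toFinset _).2 hself
  have hlt : ∀ L ∈ T.erase K, L.out.rank < K.out.rank := by
    intro L hL
    obtain ⟨h1, h2⟩ := Finset.mem_erase.1 hL
    exact (eq_or_rank_lt ((Set.Finite.mem_toFinset _).1 h2)).resolve_left h1
  obtain ⟨a, ha⟩ : ∃ a : ℚ, a = numSurjHom K.out K.out := ⟨_, rfl⟩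
  have ha0 : a ≠ 0 := ha ▸ Nat.cast_ne_zero.2 hself
  let δ : IsoClass →₀ ℚ := ∑ L ∈ T.erase K, (numSurjHom K.out L.out : ℚ) • g L
  have hδ : ∀ F, δ F ≠ 0 → F.out.rank < K.out.rank := by
    intro F hF
    rw [Finsupp.finsetSum_apply] at hF
    obtain ⟨L, hL, h⟩ := Finset.exists_ne_zero_of_sum_ne_zero hF
    refine (hg L (hlt L hL)).2 F fun h0 => h ?_
    rw [Finsupp.smul_apply, h0, smul_zero]
  have hδK : δ K = 0 := by_contra fun h => (hδ K h).false
  refine ⟨a⁻¹ • (Finsupp.single K 1 - δ), fun G => ?_, ?_, fun F hF => ?_⟩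
  · have hsum : trimHomSum G δ =
        ∑ L ∈ T.erase K, (numSurjHom K.out L.out : ℚ) * numIndTrimSub L.out G := by
      rw [map_sum]
      refine Finset.sum_congr rfl fun L hL => ?_
      rw [map_smul, smul_eq_mul, trimHomSum_apply, ← (hg L (hlt L hL)).1 G]
    have htot : (K.numTrimHom G : ℚ) = a * numIndTrimSub K.out G + trimHomSum G δ := by
      rw [hsum, ha, Finset.add_sum_erase T
        (fun L => (numSurjHom K.out L.out : ℚ) * numIndTrimSub L.out G) hKT,
        IsoClass.numTrimHom_eq, numTrimHom_eq_sum_isoClass]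
      push_cast
      rfl
    have hsingle : trimHomSum G (Finsupp.single K 1) = K.numTrimHom G := by
      rw [trimHomSum, Finsupp.linearCombination_single, one_smul]
    rw [← trimHomSum_apply, map_smul, map_sub, hsingle, htot, smul_eq_mul]
    field_simp
    ring
  · rw [Finsupp.smul_apply, Finsupp.sub_apply, hδK, Finsupp.single_eq_same]
    simpa using ha0
  · by_cases hFK : F = K
    · exact Or.inl hFK
    · refine Or.inr (hδ F fun h0 => hF ?_)
      rw [Finsupp.smul_apply, Finsupp.sub_apply, h0, Finsupp.single_eq_of_ne hFK]
      simp

/-- Expanding the vanishing sum over images `X`, the proper subsets contribute zero by induction on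
the number of vertices, and `X = V(G)` gives back `G` itself. -/
theorem sum_numSurjHom_eq_zero {γ : IsoClass →₀ ℚ} (h : ∀ G, trimHomSum G γ = 0)
    (G : FinHypergraph) : (γ.sum fun F c => c * (numSurjHom F.out G : ℚ)) = 0 := by
  classical
  induction hN : G.vertexSet.ncard using Nat.strong_induction_on generalizing G with
  | _ N ih =>
  subst hN
  have h1 := h G
  rw [trimHomSum_apply, Finsupp.sum] at h1
  simp only [IsoClass.numTrimHom_eq, numTrimHom_eq_sum, Nat.cast_sum, Finset.mul_sum] at h1
  rw [Finset.sum_comm, Finset.sum_eq_single_of_mem G.finite.toFinset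
    (Finset.mem_powerset_self _)] at h1
  · rwa [Set.Finite.coe_toFinset, trim_self] at h1
  · intro X hX hne
    have hX' : (X : Set ℕ) ⊆ G.vertexSet := fun v hv =>
      G.finite.mem_toFinset.1 (Finset.mem_powerset.1 hX hv)
    refine ih _ ?_ _ rfl
    rw [trim_vertexSet hX']
    refine Set.ncard_lt_ncard (hX'.ssubset_of_ne fun h => hne ?_) G.finite
    rw [← Finset.coe_inj, h, Set.Finite.coe_toFinset]

/-- Evaluated at a member `F₀` of the support with maximal rank, the sum has only its diagonal term:
another `F` in the support with a surjection to `F₀` would have larger rank. -/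
theorem eq_zero_of_trimHomSum_eq_zero {γ : IsoClass →₀ ℚ} (h : ∀ G, trimHomSum G γ = 0) :
    γ = 0 := by
  by_contra hγ
  obtain ⟨F₀, hF₀, hmax⟩ := γ.support.exists_max_image (fun F => F.out.rank)
    (Finsupp.support_nonempty_iff.2 hγ)
  have h1 := sum_numSurjHom_eq_zero h F₀.out
  rw [Finsupp.sum, Finset.sum_eq_single_of_mem F₀ hF₀] at h1
  · exact mul_ne_zero (Finsupp.mem_support_iff.1 hF₀)
      (Nat.cast_ne_zero.2 (numSurjHom_self_pos F₀.out).ne') h1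
  · intro F hF hne
    rw [mul_eq_zero, Nat.cast_eq_zero]
    by_contra! hc
    rcases eq_or_rank_lt hc.2 with rfl | hlt
    exacts [hne rfl, (hmax F hF).not_gt hlt]

theorem IsTrimHomExpansion.unique {g : FinHypergraph → ℕ} {γ γ' : IsoClass →₀ ℚ}
    (h : IsTrimHomExpansion g γ) (h' : IsTrimHomExpansion g γ') : γ' = γ := by
  refine sub_eq_zero.1 (eq_zero_of_trimHomSum_eq_zero fun G => ?_)
  rw [map_sub, trimHomSum_apply, trimHomSum_apply, ← h G, ← h' G, sub_self]

theorem existsUnique_trimHom_expansion (H : FinHypergraph) : ∃ γ : IsoClass →₀ ℚ,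
    IsTrimHomExpansion (numIndTrimSub H) γ ∧
      (∀ γ' : IsoClass →₀ ℚ, IsTrimHomExpansion (numIndTrimSub H) γ' → γ' = γ) ∧
      γ (Quotient.mk _ H) ≠ 0 := by
  classical
  obtain ⟨γ, h, h0, -⟩ := exists_trimHom_expansion (Quotient.mk _ H)
  have hH : numIndTrimSub (Quotient.mk isoSetoid H).out = numIndTrimSub H := by
    funext G
    rw [numIndTrimSub_eq_card, numIndTrimSub_eq_card, Quotient.out_eq]
  rw [hH] at h
  exact ⟨γ, h, fun γ' h' => h.unique h', h0⟩

end FinHypergraph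

theorem mainTheorem9 :
    -- counting trimmed homomorphisms from the single-edge hypergraphs is hard
    (trimHomProblem FinHypergraph.singleEdgeFamily).SharpW2Hard ∧
    -- the lower bound under SETH, for `k` as part of the input
    (SETH → ¬ ∃ (p : Prog) (f : ℕ → ℕ) (c ε : ℝ), Computable f ∧ 0 < ε ∧
      ∀ x : PatternInst FinHypergraph.singleEdgeFamily, 1 ≤ x.G.n →
        p.Computes noOracle x.word
          (FinHypergraph.numTrimHom x.H.toFinHypergraph x.G.toFinHypergraph)
          (f x.H.n * (c * (x.G.n : ℝ) ^ ((x.H.n : ℝ) - ε)))) ∧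
    -- the lower bound under SETH, for every fixed `k ≥ 3`, already on hosts with `|E| ≤ |V|`
    (SETH → ∀ k : ℕ, 3 ≤ k → ¬ ∃ (p : Prog) (c ε : ℝ), 0 < ε ∧
      ∀ x : PatternInst FinHypergraph.singleEdgeFamily,
        x.H.n = k → 1 ≤ x.G.n → x.G.m ≤ x.G.n →
        p.Computes noOracle x.word
          (FinHypergraph.numTrimHom x.H.toFinHypergraph x.G.toFinHypergraph)
          (c * (x.G.n : ℝ) ^ ((k : ℝ) - ε))) ∧
    -- counting induced trimmed sub-hypergraphs is easy
    (indTrimSubProblem FinHypergraph.singleEdgeFamily).PolyTime ∧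
    -- the trimmed-homomorphism expansion exists, is unique, and contains `#TrimHom(B_k, ·)`
    (∀ (k : ℕ) (hk : 0 < k), ∃ γ : FinHypergraph.IsoClass →₀ ℚ,
      FinHypergraph.IsTrimHomExpansion
        (FinHypergraph.numIndTrimSub (FinHypergraph.singleEdge k hk)) γ ∧
      (∀ γ' : FinHypergraph.IsoClass →₀ ℚ, FinHypergraph.IsTrimHomExpansion
        (FinHypergraph.numIndTrimSub (FinHypergraph.singleEdge k hk)) γ' → γ' = γ) ∧
      γ (Quotient.mk _ (FinHypergraph.singleEdge k hk)) ≠ 0) ∧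
    -- complexity monotonicity fails
    (¬ domSetProblem.FPT →
      ¬ (trimHomProblem FinHypergraph.singleEdgeFamily).FPTReducible
        (indTrimSubProblem FinHypergraph.singleEdgeFamily)) :=
  ⟨sharpW2Hard_trimHomProblem, fun hS => hS.not_computes,
    fun hS _ hk => hS.not_computes_fixed (by omega), polyTime_indTrimSubProblem,
    fun k hk => FinHypergraph.existsUnique_trimHom_expansion (FinHypergraph.singleEdge k hk),
    not_fptReducible_of_not_fpt polyTime_indTrimSubProblem⟩
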